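/- **Setting.** Consider an episodic MDP with measurable state space $\mathcal S$, finite action space $\mathcal A$, $H$ steps per episode and $K$ episodes; put $T=KH$. In episode $k$ and step $h$ the transition kernel is $\mathbb P_h^k(\cdot\mid s,a)$ and the deterministic reward is $r_h^k(s,a)\in[0,1]$. The MDP is *linear*: for a known measurable feature map $\phi:\mathcal S\times\mathcal A\to\mathbb R^d$ there are, for all $(k,h)$, vectors $\theta_{h,k}\in\mathbb R^d$ and vectors $\mu_{h,k}=(\mu^1_{h,k},\dots,\mu^d_{h,k})$ of finite signed measures on $\mathcal S$ with $\mathbb P_h^k(B\mid s,a)=\sum_i\phi_i(s,a)\mu^i_{h,k}(B)$ for every measurable $B$ and $r_h^k(s,a)=\langle\phi(s,a),\theta_{h,k}\rangle$. For a vector $\nu=(\nu^1,\dots,\nu^d)$ of signed measures let $\|\nu\|$ be the Euclidean norm of $(|\nu^1|(\mathcal S),\dots,|\nu^d|(\mathcal S))$, where $|\nu^i|$ is the total variation of $\nu^i$. It is assumed that $\|\phi(s,a)\|_2\le1$, $\|\theta_{h,k}\|_2\le\sqrt d$ and $\|\mu_{h,k}\|\le\sqrt d$. The variation budgets are $$B_\theta=\sum_{k=2}^K\sum_{h=1}^H\|\theta_{h,k}-\theta_{h,k-1}\|_2,\qquad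 B_\mu=\sum_{k=2}^K\sum_{h=1}^H\|\mu_{h,k}-\mu_{h,k-1}\| .$$ The initial state $s_1^k$ of each episode is chosen by an adversary, possibly depending on the past. For a policy $\pi=(\pi_h)_h$, $V^\pi_{h,k}(s)$ is the expected sum of the rewards of steps $h,\dots,H$ of episode $k$ from state $s$ at step $h$ under $\pi$, and $V^*_{h,k}=\sup_\pi V^\pi_{h,k}$. **Algorithm LSVI-UCB-Restart** (epoch length $W$, bonus factor $\beta$). The episodes are split into consecutive epochs of $W/H$ episodes (the last one may be shorter). In episode $k$ of an epoch with first episode $\tau$, write $\phi_h^l=\phi(s_h^l,a_h^l)$, set $V_{H+1}^k=0$ and, for $h=H,\dots,1$, $$\Lambda_h^k=I+\sum_{l=\tau}^{k-1}\phi_h^l(\phi_h^l)^\top,\qquad w_h^k=(\Lambda_h^k)^{-1}\sum_{l=\tau}^{k-1}\phi_h^l\big[r_h^l(s_h^l,a_h^l)+V_{h+1}^k(s_{h+1}^l)\big],$$ $$Q_h^k(s,a)=\min\Big\{\langle w_h^k,\phi(s,a)\rangle+\beta\sqrt{\phi(s,a)^\top(\Lambda_h^k)^{-1}\phi(s,a)},\,H\Big\},\qquad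 V_h^k(s)=\max_aQ_h^k(s,a);$$ then play the greedy policy $\pi^k_h(s)\in\arg\max_aQ_h^k(s,a)$, with any fixed measurable tie-breaking rule. The algorithm uses neither $B_\theta$ nor $B_\mu$. The dynamic regret is $\text{Dyn-Reg}(T)=\sum_{k=1}^K\big[V^*_{1,k}(s_1^k)-V^{\pi^k}_{1,k}(s_1^k)\big]$. **Theorem.** There is an absolute constant $c_0>0$ such that for every $c\ge c_0$ there are constants $C>0$ and $q\in\mathbb N$, depending only on $c$, with the following property. Let $p\in(0,1)$, let $W$ be a positive multiple of $H$ with $W\le T$, and set $\beta=c\,dH\sqrt{\log(2dT/p)}$. Then on every nonstationary linear MDP as above, with probability at least $1-p$, LSVI-UCB-Restart satisfies $$\text{Dyn-Reg}(T)\le C\,\big(\log(2dT/p)\big)^q\Big(W^{-1/2}\,T\,d^{3/2}H^{3/2}+B_\theta\,d^{1/2}H^{-1/2}W^{3/2}+B_\mu\,d^{1/2}H^{1/2}W^{3/2}\Big).$$ -/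

import Mathlib

open MeasureTheory ProbabilityTheory

namespace NonstationaryRL

noncomputable section

/-- A nonstationary episodic Markov decision process with state space `S`, action space `A`,
`H` steps per episode and `K` episodes.  Episodes and steps are numbered from `0`: the episodes
are `k < K` and the steps are `h < H`; values at other indices play no role.  `P k h (s, a)` is
the law of the next state and `r k h s a ∈ [0, 1]` the deterministic reward when action `a` is
taken in state `s` at step `h` of episode `k`. -/
structure EpisodicMDP (S A : Type*) [MeasurableSpace S] [MeasurableSpace A] (H K : ℕ) where
  P : ℕ → ℕ → Kernel (S × A) S
  r : ℕ → ℕ → S → A → ℝ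
  isMarkov : ∀ k < K, ∀ h < H, IsMarkovKernel (P k h)
  reward_mem : ∀ k < K, ∀ h < H, ∀ s a, r k h s a ∈ Set.Icc (0 : ℝ) 1

/-- The size of a vector `ν = (ν¹, …, νᵈ)` of finite signed measures: the Euclidean norm of the
vector `(|ν¹|(S), …, |νᵈ|(S))` of total variations.  For nonnegative measures this is the
Euclidean norm of `(ν¹(S), …, νᵈ(S))`. -/
def tvNorm {S : Type*} [MeasurableSpace S] {d : ℕ} (ν : Fin d → SignedMeasure S) : ℝ :=
  ‖WithLp.toLp 2 (fun i => (ν i).totalVariation.real Set.univ)‖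

/-- A nonstationary linear MDP of dimension `d`: with respect to a feature map `φ`, transition
probabilities and rewards of every step of every episode are linear, with parameters `μ k h`
(a vector of signed measures) and `θ k h`, under the usual normalization. -/
structure LinearMDP (S A : Type*) [MeasurableSpace S] [MeasurableSpace A] (d H K : ℕ)
    extends EpisodicMDP S A H K where
  φ : S → A → EuclideanSpace ℝ (Fin d)
  μ : ℕ → ℕ → Fin d → SignedMeasure S
  θ : ℕ → ℕ → EuclideanSpace ℝ (Fin d)
  measurable_feature : Measurable fun x : S × A => φ x.1 x.2
  transition_eq : ∀ k < K, ∀ h < H, ∀ s a, ∀ B : Set S, MeasurableSet B →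
    (P k h (s, a)).real B = ∑ i, φ s a i * μ k h i B
  reward_eq : ∀ k < K, ∀ h < H, ∀ s a, r k h s a = ∑ i, φ s a i * θ k h i
  norm_feature_le : ∀ s a, ‖φ s a‖ ≤ 1
  norm_measure_le : ∀ k < K, ∀ h < H, tvNorm (μ k h) ≤ √(d : ℝ)
  norm_theta_le : ∀ k < K, ∀ h < H, ‖θ k h‖ ≤ √(d : ℝ)

section Values

variable {S A : Type*} [MeasurableSpace S] [MeasurableSpace A] {H K : ℕ}

/-- `M.policyValue k π h s` is `V^π_{h,k}(s)`: the expected sum of the rewards of the steps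
`h, …, H - 1` of episode `k` when the state at step `h` is `s` and the action at each step `j` is
`π j` applied to the current state. -/
def EpisodicMDP.policyValue (M : EpisodicMDP S A H K) (k : ℕ) (π : ℕ → S → A) (h : ℕ) : S → ℝ :=
  fun s =>
    if h < H then
      M.r k h s (π h s) + ∫ s', M.policyValue k π (h + 1) s' ∂(M.P k h (s, π h s))
    else 0
termination_by H - h

/-- `V^*_{h,k}(s)`: the supremum of `V^π_{h,k}(s)` over all (measurable) policies `π`. -/
def EpisodicMDP.optimalValue (M : EpisodicMDP S A H K) (k h : ℕ) (s : S) : ℝ :=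
  ⨆ π : {π : ℕ → S → A // ∀ j, Measurable (π j)}, M.policyValue k π.1 h s

/-- The variation budget of the rewards. -/
def LinearMDP.Btheta {d : ℕ} (M : LinearMDP S A d H K) : ℝ :=
  ∑ k ∈ Finset.Ico 1 K, ∑ h ∈ Finset.range H, ‖M.θ k h - M.θ (k - 1) h‖

/-- The variation budget of the transitions. -/
def LinearMDP.Bmu {d : ℕ} (M : LinearMDP S A d H K) : ℝ :=
  ∑ k ∈ Finset.Ico 1 K, ∑ h ∈ Finset.range H, tvNorm (fun i => M.μ k h i - M.μ (k - 1) h i)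

end Values

/-- The data seen by the learner: states, actions and received rewards, by episode and step. -/
structure Log (S A : Type*) where
  state : ℕ → ℕ → S
  action : ℕ → ℕ → A
  reward : ℕ → ℕ → ℝ

/-! ### The algorithm LSVI-UCB-Restart

Its inputs are the feature map `φ`, the episode length `H`, the epoch length `W` (in time steps; an
epoch consists of `W / H` episodes), the bonus factor `β`, and the data `D` collected so far. -/

section Algorithm

variable {S A : Type*} {d : ℕ}

/-- The first episode `τ` of the epoch that contains episode `k`. -/
def epochStart (H W k : ℕ) : ℕ := k / (W / H) * (W / H)

/-- The regularized Gram matrix `Λ_h^k = I + ∑_{l=τ}^{k-1} φ(s_h^l, a_h^l) φ(s_h^l, a_h^l)ᵀ`. -/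
def gram (φ : S → A → EuclideanSpace ℝ (Fin d)) (H W : ℕ) (D : Log S A) (k h : ℕ) :
    Matrix (Fin d) (Fin d) ℝ :=
  1 + ∑ l ∈ Finset.Ico (epochStart H W k) k,
    Matrix.vecMulVec (φ (D.state l h) (D.action l h)).ofLp (φ (D.state l h) (D.action l h)).ofLp

/-- The least-squares weights
`w_h^k = (Λ_h^k)⁻¹ ∑_{l=τ}^{k-1} φ(s_h^l, a_h^l) [r_h^l(s_h^l, a_h^l) + V(s_{h+1}^l)]`
for a given value function `V` of the next step. -/
def weight (φ : S → A → EuclideanSpace ℝ (Fin d)) (H W : ℕ) (D : Log S A) (k h : ℕ) (V : S → ℝ) :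
    Fin d → ℝ :=
  Matrix.mulVec (gram φ H W D k h)⁻¹
    (∑ l ∈ Finset.Ico (epochStart H W k) k,
      (D.reward l h + V (D.state l (h + 1))) • (φ (D.state l h) (D.action l h)).ofLp)

/-- The action-value estimate
`Q_h^k(s, a) = min {⟨w_h^k, φ(s, a)⟩ + β ‖φ(s, a)‖_{(Λ_h^k)⁻¹}, H}`, computed backwards in `h`
with `V_{h+1}^k = max_b Q_{h+1}^k(·, b)`, and with value `0` after the last step. -/
def estQ (φ : S → A → EuclideanSpace ℝ (Fin d)) (H W : ℕ) (β : ℝ) (D : Log S A) (k h : ℕ) :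
    S → A → ℝ :=
  fun s a =>
    if h < H then
      min (dotProduct (weight φ H W D k h (fun s' => ⨆ b, estQ φ H W β D k (h + 1) s' b))
            (φ s a).ofLp
          + β * √(dotProduct (φ s a).ofLp
              (Matrix.mulVec (gram φ H W D k h)⁻¹ (φ s a).ofLp)))
        (H : ℝ)
    else 0
termination_by H - h

/-- The policy executed in episode `k`: greedy with respect to `Q_h^k`, where `sel` picks a
maximizer of a function on the action space. -/
def greedyPolicy (φ : S → A → EuclideanSpace ℝ (Fin d)) (H W : ℕ) (β : ℝ)
    (sel : (A → ℝ) → A) (D : Log S A) (k : ℕ) : ℕ → S → A :=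
  fun h s => sel (estQ φ H W β D k h s)

end Algorithm

section Run

variable {S A : Type*} [MeasurableSpace S] [MeasurableSpace A] {d H K : ℕ}
  {Ω : Type*} {mΩ : MeasurableSpace Ω}

/-- The random data produced by states `s`, actions `a` (by episode and step) in the MDP `M`. -/
def runLog (M : EpisodicMDP S A H K) (s : ℕ → ℕ → Ω → S) (a : ℕ → ℕ → Ω → A) (ω : Ω) :
    Log S A where
  state k h := s k h ω
  action k h := a k h ω
  reward k h := M.r k h (s k h ω) (a k h ω)

/-- The states `s` and actions `a` form a run of LSVI-UCB-Restart on the linear MDP `M`.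
The information available at step `h` of episode `k`, that is at time `k * H + h`, is the
sigma-algebra `ℱ (k * H + h)`.  The initial states `s k 0` are chosen by an adversary: they may
depend in any way on that information. -/
structure IsRun (M : LinearMDP S A d H K) (W : ℕ) (β : ℝ) (sel : (A → ℝ) → A)
    (Pr : Measure Ω) (ℱ : Filtration ℕ mΩ) (s : ℕ → ℕ → Ω → S) (a : ℕ → ℕ → Ω → A) : Prop where
  adapted : ∀ k < K, ∀ h < H, Measurable[ℱ (k * H + h)] (s k h)
  transition : ∀ k < K, ∀ h, h + 1 < H → ∀ B : Set S, MeasurableSet B →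
    Pr[fun ω => B.indicator (fun _ => (1 : ℝ)) (s k (h + 1) ω) | ℱ (k * H + h)]
      =ᵐ[Pr] fun ω => (M.P k h (s k h ω, a k h ω)).real B
  action : ∀ k < K, ∀ h < H, ∀ ω,
    a k h ω = greedyPolicy M.φ H W β sel (runLog M.toEpisodicMDP s a ω) k h (s k h ω)

/-- The dynamic regret `∑_k (V^*_{1,k}(s_1^k) - V^{π^k}_{1,k}(s_1^k))` of a run, where `π^k` is the
policy that LSVI-UCB-Restart executes in episode `k`. -/
def dynRegret (M : LinearMDP S A d H K) (W : ℕ) (β : ℝ) (sel : (A → ℝ) → A)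
    (s : ℕ → ℕ → Ω → S) (a : ℕ → ℕ → Ω → A) (ω : Ω) : ℝ :=
  ∑ k ∈ Finset.range K,
    (M.optimalValue k 0 (s k 0 ω)
      - M.policyValue k
          (greedyPolicy M.φ H W β sel (runLog M.toEpisodicMDP s a ω) k) 0 (s k 0 ω))

end Run

end

end NonstationaryRL

/-!
The regret of an episode is controlled by optimism, separately in every epoch.

A linear MDP turns the one-step target `r + P V` into a linear function of the feature, with a
parameter vector whose change between episodes is bounded by the variation of `θ` and `μ`
(`LinearMDP.norm_targetVec_sub_le_sum`). The least-squares prediction of the target is therefore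
correct up to three errors (`LinearMDP.abs_weight_dotProduct_sub_le`): the regularization bias and
the sampling noise, both of which are multiples of the bonus `‖φ‖` in the inverse Gram matrix, and a
drift term, `√L` times the variation in the epoch, for epochs of `L = W / H` episodes. When the
bonus factor `β` exceeds the first two multiples, the value estimates dominate the optimal values up
to the drift (`LinearMDP.GoodEpisode.optimism`), and the regret of the episode is at most the sum of
twice the bonuses, the drift and a martingale term (`LinearMDP.GoodEpisode.regret_le`).

The estimates are truncated from above only. A lower bound on them, which concentration needs, comes
from optimism when the total drift is at most `1`; in an episode where it is larger, the drift term
alone exceeds the trivial bound on the regret (`dynRegret_le`). Whether it is larger depends on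
the parameters of the MDP only, so that the episodes can be sorted before the run.

For the noise, the value estimates depend on the data, but lie in a family with parameters
`(w, Λ⁻¹)`. The self-normalized bound is reduced to a union bound: for a fixed direction `u` and
a fixed value function `V`, the exponential of
`∑ l, (⟪u, φ l⟫ * noise l - ⟪u, φ l⟫ ^ 2 / 2)`, for noise normalized to `[-1, 1]`, has
expectation at most `1` (`integral_exp_sum_le_one`). A union bound over a grid of
directions and parameters (`IsRun.exists_event`) and a continuity argument
(`LinearMDP.abs_sum_noise_le`), applied to the direction proportional to `Λ⁻¹ φ`, give a bound by a
multiple of the bonus of order `d H √log`, which `β` exceeds once `c ≥ 1000`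
(`exists_discretization`). The same exponential inequality bounds the martingale term.

It remains to add up. The elliptical potential lemma (`sum_dotProduct_regGram_inv_le`) bounds the
bonuses, every change of the parameters is counted once for each episode of its epoch
(`LinearMDP.sum_epochVariation_le`), and `regret_terms_le` compares the result with the claim. One
factor of the logarithm suffices.
-/

open MeasureTheory ProbabilityTheory

namespace NonstationaryRL

/-! ### Integrals against signed measures -/

section SignedMeasure

variable {S : Type*} [MeasurableSpace S]

/-- The integral of a real function against a signed measure. -/
noncomputable def signedIntegral (ν : SignedMeasure S) (f : S → ℝ) : ℝ :=
  ν.integral f (ContinuousLinearMap.lsmul ℝ ℝ).flip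

lemma integrable_signedMeasure_of_bounded {f : S → ℝ} (hf : Measurable f) {b : ℝ}
    (hb : ∀ x, |f x| ≤ b) (ν : SignedMeasure S) : ν.Integrable f := by
  have : IsFiniteMeasure ν.variation := by
    rw [← SignedMeasure.totalVariation_eq_variation]; infer_instance
  exact MeasureTheory.Integrable.of_bound hf.aestronglyMeasurable b
    (Filter.Eventually.of_forall hb)

/-- A bounded function integrates to at most its bound times the total variation. No measurability
is needed, since the integral of a non-integrable function is `0`. -/
lemma abs_signedIntegral_le {f : S → ℝ} {b : ℝ} (hb0 : 0 ≤ b) (hb : ∀ x, |f x| ≤ b)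
    (ν : SignedMeasure S) :
    |signedIntegral ν f| ≤ b * ν.totalVariation.real Set.univ := by
  have : IsFiniteMeasure ν.variation := by
    rw [← SignedMeasure.totalVariation_eq_variation]; infer_instance
  have h := VectorMeasure.norm_integral_le_of_norm_le_const (μ := ν)
    (B := (ContinuousLinearMap.lsmul ℝ ℝ).flip) (f := f) (C := b) (Filter.Eventually.of_forall hb)
  rw [← SignedMeasure.totalVariation_eq_variation] at h
  refine h.trans ?_
  have h1 : ‖(ContinuousLinearMap.lsmul ℝ ℝ : ℝ →L[ℝ] ℝ →L[ℝ] ℝ).flip‖ ≤ 1 := by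
    rw [ContinuousLinearMap.opNorm_flip]; exact ContinuousLinearMap.opNorm_lsmul_le
  have h2 : 0 ≤ ν.totalVariation.real Set.univ := measureReal_nonneg
  gcongr
  nlinarith

lemma signedIntegral_sub {f : S → ℝ} (hf : Measurable f) {b : ℝ} (hb : ∀ x, |f x| ≤ b)
    (ν ν' : SignedMeasure S) :
    signedIntegral (ν - ν') f = signedIntegral ν f - signedIntegral ν' f :=
  VectorMeasure.integral_sub_vectorMeasure (integrable_signedMeasure_of_bounded hf hb ν)
    (integrable_signedMeasure_of_bounded hf hb ν')

/-- If a finite measure is a linear combination of signed measures, then so is its integral. -/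
lemma integral_eq_sum_signedIntegral {ι : Type*} [Fintype ι] (m : Measure S) [IsFiniteMeasure m]
    (c : ι → ℝ) (ν : ι → SignedMeasure S)
    (h : ∀ B, MeasurableSet B → m.real B = ∑ i, c i * ν i B)
    {f : S → ℝ} (hf : Measurable f) {b : ℝ} (hb : ∀ x, |f x| ≤ b) :
    ∫ x, f x ∂m = ∑ i, c i * signedIntegral (ν i) f := by
  have h1 : m.toSignedMeasure = ∑ i, c i • ν i := by
    ext B hB
    rw [Measure.toSignedMeasure_apply_measurable hB, h B hB]
    simp
  rw [← VectorMeasure.integral_toSignedMeasure, h1,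
    VectorMeasure.integral_finsetSum_vectorMeasure]
  · simp [signedIntegral, VectorMeasure.integral_smul_vectorMeasure]
  · intro i _
    exact (integrable_signedMeasure_of_bounded hf hb (ν i)).smul_vectorMeasure _

end SignedMeasure

/-! ### Conditional laws and an exponential inequality for martingale differences -/

section Martingale

variable {Ω : Type*} {mΩ : MeasurableSpace Ω} {Pr : Measure Ω}

/-- If `κ` is the conditional law of `X` given `Y`, tested on measurable rectangles, then a bounded
function of `Y` and `X` may be averaged over `X` under `κ`. -/
lemma integral_comp_eq_integral_kernel [IsProbabilityMeasure Pr] {E S : Type*} [MeasurableSpace E]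
    [MeasurableSpace S] {Y : Ω → E} {X : Ω → S} (hY : Measurable Y) (hX : Measurable X)
    (κ : Kernel E S) [IsMarkovKernel κ]
    (h : ∀ C, MeasurableSet C → ∀ B, MeasurableSet B →
      Pr.real (Y ⁻¹' C ∩ X ⁻¹' B) = ∫ ω in Y ⁻¹' C, (κ (Y ω)).real B ∂Pr)
    {f : E × S → ℝ} (hf : Measurable f) {b : ℝ} (hb : ∀ x, |f x| ≤ b) :
    ∫ ω, f (Y ω, X ω) ∂Pr = ∫ ω, ∫ x, f (Y ω, x) ∂κ (Y ω) ∂Pr := by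
  have : IsProbabilityMeasure (Pr.map Y) := Measure.isProbabilityMeasure_map hY.aemeasurable
  have key : Pr.map (fun ω => (Y ω, X ω)) = (Pr.map Y) ⊗ₘ κ := by
    have : IsProbabilityMeasure (Pr.map fun ω => (Y ω, X ω)) :=
      Measure.isProbabilityMeasure_map (hY.prodMk hX).aemeasurable
    refine Measure.ext_prod fun {C B} hC hB => ?_
    rw [Measure.map_apply (hY.prodMk hX) (hC.prod hB), Measure.compProd_apply_prod hC hB]
    have e : (fun ω => (Y ω, X ω)) ⁻¹' C ×ˢ B = Y ⁻¹' C ∩ X ⁻¹' B := by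
      ext; simp
    rw [e, setLIntegral_map hC (κ.measurable_coe hB) hY,
      ← ofReal_measureReal (measure_ne_top _ _), h C hC B hB,
      ofReal_integral_eq_lintegral_ofReal]
    · refine lintegral_congr fun ω => ?_
      rw [ofReal_measureReal (measure_ne_top _ _)]
    · refine (Integrable.of_bound (C := 1) ?_ ?_).integrableOn
      · exact ((κ.measurable_coe hB).comp hY).ennreal_toReal.aestronglyMeasurable
      · refine Filter.Eventually.of_forall fun ω => ?_
        rw [Real.norm_eq_abs, abs_of_nonneg measureReal_nonneg]
        exact measureReal_le_one
    · exact Filter.Eventually.of_forall fun ω => measureReal_nonneg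
  have h1 : ∫ z, f z ∂(Pr.map fun ω => (Y ω, X ω)) = ∫ ω, f (Y ω, X ω) ∂Pr :=
    integral_map (hY.prodMk hX).aemeasurable hf.aestronglyMeasurable
  rw [← h1, key, Measure.integral_compProd
    (Integrable.of_bound hf.aestronglyMeasurable b (Filter.Eventually.of_forall hb)),
    integral_map hY.aemeasurable]
  exact (StronglyMeasurable.integral_kernel_prod_right' hf.stronglyMeasurable).aestronglyMeasurable

/-- If `κ ω` is the conditional law of `X` given `m`, then a bounded function of `ω` and `X ω`,
`m`-measurable in the first argument, may be averaged over the second argument under `κ ω`. -/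
lemma integral_eq_integral_condLaw {Ω : Type*} {m mΩ : MeasurableSpace Ω} {Pr : Measure Ω}
    [IsProbabilityMeasure Pr] {S : Type*} [MeasurableSpace S] (hm : m ≤ mΩ) {X : Ω → S}
    (hX : Measurable X)
    (κ : @Kernel Ω S m _) (hκ : @IsMarkovKernel _ _ m _ κ)
    (h : ∀ B, MeasurableSet B →
      Pr[fun ω => B.indicator (fun _ => (1 : ℝ)) (X ω) | m] =ᵐ[Pr] fun ω => (κ ω).real B)
    {f : Ω → S → ℝ} (hf : @Measurable _ _ (@Prod.instMeasurableSpace _ _ m _) _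
      (fun z : Ω × S => f z.1 z.2))
    {b : ℝ} (hb : ∀ ω x, |f ω x| ≤ b) :
    ∫ ω, f ω (X ω) ∂Pr = ∫ ω, ∫ x, f ω x ∂κ ω ∂Pr := by
  -- the preceding lemma for the identity map from `(Ω, mΩ)` to `(Ω, m)`
  refine @integral_comp_eq_integral_kernel Ω mΩ Pr _ Ω S m _ (fun ω => ω) X
    (measurable_id'' hm) hX κ hκ (fun C hC B hB => ?_) (fun z => f z.1 z.2) hf b
    (fun z => hb z.1 z.2)
  have hC' : MeasurableSet C := hm C hC
  have hint : Integrable (fun ω => B.indicator (fun _ => (1 : ℝ)) (X ω)) Pr := by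
    refine Integrable.of_bound (C := 1)
      ((measurable_const.indicator hB).comp hX).aestronglyMeasurable
      (Filter.Eventually.of_forall fun ω => ?_)
    by_cases hx : X ω ∈ B <;> simp [hx]
  have h1 := setIntegral_condExp hm hint hC
  rw [setIntegral_congr_ae (g := fun ω => (κ ω).real B) hC'
    ((h B hB).mono fun ω hω _ => hω)] at h1
  have e : (fun ω => B.indicator (fun _ => (1 : ℝ)) (X ω)) = (X ⁻¹' B).indicator fun _ => 1 := by
    ext ω; rfl
  rw [Set.preimage_id', h1, e, setIntegral_indicator (hX hB)]
  simp

/-- The chord of the exponential over `[-η, η]` lies above it. -/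
lemma exp_mul_le_cosh_add {x : ℝ} (hx : |x| ≤ 1) (η : ℝ) :
    Real.exp (η * x) ≤ Real.cosh η + x * Real.sinh η := by
  rw [abs_le] at hx
  have ha : 0 ≤ (1 + x) / 2 := by linarith
  have hb : 0 ≤ (1 - x) / 2 := by linarith
  have h := convexOn_exp.2 (Set.mem_univ η) (Set.mem_univ (-η)) ha hb (by ring)
  simp only [smul_eq_mul] at h
  rw [Real.cosh_eq, Real.sinh_eq]
  calc Real.exp (η * x) = Real.exp ((1 + x) / 2 * η + (1 - x) / 2 * -η) := by ring_nf
    _ ≤ _ := h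
    _ = _ := by ring

/-- **Exponential inequality** of Azuma–Hoeffding type: `ξ t` is a martingale difference with values
in `[-1, 1]` and `η t` is a bounded predictable multiplier. Measurability and boundedness are part
of the conclusion because the induction on `n` needs them. -/
lemma integral_exp_sum_le_one [IsProbabilityMeasure Pr] (ℱ : Filtration ℕ mΩ) (η ξ : ℕ → Ω → ℝ)
    {C : ℝ} (n : ℕ) (hη : ∀ t < n, Measurable[ℱ t] (η t)) (hηC : ∀ t < n, ∀ ω, |η t ω| ≤ C)
    (hξ : ∀ t < n, Measurable[ℱ (t + 1)] (ξ t)) (hξ1 : ∀ t < n, ∀ ω, |ξ t ω| ≤ 1)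
    (hmart : ∀ t < n, ∀ Z : Ω → ℝ, Measurable[ℱ t] Z → (∃ b, ∀ ω, |Z ω| ≤ b) →
      ∫ ω, Z ω * ξ t ω ∂Pr = 0) :
    (Measurable[ℱ n] fun ω => Real.exp (∑ t ∈ Finset.range n, (η t ω * ξ t ω - η t ω ^ 2 / 2))) ∧
    (∃ b, ∀ ω, Real.exp (∑ t ∈ Finset.range n, (η t ω * ξ t ω - η t ω ^ 2 / 2)) ≤ b) ∧
    ∫ ω, Real.exp (∑ t ∈ Finset.range n, (η t ω * ξ t ω - η t ω ^ 2 / 2)) ∂Pr ≤ 1 := by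
  induction n with
  | zero => exact ⟨by simp, ⟨1, by simp⟩, by simp⟩
  | succ n ih =>
    obtain ⟨hM, ⟨b, hb⟩, hI⟩ := ih (fun t ht => hη t (by omega)) (fun t ht => hηC t (by omega))
      (fun t ht => hξ t (by omega)) (fun t ht => hξ1 t (by omega))
      (fun t ht => hmart t (by omega))
    set Y : Ω → ℝ := fun ω =>
      Real.exp (∑ t ∈ Finset.range n, (η t ω * ξ t ω - η t ω ^ 2 / 2)) with hY
    have hsplit : ∀ ω, Real.exp (∑ t ∈ Finset.range (n + 1), (η t ω * ξ t ω - η t ω ^ 2 / 2))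
        = Y ω * Real.exp (η n ω * ξ n ω - η n ω ^ 2 / 2) := fun ω => by
      rw [Finset.sum_range_succ, Real.exp_add]
    simp only [hsplit]
    have hC0 : ∀ ω, 0 ≤ C := fun ω => (abs_nonneg _).trans (hηC n (by omega) ω)
    have hmono : ℱ n ≤ ℱ (n + 1) := ℱ.mono (by omega)
    have hηn : Measurable[ℱ n] (η n) := hη n (by omega)
    have hY0 : ∀ ω, 0 ≤ Y ω := fun ω => (Real.exp_pos _).le
    have hmeas : Measurable[ℱ (n + 1)]
        fun ω => Y ω * Real.exp (η n ω * ξ n ω - η n ω ^ 2 / 2) := by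
      have h1 := hηn.mono hmono le_rfl
      exact (hM.mono hmono le_rfl).mul (Real.measurable_exp.comp
        ((h1.mul (hξ n (by omega))).sub ((h1.pow_const 2).div_const 2)))
    have hbd : ∀ ω, Y ω * Real.exp (η n ω * ξ n ω - η n ω ^ 2 / 2) ≤ b * Real.exp C := by
      intro ω
      refine mul_le_mul (hb ω) (Real.exp_le_exp.2 ?_) (Real.exp_pos _).le ((hY0 ω).trans (hb ω))
      have h1 : η n ω * ξ n ω ≤ C * 1 := by
        refine (le_abs_self _).trans ?_
        rw [abs_mul]
        exact mul_le_mul (hηC n (by omega) ω) (hξ1 n (by omega) ω) (abs_nonneg _) (hC0 ω)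
      nlinarith [sq_nonneg (η n ω)]
    refine ⟨hmeas, ⟨b * Real.exp C, hbd⟩, ?_⟩
    -- the multiplier of `ξ n` in the affine upper bound of the exponential
    set G : Ω → ℝ := fun ω => Y ω * (Real.exp (-(η n ω ^ 2 / 2)) * Real.sinh (η n ω)) with hG
    have hGm : Measurable[ℱ n] G :=
      hM.mul ((Real.measurable_exp.comp ((hηn.pow_const 2).div_const 2).neg).mul
        (Real.measurable_sinh.comp hηn))
    have hGb : ∀ ω, |G ω| ≤ b * Real.exp C := by
      intro ω
      rw [hG, abs_mul, abs_of_nonneg (hY0 ω), abs_mul, Real.abs_exp]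
      refine mul_le_mul (hb ω) ?_ (by positivity) ((hY0 ω).trans (hb ω))
      have h1 : Real.exp (-(η n ω ^ 2 / 2)) ≤ 1 := by
        rw [Real.exp_le_one_iff]; nlinarith [sq_nonneg (η n ω)]
      have h2 : |Real.sinh (η n ω)| ≤ Real.exp C := by
        rw [Real.abs_sinh, Real.sinh_eq]
        have := Real.exp_pos (-|η n ω|)
        have := Real.exp_le_exp.2 (hηC n (by omega) ω)
        have := Real.exp_pos C
        linarith
      calc _ ≤ 1 * Real.exp C := mul_le_mul h1 h2 (abs_nonneg _) zero_le_one
        _ = _ := one_mul _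
    have hξm : Measurable (ξ n) := (hξ n (by omega)).mono (ℱ.le _) le_rfl
    have hYm : Measurable Y := hM.mono (ℱ.le _) le_rfl
    have hYi : Integrable Y Pr := Integrable.of_bound hYm.aestronglyMeasurable b
      (Filter.Eventually.of_forall fun ω => by
        rw [Real.norm_eq_abs, abs_of_nonneg (hY0 ω)]; exact hb ω)
    have hGi : Integrable (fun ω => G ω * ξ n ω) Pr :=
      Integrable.of_bound ((hGm.mono (ℱ.le _) le_rfl).mul hξm).aestronglyMeasurable (b * Real.exp C)
        (Filter.Eventually.of_forall fun ω => by
          rw [Real.norm_eq_abs, abs_mul]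
          calc _ ≤ b * Real.exp C * 1 := mul_le_mul (hGb ω) (hξ1 n (by omega) ω) (abs_nonneg _)
                  ((abs_nonneg _).trans (hGb ω))
            _ = _ := mul_one _)
    have hpt : ∀ ω, Y ω * Real.exp (η n ω * ξ n ω - η n ω ^ 2 / 2) ≤ Y ω + G ω * ξ n ω := by
      intro ω
      have h1 := exp_mul_le_cosh_add (hξ1 n (by omega) ω) (η n ω)
      have h2 := Real.cosh_le_exp_half_sq (η n ω)
      have h3 : Real.exp (-(η n ω ^ 2 / 2)) * Real.exp (η n ω ^ 2 / 2) = 1 := by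
        rw [← Real.exp_add]; simp
      have h4 := Real.exp_pos (-(η n ω ^ 2 / 2))
      rw [sub_eq_add_neg, Real.exp_add]
      have h5 : Real.exp (η n ω * ξ n ω) * Real.exp (-(η n ω ^ 2 / 2)) ≤
          1 + Real.exp (-(η n ω ^ 2 / 2)) * Real.sinh (η n ω) * ξ n ω := by
        nlinarith [mul_le_mul_of_nonneg_left h1 h4.le, mul_le_mul_of_nonneg_left h2 h4.le]
      have := mul_le_mul_of_nonneg_left h5 (hY0 ω)
      rw [hG]; linarith
    calc ∫ ω, Y ω * Real.exp (η n ω * ξ n ω - η n ω ^ 2 / 2) ∂Pr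
        ≤ ∫ ω, (Y ω + G ω * ξ n ω) ∂Pr := by
          refine integral_mono ?_ (hYi.add hGi) hpt
          exact Integrable.of_bound (hmeas.mono (ℱ.le _) le_rfl).aestronglyMeasurable
            (b * Real.exp C) (Filter.Eventually.of_forall fun ω => by
              rw [Real.norm_eq_abs, abs_of_nonneg (mul_nonneg (hY0 ω) (Real.exp_pos _).le)]
              exact hbd ω)
      _ = ∫ ω, Y ω ∂Pr + 0 := by
          rw [integral_add hYi hGi, hmart n (by omega) G hGm ⟨_, hGb⟩]
      _ ≤ 1 := by linarith

end Martingale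

/-! ### Regularized Gram matrices -/

section Gram

open Matrix

variable {ι n : Type*} [Fintype n] [DecidableEq n]

/-- The regularized Gram matrix `1 + ∑ l ∈ I, x l (x l)ᵀ` of a finite family of vectors. -/
def regGram (I : Finset ι) (x : ι → n → ℝ) : Matrix n n ℝ :=
  1 + ∑ l ∈ I, vecMulVec (x l) (x l)

lemma regGram_mulVec (I : Finset ι) (x : ι → n → ℝ) (y : n → ℝ) :
    regGram I x *ᵥ y = y + ∑ l ∈ I, (x l ⬝ᵥ y) • x l := by
  rw [regGram, add_mulVec, one_mulVec, sum_mulVec]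
  congr 1
  refine Finset.sum_congr rfl fun l _ => ?_
  rw [vecMulVec_mulVec]
  ext i; simp [mul_comm]

lemma regGram_posDef (I : Finset ι) (x : ι → n → ℝ) : (regGram I x).PosDef := by
  refine PosDef.one.add_posSemidef (posSemidef_sum I fun l _ => ?_)
  simpa using posSemidef_vecMulVec_self_star (x l)

lemma regGram_isUnit_det (I : Finset ι) (x : ι → n → ℝ) : IsUnit (regGram I x).det :=
  (regGram_posDef I x).det_pos.ne'.isUnit

/-- The equation `Λ y = v` for `y = Λ⁻¹ v`, written out. -/
lemma regGram_inv_mulVec_spec (I : Finset ι) (x : ι → n → ℝ) (v : n → ℝ) :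
    (regGram I x)⁻¹ *ᵥ v + ∑ l ∈ I, (x l ⬝ᵥ (regGram I x)⁻¹ *ᵥ v) • x l = v := by
  rw [← regGram_mulVec, mulVec_mulVec, mul_nonsing_inv _ (regGram_isUnit_det I x), one_mulVec]

lemma dotProduct_regGram_inv_mulVec_comm (I : Finset ι) (x : ι → n → ℝ) (v w : n → ℝ) :
    v ⬝ᵥ (regGram I x)⁻¹ *ᵥ w = w ⬝ᵥ (regGram I x)⁻¹ *ᵥ v := by
  have h : ((regGram I x)⁻¹)ᵀ = (regGram I x)⁻¹ := by
    have := (regGram_posDef I x).isHermitian.inv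
    simpa [IsHermitian, conjTranspose_eq_transpose_of_trivial] using this
  rw [dotProduct_mulVec, ← mulVec_transpose, h, dotProduct_comm]

/-- The squared norm `vᵀ Λ⁻¹ v` in terms of `y = Λ⁻¹ v`. -/
lemma dotProduct_regGram_inv_mulVec_self (I : Finset ι) (x : ι → n → ℝ) (v : n → ℝ) :
    v ⬝ᵥ (regGram I x)⁻¹ *ᵥ v = (regGram I x)⁻¹ *ᵥ v ⬝ᵥ (regGram I x)⁻¹ *ᵥ v
      + ∑ l ∈ I, (x l ⬝ᵥ (regGram I x)⁻¹ *ᵥ v) ^ 2 := by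
  have h := congrArg (· ⬝ᵥ (regGram I x)⁻¹ *ᵥ v) (regGram_inv_mulVec_spec I x v)
  simp only [add_dotProduct, sum_dotProduct, smul_dotProduct, smul_eq_mul, ← sq] at h
  exact h.symm

lemma dotProduct_regGram_inv_mulVec_self_nonneg (I : Finset ι) (x : ι → n → ℝ) (v : n → ℝ) :
    0 ≤ v ⬝ᵥ (regGram I x)⁻¹ *ᵥ v := by
  rw [dotProduct_regGram_inv_mulVec_self]
  exact add_nonneg (by simpa using dotProduct_self_star_nonneg ((regGram I x)⁻¹ *ᵥ v))
    (Finset.sum_nonneg fun _ _ => sq_nonneg _)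

lemma sum_sq_le_dotProduct_regGram_inv (I : Finset ι) (x : ι → n → ℝ) (v : n → ℝ) :
    ∑ l ∈ I, (x l ⬝ᵥ (regGram I x)⁻¹ *ᵥ v) ^ 2 ≤ v ⬝ᵥ (regGram I x)⁻¹ *ᵥ v := by
  rw [dotProduct_regGram_inv_mulVec_self]
  exact le_add_of_nonneg_left (by simpa using dotProduct_self_star_nonneg ((regGram I x)⁻¹ *ᵥ v))

lemma normSq_regGram_inv_mulVec_le (I : Finset ι) (x : ι → n → ℝ) (v : n → ℝ) :
    (regGram I x)⁻¹ *ᵥ v ⬝ᵥ (regGram I x)⁻¹ *ᵥ v ≤ v ⬝ᵥ (regGram I x)⁻¹ *ᵥ v := by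
  rw [dotProduct_regGram_inv_mulVec_self]
  exact le_add_of_nonneg_right (Finset.sum_nonneg fun _ _ => sq_nonneg _)

lemma dotProduct_regGram_inv_le (I : Finset ι) (x : ι → n → ℝ) (v : n → ℝ) :
    v ⬝ᵥ (regGram I x)⁻¹ *ᵥ v ≤ v ⬝ᵥ v := by
  have h1 := normSq_regGram_inv_mulVec_le I x v
  set y := (regGram I x)⁻¹ *ᵥ v
  have h2 : 0 ≤ (v - y) ⬝ᵥ (v - y) := by simpa using dotProduct_self_star_nonneg (v - y)
  rw [sub_dotProduct, dotProduct_sub, dotProduct_sub, dotProduct_comm y v] at h2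
  linarith

lemma abs_dotProduct_regGram_inv_le_one (I : Finset ι) (x : ι → n → ℝ) {v : n → ℝ}
    (hv : v ⬝ᵥ v ≤ 1) {l : ι} (hl : l ∈ I) : |x l ⬝ᵥ (regGram I x)⁻¹ *ᵥ v| ≤ 1 := by
  rw [← sq_le_one_iff_abs_le_one]
  calc _ ≤ ∑ l ∈ I, (x l ⬝ᵥ (regGram I x)⁻¹ *ᵥ v) ^ 2 :=
        Finset.single_le_sum (f := fun l => (x l ⬝ᵥ (regGram I x)⁻¹ *ᵥ v) ^ 2)
          (fun _ _ => sq_nonneg _) hl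
    _ ≤ _ := (sum_sq_le_dotProduct_regGram_inv I x v).trans (dotProduct_regGram_inv_le I x v)
    _ ≤ 1 := hv

lemma abs_regGram_inv_apply_le_one (I : Finset ι) (x : ι → n → ℝ) (i j : n) :
    |(regGram I x)⁻¹ i j| ≤ 1 := by
  have h0 : (Pi.single j 1 : n → ℝ) ⬝ᵥ Pi.single j 1 = 1 := by simp
  have h1 := (normSq_regGram_inv_mulVec_le I x (Pi.single j 1)).trans
    (dotProduct_regGram_inv_le I x (Pi.single j 1))
  rw [h0, dotProduct] at h1
  rw [← sq_le_one_iff_abs_le_one]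
  have h2 := Finset.single_le_sum (f := fun k => ((regGram I x)⁻¹ *ᵥ Pi.single j 1) k *
    ((regGram I x)⁻¹ *ᵥ Pi.single j 1) k) (fun _ _ => mul_self_nonneg _) (Finset.mem_univ i)
  simp only [mulVec_single_one, col_apply] at h1 h2
  rw [sq]; exact h2.trans h1

/-- A least-squares prediction is a linear combination of the responses `z l`. -/
lemma leastSquares_dotProduct (I : Finset ι) (x : ι → n → ℝ) (z : ι → ℝ) (v : n → ℝ) :
    ((regGram I x)⁻¹ *ᵥ ∑ l ∈ I, z l • x l) ⬝ᵥ v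
      = ∑ l ∈ I, z l * (x l ⬝ᵥ (regGram I x)⁻¹ *ᵥ v) := by
  rw [dotProduct_comm, dotProduct_regGram_inv_mulVec_comm, sum_dotProduct]
  simp [smul_dotProduct]

/-- The matrix determinant lemma for a rank-one update of a Gram matrix. -/
lemma det_regGram_insert [DecidableEq ι] {I : Finset ι} (x : ι → n → ℝ) {a : ι} (ha : a ∉ I) :
    (regGram (insert a I) x).det
      = (regGram I x).det * (1 + x a ⬝ᵥ (regGram I x)⁻¹ *ᵥ x a) := by
  have h : regGram (insert a I) x = regGram I x
      + replicateCol Unit (x a) * replicateRow Unit (x a) := by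
    rw [regGram, Finset.sum_insert ha, vecMulVec_eq Unit, regGram]; abel
  rw [h, det_add_replicateCol_mul_replicateRow (regGram_isUnit_det I x)]
  congr 1
  rw [det_unique, Matrix.add_apply, one_apply_eq, ← replicateRow_vecMul,
    replicateRow_mul_replicateCol_apply, ← dotProduct_mulVec]

/-- Each eigenvalue is at most the trace, which is at most `n + |I|`. -/
lemma det_regGram_le (I : Finset ι) (x : ι → n → ℝ) (hx : ∀ l ∈ I, x l ⬝ᵥ x l ≤ 1) :
    (regGram I x).det ≤ ((Fintype.card n + I.card : ℕ) : ℝ) ^ Fintype.card n := by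
  have hp := regGram_posDef I x
  have ht : (regGram I x).trace ≤ ((Fintype.card n + I.card : ℕ) : ℝ) := by
    rw [regGram, trace_add, trace_one, trace_sum]
    push_cast
    gcongr
    calc _ ≤ ∑ l ∈ I, (1 : ℝ) := by
          refine Finset.sum_le_sum fun l hl => ?_
          rw [trace_vecMulVec]; exact hx l hl
      _ = _ := by simp
  have hd := hp.isHermitian.det_eq_prod_eigenvalues
  have htr := hp.isHermitian.trace_eq_sum_eigenvalues
  simp only [RCLike.ofReal_real_eq_id, id_eq] at hd htr
  have hpos : ∀ i, 0 ≤ hp.isHermitian.eigenvalues i := fun i => (hp.eigenvalues_pos i).le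
  rw [hd]
  calc _ ≤ ∏ _i : n, ((Fintype.card n + I.card : ℕ) : ℝ) := by
        refine Finset.prod_le_prod (fun i _ => hpos i) fun i _ => ?_
        refine le_trans ?_ (htr ▸ ht)
        exact Finset.single_le_sum (fun j _ => hpos j) (Finset.mem_univ i)
    _ = _ := by simp

/-- **Elliptical potential lemma**: the squared norms of the vectors in the inverse Gram matrices of
their predecessors add up to a logarithm. -/
lemma sum_dotProduct_regGram_inv_le (x : ℕ → n → ℝ) (hx : ∀ l, x l ⬝ᵥ x l ≤ 1) (a N : ℕ) :
    ∑ i ∈ Finset.range N, x (a + i) ⬝ᵥ (regGram (Finset.Ico a (a + i)) x)⁻¹ *ᵥ x (a + i)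
      ≤ 2 * (Fintype.card n * Real.log ((Fintype.card n + N : ℕ) : ℝ)) := by
  have key : ∑ i ∈ Finset.range N,
      x (a + i) ⬝ᵥ (regGram (Finset.Ico a (a + i)) x)⁻¹ *ᵥ x (a + i)
      ≤ 2 * Real.log (regGram (Finset.Ico a (a + N)) x).det := by
    induction N with
    | zero => simp [regGram]
    | succ N ih =>
      rw [Finset.sum_range_succ]
      have hI : Finset.Ico a (a + (N + 1)) = insert (a + N) (Finset.Ico a (a + N)) := by
        ext; simp; omega
      rw [hI, det_regGram_insert x (by simp)]
      set b := x (a + N) ⬝ᵥ (regGram (Finset.Ico a (a + N)) x)⁻¹ *ᵥ x (a + N) with hb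
      have hb0 : 0 ≤ b := dotProduct_regGram_inv_mulVec_self_nonneg _ _ _
      have hb1 : b ≤ 1 := (dotProduct_regGram_inv_le _ _ _).trans (hx _)
      rw [Real.log_mul (regGram_posDef _ x).det_pos.ne' (by positivity)]
      have h1 : b ≤ 2 * Real.log (1 + b) := by
        have := Real.one_sub_inv_le_log_of_pos (show 0 < 1 + b by positivity)
        have h2 : b / 2 ≤ 1 - (1 + b)⁻¹ := by
          rw [div_le_iff₀ two_pos, sub_mul, le_sub_iff_add_le, inv_mul_eq_div, ← le_sub_iff_add_le',
            div_le_iff₀ (by positivity)]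
          nlinarith
        linarith
      linarith
  refine key.trans ?_
  have h2 := det_regGram_le (Finset.Ico a (a + N)) x fun l _ => hx l
  rw [Nat.card_Ico, Nat.add_sub_cancel_left] at h2
  rw [← Real.log_pow]
  have := Real.log_le_log (regGram_posDef (Finset.Ico a (a + N)) x).det_pos h2
  linarith

end Gram

/-! ### Linear one-step predictions and their error -/

section Data

open Matrix

variable {S A : Type*} {d : ℕ}

/-- The feature vectors of the data at step `h`. -/
def feat (φ : S → A → EuclideanSpace ℝ (Fin d)) (D : Log S A) (h l : ℕ) : Fin d → ℝ :=
  (φ (D.state l h) (D.action l h)).ofLp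

lemma gram_eq_regGram (φ : S → A → EuclideanSpace ℝ (Fin d)) (H W : ℕ) (D : Log S A) (k h : ℕ) :
    gram φ H W D k h = regGram (Finset.Ico (epochStart H W k) k) (feat φ D h) := rfl

/-- The norm `‖φ(s, a)‖` with respect to the inverse Gram matrix. -/
noncomputable def bonus (φ : S → A → EuclideanSpace ℝ (Fin d)) (H W : ℕ) (D : Log S A) (k h : ℕ)
    (s : S) (a : A) : ℝ :=
  √((φ s a).ofLp ⬝ᵥ (gram φ H W D k h)⁻¹ *ᵥ (φ s a).ofLp)

end Data

section Model

open Matrix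

variable {S A : Type*} [MeasurableSpace S] [MeasurableSpace A] {d H K : ℕ}

lemma abs_dotProduct_ofLp_le (u v : EuclideanSpace ℝ (Fin d)) :
    |u.ofLp ⬝ᵥ v.ofLp| ≤ ‖u‖ * ‖v‖ := by
  have h := abs_real_inner_le_norm v u
  rw [EuclideanSpace.inner_eq_star_dotProduct, star_trivial, mul_comm] at h
  exact h

lemma dotProduct_self_ofLp (u : EuclideanSpace ℝ (Fin d)) : u.ofLp ⬝ᵥ u.ofLp = ‖u‖ ^ 2 := by
  rw [EuclideanSpace.real_norm_sq_eq]
  simp [dotProduct, sq]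

lemma abs_apply_le_norm (u : EuclideanSpace ℝ (Fin d)) (i : Fin d) : |u.ofLp i| ≤ ‖u‖ := by
  simpa using PiLp.norm_apply_le u i

lemma norm_signedIntegral_le {f : S → ℝ} {b : ℝ} (hb0 : 0 ≤ b) (hb : ∀ x, |f x| ≤ b)
    (ν : Fin d → SignedMeasure S) :
    ‖(WithLp.toLp 2 (fun i => signedIntegral (ν i) f) : EuclideanSpace ℝ (Fin d))‖
      ≤ b * tvNorm ν := by
  rw [tvNorm]
  have e : b * ‖(WithLp.toLp 2 (fun i => (ν i).totalVariation.real Set.univ) :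
      EuclideanSpace ℝ (Fin d))‖ = ‖b • (WithLp.toLp 2 (fun i => (ν i).totalVariation.real Set.univ)
      : EuclideanSpace ℝ (Fin d))‖ := by
    rw [norm_smul, Real.norm_eq_abs, abs_of_nonneg hb0]
  refine le_trans ?_ e.ge
  rw [EuclideanSpace.norm_eq, EuclideanSpace.norm_eq]
  refine Real.sqrt_le_sqrt (Finset.sum_le_sum fun i _ => ?_)
  refine pow_le_pow_left₀ (norm_nonneg _) ?_ 2
  simp only [WithLp.ofLp_smul, Pi.smul_apply, smul_eq_mul, Real.norm_eq_abs]
  exact (abs_signedIntegral_le hb0 hb (ν i)).trans (le_abs_self _)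

/-- The parameter vector of the one-step target `r + P f`: by linearity of the MDP,
`r k h s a + ∫ f ∂(P k h (s, a)) = ⟨φ s a, targetVec k h f⟩`. -/
noncomputable def LinearMDP.targetVec (M : LinearMDP S A d H K) (k h : ℕ) (f : S → ℝ) :
    EuclideanSpace ℝ (Fin d) :=
  M.θ k h + WithLp.toLp 2 (fun i => signedIntegral (M.μ k h i) f)

lemma LinearMDP.reward_add_integral (M : LinearMDP S A d H K) {k h : ℕ} (hk : k < K) (hh : h < H)
    {f : S → ℝ} (hf : Measurable f) {b : ℝ} (hb : ∀ x, |f x| ≤ b) (s : S) (a : A) :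
    M.r k h s a + ∫ x, f x ∂(M.P k h (s, a)) = (M.φ s a).ofLp ⬝ᵥ (M.targetVec k h f).ofLp := by
  have := M.isMarkov k hk h hh
  rw [M.reward_eq k hk h hh, integral_eq_sum_signedIntegral (M.P k h (s, a)) _ _
    (M.transition_eq k hk h hh s a) hf hb, targetVec, WithLp.ofLp_add, dotProduct_add]
  rfl

lemma LinearMDP.norm_targetVec_le (M : LinearMDP S A d H K) {k h : ℕ} (hk : k < K) (hh : h < H)
    {f : S → ℝ} {b : ℝ} (hb0 : 0 ≤ b) (hb : ∀ x, |f x| ≤ b) :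
    ‖M.targetVec k h f‖ ≤ √d * (1 + b) := by
  calc _ ≤ ‖M.θ k h‖ + b * tvNorm (M.μ k h) :=
        (norm_add_le _ _).trans (by gcongr; exact norm_signedIntegral_le hb0 hb _)
    _ ≤ √d + b * √d := by
        gcongr
        · exact M.norm_theta_le k hk h hh
        · exact M.norm_measure_le k hk h hh
    _ = _ := by ring

/-- The change of the parameters at step `h` from episode `j - 1` to episode `j`, in the combination
that controls the change of a one-step target with values bounded by `H`. -/
noncomputable def LinearMDP.variation (M : LinearMDP S A d H K) (j h : ℕ) : ℝ :=
  ‖M.θ j h - M.θ (j - 1) h‖ + H * tvNorm (fun i => M.μ j h i - M.μ (j - 1) h i)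

lemma LinearMDP.variation_nonneg (M : LinearMDP S A d H K) (j h : ℕ) : 0 ≤ M.variation j h :=
  add_nonneg (norm_nonneg _) (mul_nonneg (Nat.cast_nonneg _) (norm_nonneg _))

lemma LinearMDP.norm_targetVec_sub_le_variation (M : LinearMDP S A d H K) (j h : ℕ)
    {f : S → ℝ} (hf : Measurable f) (hb : ∀ x, |f x| ≤ H) :
    ‖M.targetVec j h f - M.targetVec (j - 1) h f‖ ≤ M.variation j h := by
  have e : M.targetVec j h f - M.targetVec (j - 1) h f = (M.θ j h - M.θ (j - 1) h) +
      WithLp.toLp 2 (fun i => signedIntegral (M.μ j h i - M.μ (j - 1) h i) f) := by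
    ext i
    simp only [targetVec, WithLp.ofLp_sub, WithLp.ofLp_add, Pi.sub_apply, Pi.add_apply]
    rw [signedIntegral_sub hf hb]; ring
  rw [e]
  refine (norm_add_le _ _).trans ?_
  rw [variation]
  gcongr
  exact norm_signedIntegral_le (Nat.cast_nonneg _) hb _

/-- The drift of a one-step target between two episodes is at most the accumulated variation. -/
lemma LinearMDP.norm_targetVec_sub_le_sum (M : LinearMDP S A d H K) {l k : ℕ} (hlk : l ≤ k) (h : ℕ)
    {f : S → ℝ} (hf : Measurable f) (hb : ∀ x, |f x| ≤ H) :
    ‖M.targetVec l h f - M.targetVec k h f‖ ≤ ∑ j ∈ Finset.Ioc l k, M.variation j h := by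
  induction k, hlk using Nat.le_induction with
  | base => simp
  | succ k hk ih =>
    rw [← Finset.insert_Ioc_right_eq_Ioc_add_one (by omega), Finset.sum_insert (by simp)]
    have h1 := M.norm_targetVec_sub_le_variation (k + 1) h hf hb
    rw [Nat.add_sub_cancel, norm_sub_rev] at h1
    calc _ = ‖(M.targetVec k h f - M.targetVec (k + 1) h f)
          + (M.targetVec l h f - M.targetVec k h f)‖ := by congr 1; abel
      _ ≤ _ := (norm_add_le _ _).trans (add_le_add h1 ih)

lemma LinearMDP.dotProduct_feature_le_one (M : LinearMDP S A d H K) (s : S) (a : A) :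
    (M.φ s a).ofLp ⬝ᵥ (M.φ s a).ofLp ≤ 1 := by
  rw [dotProduct_self_ofLp]
  exact pow_le_one₀ (norm_nonneg _) (M.norm_feature_le s a)

/-- The noise of the sample of `f` at the next state, for the data of step `h` of episode `l`. -/
noncomputable def LinearMDP.noise (M : LinearMDP S A d H K) (D : Log S A) (f : S → ℝ) (h l : ℕ) :
    ℝ :=
  f (D.state l (h + 1)) - ∫ x, f x ∂(M.P l h (D.state l h, D.action l h))

/-- Error of the least-squares prediction of a one-step target: a statistical and a regularization
term, both proportional to the bonus, and a term for the drift of the parameters. -/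
lemma LinearMDP.abs_weight_dotProduct_sub_le (M : LinearMDP S A d H K) {W k h : ℕ} (hk : k < K)
    (hh : h < H) (D : Log S A) (hD : ∀ l < k, D.reward l h = M.r l h (D.state l h) (D.action l h))
    {f : S → ℝ} (hf : Measurable f) (hb : ∀ x, |f x| ≤ H) (s : S) (a : A) {N δ : ℝ} {L : ℕ}
    (hL : k - epochStart H W k ≤ L)
    (hN : |∑ l ∈ Finset.Ico (epochStart H W k) k, M.noise D f h l *
      (feat M.φ D h l ⬝ᵥ (gram M.φ H W D k h)⁻¹ *ᵥ (M.φ s a).ofLp)| ≤ N * bonus M.φ H W D k h s a)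
    (hδ0 : 0 ≤ δ)
    (hδ : ∀ l ∈ Finset.Ico (epochStart H W k) k, ‖M.targetVec l h f - M.targetVec k h f‖ ≤ δ) :
    |weight M.φ H W D k h f ⬝ᵥ (M.φ s a).ofLp - (M.r k h s a + ∫ x, f x ∂(M.P k h (s, a)))|
      ≤ (N + √d * (1 + H)) * bonus M.φ H W D k h s a + √L * δ := by
  rw [M.reward_add_integral hk hh hf hb, weight, gram_eq_regGram]
  rw [gram_eq_regGram] at hN
  set I := Finset.Ico (epochStart H W k) k with hI
  set x := feat M.φ D h with hx
  set v := (M.φ s a).ofLp with hv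
  have hlk : ∀ l ∈ I, l < k := fun l hl => (Finset.mem_Ico.1 hl).2
  have hy := regGram_inv_mulVec_spec I x v
  have hsq := sum_sq_le_dotProduct_regGram_inv I x v
  have hnorm := normSq_regGram_inv_mulVec_le I x v
  have hlsq := leastSquares_dotProduct I x (fun l => D.reward l h + f (D.state l (h + 1))) v
  have hbon : bonus M.φ H W D k h s a ^ 2 = v ⬝ᵥ (regGram I x)⁻¹ *ᵥ v :=
    Real.sq_sqrt (dotProduct_regGram_inv_mulVec_self_nonneg I x v)
  have hb1 : bonus M.φ H W D k h s a ≤ 1 := by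
    have hb0 : 0 ≤ bonus M.φ H W D k h s a := Real.sqrt_nonneg _
    refine (sq_le_one_iff₀ hb0).1 ?_
    rw [hbon]
    exact (dotProduct_regGram_inv_le I x v).trans (M.dotProduct_feature_le_one s a)
  have hb0 : 0 ≤ bonus M.φ H W D k h s a := Real.sqrt_nonneg _
  set B := bonus M.φ H W D k h s a
  set y := (regGram I x)⁻¹ *ᵥ v with hydef
  set m := (M.targetVec k h f).ofLp with hm
  change (((regGram I x)⁻¹ *ᵥ ∑ l ∈ I, (D.reward l h + f (D.state l (h + 1))) • x l) ⬝ᵥ v) = _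
    at hlsq
  change |((regGram I x)⁻¹ *ᵥ ∑ l ∈ I, (D.reward l h + f (D.state l (h + 1))) • x l) ⬝ᵥ v - _| ≤ _
  have hz : ∀ l ∈ I, D.reward l h + f (D.state l (h + 1))
      = x l ⬝ᵥ (M.targetVec l h f).ofLp + M.noise D f h l := by
    intro l hl
    have := M.reward_add_integral ((hlk l hl).trans hk) hh hf hb (D.state l h) (D.action l h)
    rw [hD l (hlk l hl), noise, hx, feat, ← this]; ring
  have hvm : v ⬝ᵥ m = y ⬝ᵥ m + ∑ l ∈ I, (x l ⬝ᵥ y) * (x l ⬝ᵥ m) := by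
    conv_lhs => rw [← hy]
    rw [add_dotProduct, sum_dotProduct]
    simp [smul_dotProduct]
  -- error = noise + drift of the parameters - effect of the regularization
  have e : ((regGram I x)⁻¹ *ᵥ ∑ l ∈ I, (D.reward l h + f (D.state l (h + 1))) • x l) ⬝ᵥ v - v ⬝ᵥ m
      = ∑ l ∈ I, M.noise D f h l * (x l ⬝ᵥ y)
        + ∑ l ∈ I, (x l ⬝ᵥ (M.targetVec l h f - M.targetVec k h f).ofLp) * (x l ⬝ᵥ y)
        - y ⬝ᵥ m := by
    rw [hlsq, hvm, ← Finset.sum_add_distrib, sub_add_eq_sub_sub, sub_right_comm,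
      ← Finset.sum_sub_distrib]
    congr 1
    refine Finset.sum_congr rfl fun l hl => ?_
    rw [hz l hl, WithLp.ofLp_sub, dotProduct_sub]; ring
  rw [e]
  have h1 : |y ⬝ᵥ m| ≤ √d * (1 + H) * B := by
    have h2 := abs_dotProduct_ofLp_le (WithLp.toLp 2 y) (M.targetVec k h f)
    have h3 : ‖(WithLp.toLp 2 y : EuclideanSpace ℝ (Fin d))‖ ≤ B := by
      refine abs_le_of_sq_le_sq' ?_ hb0 |>.2
      rw [← dotProduct_self_ofLp, hbon]; exact hnorm
    calc _ ≤ ‖(WithLp.toLp 2 y : EuclideanSpace ℝ (Fin d))‖ * ‖M.targetVec k h f‖ := h2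
      _ ≤ B * (√d * (1 + H)) := by
          gcongr
          exact M.norm_targetVec_le hk hh (Nat.cast_nonneg _) hb
      _ = _ := by ring
  have h2 : |∑ l ∈ I, (x l ⬝ᵥ (M.targetVec l h f - M.targetVec k h f).ofLp) * (x l ⬝ᵥ y)|
      ≤ √L * δ := by
    calc _ ≤ ∑ l ∈ I, δ * |x l ⬝ᵥ y| := by
          refine (Finset.abs_sum_le_sum_abs _ _).trans (Finset.sum_le_sum fun l hl => ?_)
          rw [abs_mul]
          gcongr
          calc _ ≤ ‖M.φ (D.state l h) (D.action l h)‖ * ‖M.targetVec l h f - M.targetVec k h f‖ :=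
                abs_dotProduct_ofLp_le _ _
            _ ≤ 1 * δ := mul_le_mul (M.norm_feature_le _ _) (hδ l hl) (norm_nonneg _) zero_le_one
            _ = δ := one_mul _
      _ = δ * ∑ l ∈ I, 1 * |x l ⬝ᵥ y| := by rw [Finset.mul_sum]; simp
      _ ≤ δ * (√(∑ l ∈ I, (1 : ℝ) ^ 2) * √(∑ l ∈ I, |x l ⬝ᵥ y| ^ 2)) := by
          gcongr; exact Real.sum_mul_le_sqrt_mul_sqrt _ _ _
      _ ≤ δ * (√L * 1) := by
          gcongr
          · simp only [one_pow, Finset.sum_const, nsmul_eq_mul, mul_one]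
            rw [hI, Nat.card_Ico]; exact_mod_cast hL
          · refine Real.sqrt_le_iff.2 ⟨zero_le_one, ?_⟩
            simp only [sq_abs, one_pow]
            refine hsq.trans ?_
            rw [← hbon]; exact pow_le_one₀ hb0 hb1
      _ = _ := by ring
  rw [abs_le] at h1 h2 hN ⊢
  constructor <;> linarith [h1.1, h1.2, h2.1, h2.2, hN.1, hN.2]

end Model

/-! ### Measurability and bounds of value functions -/

section Values

open Matrix

variable {S A : Type*} [MeasurableSpace S] [MeasurableSpace A] {d H K : ℕ}

lemma LinearMDP.measurable_feature_apply (M : LinearMDP S A d H K) (i : Fin d) :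
    Measurable fun x : S × A => (M.φ x.1 x.2).ofLp i :=
  (measurable_pi_apply i).comp ((WithLp.measurable_ofLp 2 _).comp M.measurable_feature)

lemma LinearMDP.measurable_reward (M : LinearMDP S A d H K) {k h : ℕ} (hk : k < K) (hh : h < H) :
    Measurable fun x : S × A => M.r k h x.1 x.2 := by
  simp only [M.reward_eq k hk h hh]
  exact Finset.measurable_sum _ fun i _ => (M.measurable_feature_apply i).mul_const _

lemma EpisodicMDP.policyValue_of_le (M : EpisodicMDP S A H K) (k : ℕ) (π : ℕ → S → A) {h : ℕ}
    (hh : H ≤ h) (s : S) : M.policyValue k π h s = 0 := by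
  rw [EpisodicMDP.policyValue, if_neg (by omega)]

lemma EpisodicMDP.policyValue_of_lt (M : EpisodicMDP S A H K) (k : ℕ) (π : ℕ → S → A) {h : ℕ}
    (hh : h < H) (s : S) : M.policyValue k π h s =
      M.r k h s (π h s) + ∫ s', M.policyValue k π (h + 1) s' ∂(M.P k h (s, π h s)) := by
  rw [EpisodicMDP.policyValue, if_pos hh]

lemma measurable_integral_transition (M : EpisodicMDP S A H K) {k h : ℕ} (hk : k < K) (hh : h < H)
    {X : Type*} [MeasurableSpace X] {s : X → S} {a : X → A} (hs : Measurable s) (ha : Measurable a)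
    {f : X → S → ℝ} (hf : Measurable fun z : X × S => f z.1 z.2) :
    Measurable fun x => ∫ y, f x y ∂(M.P k h (s x, a x)) := by
  have := M.isMarkov k hk h hh
  exact (StronglyMeasurable.integral_kernel_prod_right'
    (κ := (M.P k h).comap (fun x => (s x, a x)) (hs.prodMk ha)) hf.stronglyMeasurable).measurable

/-- Joint measurability of the value of a random policy. -/
lemma LinearMDP.measurable_policyValue (M : LinearMDP S A d H K) {k : ℕ} (hk : k < K)
    {X : Type*} [MeasurableSpace X] {π : X → ℕ → S → A}
    (hπ : ∀ h < H, Measurable fun z : X × S => π z.1 h z.2) (h : ℕ) :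
    Measurable fun z : X × S => M.policyValue k (π z.1) h z.2 := by
  rcases le_or_gt H h with hh | hh
  · simp only [M.policyValue_of_le k _ hh]; exact measurable_const
  · have hle := hh.le
    induction hle using Nat.decreasingInduction with
    | self => omega
    | of_succ h hlt ih =>
      have ih' : Measurable fun z : X × S => M.policyValue k (π z.1) (h + 1) z.2 := by
        rcases Nat.lt_or_ge (h + 1) H with h1 | h1
        · exact ih h1
        · simp only [M.policyValue_of_le k _ h1]; exact measurable_const
      simp only [M.policyValue_of_lt k _ hh]
      refine ((M.measurable_reward hk hh).comp (measurable_snd.prodMk (hπ h hh))).add ?_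
      exact measurable_integral_transition M.toEpisodicMDP hk hh measurable_snd (hπ h hh)
        (f := fun z y => M.policyValue k (π z.1) (h + 1) y)
        (ih'.comp ((measurable_fst.comp measurable_fst).prodMk measurable_snd))

lemma LinearMDP.measurable_policyValue_of_measurable (M : LinearMDP S A d H K) {k : ℕ} (hk : k < K)
    {π : ℕ → S → A} (hπ : ∀ h < H, Measurable (π h)) (h : ℕ) :
    Measurable (M.policyValue k π h) :=
  (M.measurable_policyValue (X := Unit) hk (π := fun _ => π)
    (fun j hj => (hπ j hj).comp measurable_snd) h).comp (measurable_prodMk_left (x := ()))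

/-- The integral of a bounded function against a transition probability obeys the same bounds. -/
lemma integral_transition_mem_Icc (M : EpisodicMDP S A H K) {k h : ℕ} (hk : k < K) (hh : h < H)
    (x : S × A) {f : S → ℝ} (hf : Measurable f) {l u : ℝ} (hb : ∀ y, f y ∈ Set.Icc l u) :
    ∫ y, f y ∂(M.P k h x) ∈ Set.Icc l u := by
  have := M.isMarkov k hk h hh
  have hi : Integrable f (M.P k h x) := Integrable.of_mem_Icc l u hf.aemeasurable
    (Filter.Eventually.of_forall hb)
  have h1 := integral_mono (integrable_const l) hi fun y => (hb y).1
  have h2 := integral_mono hi (integrable_const u) fun y => (hb y).2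
  simp only [integral_const, probReal_univ, one_smul] at h1 h2
  exact ⟨h1, h2⟩

lemma LinearMDP.policyValue_mem_Icc (M : LinearMDP S A d H K) {k : ℕ} (hk : k < K)
    {π : ℕ → S → A} (hπ : ∀ h < H, Measurable (π h)) {h : ℕ} (hh : h ≤ H) (s : S) :
    M.policyValue k π h s ∈ Set.Icc (0 : ℝ) ((H - h : ℕ) : ℝ) := by
  induction hh using Nat.decreasingInduction generalizing s with
  | self => simp [M.policyValue_of_le k π le_rfl]
  | of_succ h hlt ih =>
    rw [M.policyValue_of_lt k π hlt]
    have h1 := integral_transition_mem_Icc M.toEpisodicMDP hk hlt (s, π h s)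
      (M.measurable_policyValue_of_measurable hk hπ (h + 1)) ih
    have h2 := M.reward_mem k hk h hlt s (π h s)
    have e : ((H - h : ℕ) : ℝ) = 1 + ((H - (h + 1) : ℕ) : ℝ) := by
      rw [show H - h = 1 + (H - (h + 1)) by omega]; push_cast; ring
    rw [e]
    exact ⟨add_nonneg h2.1 h1.1, add_le_add h2.2 h1.2⟩

lemma LinearMDP.policyValue_mem_Icc_zero_H (M : LinearMDP S A d H K) {k : ℕ} (hk : k < K)
    {π : ℕ → S → A} (hπ : ∀ h < H, Measurable (π h)) (h : ℕ) (s : S) :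
    M.policyValue k π h s ∈ Set.Icc (0 : ℝ) H := by
  rcases le_or_gt h H with hh | hh
  · have := M.policyValue_mem_Icc hk hπ hh s
    exact ⟨this.1, this.2.trans (by exact_mod_cast Nat.sub_le H h)⟩
  · rw [M.policyValue_of_le k π hh.le]; simp

/-- The estimated state value `V_h^k = max_a Q_h^k(·, a)`. -/
noncomputable def estV {S A : Type*} (φ : S → A → EuclideanSpace ℝ (Fin d)) (H W : ℕ) (β : ℝ)
    (D : Log S A) (k h : ℕ) (s : S) : ℝ :=
  ⨆ b, estQ φ H W β D k h s b

section EstimateBasics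

variable {S A : Type*}

lemma estQ_of_lt (φ : S → A → EuclideanSpace ℝ (Fin d)) {H : ℕ} (W : ℕ) (β : ℝ) (D : Log S A)
    (k : ℕ) {h : ℕ} (hh : h < H) (s : S) (a : A) :
    estQ φ H W β D k h s a =
      min (weight φ H W D k h (estV φ H W β D k (h + 1)) ⬝ᵥ (φ s a).ofLp
        + β * bonus φ H W D k h s a) H := by
  rw [estQ, if_pos hh]; rfl

lemma estV_of_le (φ : S → A → EuclideanSpace ℝ (Fin d)) {H : ℕ} (W : ℕ) (β : ℝ) (D : Log S A)
    (k : ℕ) {h : ℕ} (hh : H ≤ h) : estV φ H W β D k h = 0 := by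
  ext s
  have : ∀ b, estQ φ H W β D k h s b = 0 := fun b => by rw [estQ, if_neg (by omega)]
  simp [estV, this]

lemma estQ_le_estV [Finite A] (φ : S → A → EuclideanSpace ℝ (Fin d)) (H W : ℕ) (β : ℝ)
    (D : Log S A) (k h : ℕ) (s : S) (a : A) :
    estQ φ H W β D k h s a ≤ estV φ H W β D k h s :=
  le_ciSup (f := fun b => estQ φ H W β D k h s b) (Set.finite_range _).bddAbove a

lemma estV_eq_estQ_greedyPolicy [Finite A] (φ : S → A → EuclideanSpace ℝ (Fin d)) (H W : ℕ) (β : ℝ)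
    {sel : (A → ℝ) → A} (hsel : ∀ (f : A → ℝ) (b : A), f b ≤ f (sel f)) (D : Log S A)
    (k h : ℕ) (s : S) :
    estV φ H W β D k h s = estQ φ H W β D k h s (greedyPolicy φ H W β sel D k h s) := by
  have : Nonempty A := ⟨sel 0⟩
  exact le_antisymm (ciSup_le fun b => hsel _ b) (estQ_le_estV _ _ _ _ _ _ _ _ _)

end EstimateBasics

lemma measurable_matrix_inv_apply {X n : Type*} [MeasurableSpace X] [Fintype n] [DecidableEq n]
    {G : X → Matrix n n ℝ} (hG : ∀ i j, Measurable fun x => G x i j) (i j : n) :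
    Measurable fun x => (G x)⁻¹ i j := by
  have hdet : ∀ {G : X → Matrix n n ℝ}, (∀ i j, Measurable fun x => G x i j) →
      Measurable fun x => (G x).det := by
    intro G hG
    simp only [det_apply]
    exact Finset.measurable_sum _ fun σ _ =>
      (Finset.measurable_prod _ fun i _ => hG _ _).const_smul _
  simp only [inv_def, Matrix.smul_apply, Ring.inverse_eq_inv', adjugate_apply]
  refine (hdet hG).inv.smul (hdet fun k l => ?_)
  simp only [updateRow_apply]
  split_ifs
  · exact measurable_const
  · exact hG k l

/-- Joint measurability of the estimates in the data and in the state at which they are taken. -/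
lemma LinearMDP.measurable_estimates [Finite A] [MeasurableSingletonClass A]
    (M : LinearMDP S A d H K) (W : ℕ) (β : ℝ) {X : Type*}
    [MeasurableSpace X] {D : X → Log S A} {k : ℕ}
    (hs : ∀ l < k, ∀ h < H, Measurable fun x => (D x).state l h)
    (ha : ∀ l < k, ∀ h < H, Measurable fun x => (D x).action l h)
    (hr : ∀ l < k, ∀ h < H, Measurable fun x => (D x).reward l h) (h : ℕ) :
    (∀ b, Measurable fun z : X × S => estQ M.φ H W β (D z.1) k h z.2 b) ∧
      Measurable fun z : X × S => estV M.φ H W β (D z.1) k h z.2 := by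
  suffices hQ : ∀ b, Measurable fun z : X × S => estQ M.φ H W β (D z.1) k h z.2 b from
    ⟨hQ, Measurable.iSup hQ⟩
  rcases le_or_gt H h with hh | hh
  · intro b
    have : ∀ z : X × S, estQ M.φ H W β (D z.1) k h z.2 b = 0 := fun z => by
      rw [estQ, if_neg (by omega)]
    simp only [this]; exact measurable_const
  · have hle := hh.le
    induction hle using Nat.decreasingInduction with
    | self => omega
    | of_succ h hlt ih =>
      intro b
      have hV : Measurable fun z : X × S => estV M.φ H W β (D z.1) k (h + 1) z.2 := by
        rcases Nat.lt_or_ge (h + 1) H with h1 | h1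
        · exact Measurable.iSup (ih h1)
        · simp only [estV_of_le M.φ W β _ k h1]; exact measurable_const
      have hfeat : ∀ l < k, ∀ i, Measurable fun x => feat M.φ (D x) h l i := fun l hl i =>
        (M.measurable_feature_apply i).comp ((hs l hl h hh).prodMk (ha l hl h hh))
      have hlk : ∀ l ∈ Finset.Ico (epochStart H W k) k, l < k := fun l hl => (Finset.mem_Ico.1 hl).2
      have hgram : ∀ i j, Measurable fun x => gram M.φ H W (D x) k h i j := by
        intro i j
        simp only [gram_eq_regGram, regGram, Matrix.add_apply, Matrix.sum_apply, vecMulVec_apply]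
        exact measurable_const.add (Finset.measurable_sum _ fun l hl =>
          (hfeat l (hlk l hl) i).mul (hfeat l (hlk l hl) j))
      have hinv := measurable_matrix_inv_apply hgram
      have hφ : ∀ i, Measurable fun z : X × S => (M.φ z.2 b).ofLp i := fun i =>
        (M.measurable_feature_apply i).comp (measurable_snd.prodMk measurable_const)
      have hVl : ∀ l < k, Measurable fun x =>
          estV M.φ H W β (D x) k (h + 1) ((D x).state l (h + 1)) := by
        intro l hl
        rcases Nat.lt_or_ge (h + 1) H with h1 | h1
        · exact hV.comp (measurable_id.prodMk (hs l hl (h + 1) h1))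
        · simp only [estV_of_le M.φ W β _ k h1]; exact measurable_const
      have hw : ∀ i, Measurable fun x =>
          weight M.φ H W (D x) k h (estV M.φ H W β (D x) k (h + 1)) i := by
        intro i
        simp only [weight, mulVec, dotProduct, Finset.sum_apply, Pi.smul_apply, smul_eq_mul]
        exact Finset.measurable_sum _ fun j _ => (hinv i j).mul (Finset.measurable_sum _ fun l hl =>
          ((hr l (hlk l hl) h hh).add (hVl l (hlk l hl))).mul (hfeat l (hlk l hl) j))
      simp only [estQ_of_lt M.φ W β _ k hh, bonus, mulVec, dotProduct]
      refine Measurable.min (Measurable.add (Finset.measurable_sum _ fun i _ =>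
        ((hw i).comp measurable_fst).mul (hφ i)) (Measurable.const_mul (Measurable.sqrt ?_) β))
        measurable_const
      exact Finset.measurable_sum _ fun i _ => (hφ i).mul (Finset.measurable_sum _ fun j _ =>
        ((hinv i j).comp measurable_fst).mul (hφ j))

lemma LinearMDP.measurable_estV [Finite A] [MeasurableSingletonClass A]
    (M : LinearMDP S A d H K) (W : ℕ) (β : ℝ) (D : Log S A) (k h : ℕ) :
    Measurable (estV M.φ H W β D k h) :=
  ((M.measurable_estimates (X := Unit) W β (D := fun _ => D) (k := k)
    (fun _ _ _ _ => measurable_const) (fun _ _ _ _ => measurable_const)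
    (fun _ _ _ _ => measurable_const) h).2).comp (measurable_prodMk_left (x := ()))

lemma LinearMDP.measurable_greedyPolicy [Finite A] [MeasurableSingletonClass A]
    (M : LinearMDP S A d H K) (W : ℕ) (β : ℝ) {sel : (A → ℝ) → A} (hsel : Measurable sel)
    {X : Type*} [MeasurableSpace X] {D : X → Log S A} {k : ℕ}
    (hs : ∀ l < k, ∀ h < H, Measurable fun x => (D x).state l h)
    (ha : ∀ l < k, ∀ h < H, Measurable fun x => (D x).action l h)
    (hr : ∀ l < k, ∀ h < H, Measurable fun x => (D x).reward l h) (h : ℕ) :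
    Measurable fun z : X × S => greedyPolicy M.φ H W β sel (D z.1) k h z.2 :=
  hsel.comp (measurable_pi_iff.2 (M.measurable_estimates W β hs ha hr h).1)

lemma LinearMDP.measurable_greedyPolicy_const [Finite A] [MeasurableSingletonClass A]
    (M : LinearMDP S A d H K) (W : ℕ) (β : ℝ) {sel : (A → ℝ) → A} (hsel : Measurable sel)
    (D : Log S A) (k h : ℕ) : Measurable (greedyPolicy M.φ H W β sel D k h) :=
  (M.measurable_greedyPolicy (X := Unit) W β hsel (D := fun _ => D) (k := k)
    (fun _ _ _ _ => measurable_const) (fun _ _ _ _ => measurable_const)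
    (fun _ _ _ _ => measurable_const) h).comp (measurable_prodMk_left (x := ()))

end Values

/-! ### Optimism and regret in one episode -/

section Episode

open Matrix

variable {S A : Type*} [MeasurableSpace S] [MeasurableSpace A] {d H K : ℕ}

/-- The regret of an episode never exceeds its length. -/
lemma LinearMDP.optimalValue_sub_policyValue_le (M : LinearMDP S A d H K) {k : ℕ} (hk : k < K)
    {π : ℕ → S → A} (hπ : ∀ j, Measurable (π j)) (s : S) :
    M.optimalValue k 0 s - M.policyValue k π 0 s ≤ H := by
  have : Nonempty {π : ℕ → S → A // ∀ j, Measurable (π j)} := ⟨⟨π, hπ⟩⟩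
  have h1 : M.optimalValue k 0 s ≤ H :=
    ciSup_le fun π' => (M.policyValue_mem_Icc_zero_H hk (fun j _ => π'.2 j) 0 s).2
  have h2 := (M.policyValue_mem_Icc_zero_H hk (fun j _ => hπ j) 0 s).1
  linarith

/-- The conditions on the data and on the parameters under which episode `k` is analysed: rewards
are those of the MDP, `δ h` bounds the change of the parameters of step `h` within the epoch, whose
total effect is at most `1`, and for value estimates in `[-H, H]` the noise is at most `N` times the
bonus, where the bonus factor `β` also covers the regularization bias. The noise condition presumes
bounded estimates at later steps because the bounds on estimates and the noise bounds are obtained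
together, by backward induction on the step. -/
structure LinearMDP.GoodEpisode (M : LinearMDP S A d H K) (W : ℕ) (β : ℝ) (D : Log S A) (k L : ℕ)
    (N : ℝ) (δ : ℕ → ℝ) : Prop where
  lt : k < K
  reward : ∀ l < k, ∀ h < H, D.reward l h = M.r l h (D.state l h) (D.action l h)
  length : k - epochStart H W k ≤ L
  drift : ∀ h < H, ∀ l ∈ Finset.Ico (epochStart H W k) k,
    ∑ j ∈ Finset.Ioc l k, M.variation j h ≤ δ h
  drift_nonneg : ∀ h, 0 ≤ δ h
  drift_le_one : √L * ∑ h ∈ Finset.range H, δ h ≤ 1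
  noise : ∀ h, h + 1 < H → (∀ j, h < j → ∀ s, |estV M.φ H W β D k j s| ≤ H) → ∀ s a,
    |∑ l ∈ Finset.Ico (epochStart H W k) k, M.noise D (estV M.φ H W β D k (h + 1)) h l *
      (feat M.φ D h l ⬝ᵥ (gram M.φ H W D k h)⁻¹ *ᵥ (M.φ s a).ofLp)| ≤ N * bonus M.φ H W D k h s a
  le_factor : N + √d * (1 + H) ≤ β
  const_nonneg : 0 ≤ N

variable [Finite A] [MeasurableSingletonClass A] {M : LinearMDP S A d H K} {W : ℕ} {β : ℝ}
  {D : Log S A} {k L : ℕ} {N : ℝ} {δ : ℕ → ℝ}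

lemma bonus_nonneg {S A : Type*} (φ : S → A → EuclideanSpace ℝ (Fin d)) (H W : ℕ) (D : Log S A)
    (k h : ℕ) (s : S) (a : A) : 0 ≤ bonus φ H W D k h s a := Real.sqrt_nonneg _

lemma LinearMDP.GoodEpisode.abs_prediction_sub_le (g : M.GoodEpisode W β D k L N δ) {h : ℕ}
    (hh : h < H) (hV : ∀ j, h < j → ∀ s, |estV M.φ H W β D k j s| ≤ H) (s : S) (a : A) :
    |weight M.φ H W D k h (estV M.φ H W β D k (h + 1)) ⬝ᵥ (M.φ s a).ofLp
        - (M.r k h s a + ∫ x, estV M.φ H W β D k (h + 1) x ∂(M.P k h (s, a)))|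
      ≤ β * bonus M.φ H W D k h s a + √L * δ h := by
  have hm := M.measurable_estV W β D k (h + 1)
  refine (M.abs_weight_dotProduct_sub_le g.lt hh D (fun l hl => g.reward l hl h hh) hm
    (hV _ h.lt_succ_self) s a (N := N) (δ := δ h) g.length ?_ (g.drift_nonneg h)
    fun l hl => ?_).trans ?_
  · rcases Nat.lt_or_ge (h + 1) H with h1 | h1
    · exact g.noise h h1 hV s a
    · rw [estV_of_le M.φ W β D k h1]
      have hz : ∀ l, M.noise D 0 h l = 0 := fun l => by simp [LinearMDP.noise]
      simp only [hz, zero_mul, Finset.sum_const_zero, abs_zero]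
      exact mul_nonneg g.const_nonneg (bonus_nonneg _ _ _ _ _ _ _ _)
  · exact (M.norm_targetVec_sub_le_sum (Finset.mem_Ico.1 hl).2.le h hm
      (hV _ h.lt_succ_self)).trans (g.drift h hh l hl)
  · gcongr
    · exact bonus_nonneg _ _ _ _ _ _ _ _
    · exact g.le_factor

/-- **Optimism**: in a good episode the estimated values dominate the values of all policies, up to
the effect of the drift. Since this effect is at most `1`, the estimates are also bounded below,
which the truncation at `H` in the algorithm alone does not give. -/
lemma LinearMDP.GoodEpisode.optimism [Nonempty A] (g : M.GoodEpisode W β D k L N δ) {h : ℕ}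
    (hh : h ≤ H) :
    (∀ j, h ≤ j → ∀ s, |estV M.φ H W β D k j s| ≤ H) ∧
    ∀ π : ℕ → S → A, (∀ j, Measurable (π j)) → ∀ s,
      M.policyValue k π h s ≤ estV M.φ H W β D k h s + √L * ∑ j ∈ Finset.Ico h H, δ j := by
  induction hh using Nat.decreasingInduction with
  | self =>
    refine ⟨fun j hj s => by rw [estV_of_le M.φ W β D k hj]; simp, fun π _ s => ?_⟩
    rw [estV_of_le M.φ W β D k le_rfl, M.policyValue_of_le k π le_rfl]; simp
  | of_succ h hlt ih =>
    obtain ⟨hV, hopt⟩ := ih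
    have := M.isMarkov k g.lt h hlt
    have hm := M.measurable_estV W β D k (h + 1)
    have hH1 : (1 : ℝ) ≤ H := by exact_mod_cast (by omega : 1 ≤ H)
    have hδ0 : ∀ h', 0 ≤ √L * ∑ j ∈ Finset.Ico h' H, δ j := fun h' =>
      mul_nonneg (Real.sqrt_nonneg _) (Finset.sum_nonneg fun j _ => g.drift_nonneg j)
    have main : ∀ π : ℕ → S → A, (∀ j, Measurable (π j)) → ∀ s,
        M.policyValue k π h s ≤ estV M.φ H W β D k h s + √L * ∑ j ∈ Finset.Ico h H, δ j := by
      intro π hπ s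
      have hle : M.policyValue k π h s ≤ estQ M.φ H W β D k h s (π h s)
          + √L * ∑ j ∈ Finset.Ico h H, δ j := by
        rw [estQ_of_lt M.φ W β D k hlt, ← min_add_add_right]
        refine le_min ?_ ?_
        · have hp := g.abs_prediction_sub_le hlt (fun j hj => hV j hj) s (π h s)
          have hVπ := M.measurable_policyValue_of_measurable g.lt (fun j _ => hπ j) (h + 1)
          have hi1 : Integrable (M.policyValue k π (h + 1)) (M.P k h (s, π h s)) :=
            Integrable.of_mem_Icc 0 H hVπ.aemeasurable (Filter.Eventually.of_forall
              (M.policyValue_mem_Icc_zero_H g.lt (fun j _ => hπ j) (h + 1)))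
          have hi2 : Integrable (estV M.φ H W β D k (h + 1)) (M.P k h (s, π h s)) :=
            Integrable.of_bound hm.aestronglyMeasurable H
              (Filter.Eventually.of_forall (hV _ le_rfl))
          have h1 := integral_mono hi1 (hi2.add (integrable_const
            (√L * ∑ j ∈ Finset.Ico (h + 1) H, δ j))) (hopt π hπ)
          simp only [Pi.add_apply] at h1
          rw [integral_add hi2 (integrable_const _), integral_const, probReal_univ, one_smul] at h1
          rw [M.policyValue_of_lt k π hlt, Finset.sum_eq_sum_Ico_succ_bot hlt, mul_add]
          have := (abs_le.1 hp).1
          linarith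
        · have := (M.policyValue_mem_Icc_zero_H g.lt (fun j _ => hπ j) h s).2
          linarith [hδ0 h]
      exact hle.trans (by gcongr; exact estQ_le_estV _ _ _ _ _ _ _ _ _)
    refine ⟨fun j hj s => ?_, main⟩
    rcases hj.lt_or_eq with hj | rfl
    · exact hV j hj s
    refine abs_le.2 ⟨?_, ?_⟩
    · obtain ⟨a0⟩ := ‹Nonempty A›
      have h1 := main (fun _ _ => a0) (fun _ => measurable_const) s
      have h2 := (M.policyValue_mem_Icc_zero_H (π := fun _ _ => a0) g.lt
        (fun _ _ => measurable_const) h s).1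
      have h3 : √L * ∑ j ∈ Finset.Ico h H, δ j ≤ √L * ∑ j ∈ Finset.range H, δ j := by
        gcongr
        · exact fun j _ _ => g.drift_nonneg j
        · rw [Finset.range_eq_Ico]; exact Finset.Ico_subset_Ico_left (Nat.zero_le _)
      linarith [g.drift_le_one]
    · refine ciSup_le fun b => ?_
      rw [estQ_of_lt M.φ W β D k hlt]
      exact min_le_right _ _

/-- The gap between the estimated value and the value of a policy, with the estimate
truncated to `[-H, H]`. The truncation has no effect in good episodes, and makes the gap bounded on
all data, as concentration inequalities require. -/
noncomputable def LinearMDP.valueGap (M : LinearMDP S A d H K) (W : ℕ) (β : ℝ) (D : Log S A) (k : ℕ)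
    (π : ℕ → S → A) (h : ℕ) (s : S) : ℝ :=
  max (-(H : ℝ)) (min (estV M.φ H W β D k h s) H) - M.policyValue k π h s

/-- In a good episode, the regret is at most the sum of the bonuses, the drift terms and a
martingale term. -/
lemma LinearMDP.GoodEpisode.regret_le (g : M.GoodEpisode W β D k L N δ) {sel : (A → ℝ) → A}
    (hselm : Measurable sel) (hsel : ∀ (f : A → ℝ) (b : A), f b ≤ f (sel f))
    (hact : ∀ h < H, D.action k h = greedyPolicy M.φ H W β sel D k h (D.state k h)) :
    M.optimalValue k 0 (D.state k 0)
        - M.policyValue k (greedyPolicy M.φ H W β sel D k) 0 (D.state k 0)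
      ≤ ∑ h ∈ Finset.range H, (2 * β * bonus M.φ H W D k h (D.state k h) (D.action k h)
          + 2 * (√L * δ h)
          - if h + 1 < H then M.noise D
              (M.valueGap W β D k (greedyPolicy M.φ H W β sel D k) (h + 1)) h k else 0) := by
  have : Nonempty A := ⟨sel 0⟩
  set π := greedyPolicy M.φ H W β sel D k with hπdef
  have hπ : ∀ j, Measurable (π j) := M.measurable_greedyPolicy_const W β hselm D k
  set b : ℕ → ℝ := fun h => bonus M.φ H W D k h (D.state k h) (D.action k h) with hb
  set ν : ℕ → ℝ := fun h => if h + 1 < H then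
    M.noise D (M.valueGap W β D k π (h + 1)) h k else 0 with hν
  have hgap : ∀ h ≤ H, ∀ s, M.valueGap W β D k π h s
      = estV M.φ H W β D k h s - M.policyValue k π h s := by
    intro h hh s
    have := abs_le.1 ((g.optimism hh).1 h le_rfl s)
    rw [valueGap, min_eq_left this.2, max_eq_right this.1]
  have hstep : ∀ h ≤ H, estV M.φ H W β D k h (D.state k h) - M.policyValue k π h (D.state k h)
      ≤ ∑ j ∈ Finset.Ico h H, (2 * β * b j + √L * δ j - ν j) := by
    intro h hh
    induction hh using Nat.decreasingInduction with
    | self => rw [estV_of_le M.φ W β D k le_rfl, M.policyValue_of_le k π le_rfl]; simp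
    | of_succ h hlt ih =>
      have := M.isMarkov k g.lt h hlt
      rw [Finset.sum_eq_sum_Ico_succ_bot hlt]
      have hV := (g.optimism (Nat.succ_le_of_lt hlt)).1
      have hp := (abs_le.1 (g.abs_prediction_sub_le hlt hV (D.state k h) (D.action k h))).2
      have hV1 : estV M.φ H W β D k h (D.state k h) ≤
          weight M.φ H W D k h (estV M.φ H W β D k (h + 1)) ⬝ᵥ
            (M.φ (D.state k h) (D.action k h)).ofLp + β * b h := by
        rw [estV_eq_estQ_greedyPolicy M.φ H W β hsel, ← hπdef, ← hact h hlt,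
          estQ_of_lt M.φ W β D k hlt]
        exact min_le_left _ _
      have hV2 := M.policyValue_of_lt k π hlt (D.state k h)
      rw [← hact h hlt] at hV2
      have hint : ∫ x, estV M.φ H W β D k (h + 1) x ∂(M.P k h (D.state k h, D.action k h))
          - ∫ x, M.policyValue k π (h + 1) x ∂(M.P k h (D.state k h, D.action k h))
          = estV M.φ H W β D k (h + 1) (D.state k (h + 1))
            - M.policyValue k π (h + 1) (D.state k (h + 1)) - ν h := by
        rcases Nat.lt_or_ge (h + 1) H with h1 | h1
        · rw [hν]
          simp only [if_pos h1, LinearMDP.noise, hgap (h + 1) h1.le]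
          rw [integral_sub]
          · ring
          · exact Integrable.of_bound (M.measurable_estV W β D k (h + 1)).aestronglyMeasurable H
              (Filter.Eventually.of_forall (hV _ le_rfl))
          · exact Integrable.of_mem_Icc 0 H (M.measurable_policyValue_of_measurable g.lt
              (fun j _ => hπ j) (h + 1)).aemeasurable (Filter.Eventually.of_forall
              (M.policyValue_mem_Icc_zero_H g.lt (fun j _ => hπ j) (h + 1)))
        · rw [hν, estV_of_le M.φ W β D k h1]
          simp only [if_neg (not_lt.2 h1), M.policyValue_of_le k π h1]
          simp
      change _ ≤ β * b h + _ at hp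
      linarith
  have h0 := hstep 0 (Nat.zero_le _)
  rw [← Finset.range_eq_Ico] at h0
  have hopt : M.optimalValue k 0 (D.state k 0) ≤ estV M.φ H W β D k 0 (D.state k 0)
      + √L * ∑ j ∈ Finset.range H, δ j := by
    have : Nonempty {π : ℕ → S → A // ∀ j, Measurable (π j)} := ⟨⟨π, hπ⟩⟩
    refine ciSup_le fun π' => ?_
    rw [Finset.range_eq_Ico]
    exact (g.optimism (Nat.zero_le _)).2 π'.1 π'.2 _
  have e : ∑ h ∈ Finset.range H, (2 * β * b h + 2 * (√L * δ h) - ν h)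
      = ∑ h ∈ Finset.range H, (2 * β * b h + √L * δ h - ν h)
        + √L * ∑ h ∈ Finset.range H, δ h := by
    rw [Finset.mul_sum, ← Finset.sum_add_distrib]
    exact Finset.sum_congr rfl fun h _ => by ring
  change _ ≤ ∑ h ∈ Finset.range H, (2 * β * b h + 2 * (√L * δ h) - ν h)
  linarith

end Episode

/-! ### The noise of a run is a martingale difference -/

section RunNoise

open Matrix

variable {S A : Type*} [MeasurableSpace S] [MeasurableSpace A] {d H K : ℕ}
  {Ω : Type*} {mΩ : MeasurableSpace Ω}
  {M : LinearMDP S A d H K} {W : ℕ} {β : ℝ} {sel : (A → ℝ) → A} {Pr : Measure Ω}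
  {ℱ : Filtration ℕ mΩ} {s : ℕ → ℕ → Ω → S} {a : ℕ → ℕ → Ω → A}

lemma mul_add_lt_mul {k l h H : ℕ} (hlk : l < k) (hh : h < H) : l * H + h < k * H := by
  have : (l + 1) * H ≤ k * H := Nat.mul_le_mul_right H hlk
  rw [Nat.succ_mul] at this; omega

lemma measurable_comp_graph {Ω : Type*} {m m' : MeasurableSpace Ω} (hm : m ≤ m') {X : Ω → S}
    (hX : Measurable[m'] X) {f : Ω → S → ℝ}
    (hf : @Measurable _ _ (@Prod.instMeasurableSpace _ _ m _) _ (fun z : Ω × S => f z.1 z.2)) :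
    Measurable[m'] fun ω => f ω (X ω) :=
  hf.comp ((measurable_id'' hm).prodMk hX)

/-- A sum over times is a sum over episodes and steps. -/
lemma sum_range_mul_eq {α : Type*} [AddCommMonoid α] {H : ℕ} (K : ℕ) (g : ℕ → ℕ → α) :
    ∑ t ∈ Finset.range (K * H), g (t / H) (t % H)
      = ∑ k ∈ Finset.range K, ∑ h ∈ Finset.range H, g k h := by
  induction K with
  | zero => simp
  | succ K ih =>
    rw [Nat.succ_mul, Finset.sum_range_add, ih, Finset.sum_range_succ]
    congr 1
    refine Finset.sum_congr rfl fun h hh => ?_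
    have hh := Finset.mem_range.1 hh
    have hH : 0 < H := by omega
    rw [mul_comm K H, Nat.mul_add_div hH, Nat.div_eq_of_lt hh, Nat.mul_add_mod,
      Nat.mod_eq_of_lt hh, add_zero]

/-- The actions of a run are adapted, because the greedy policy is a measurable function of the data
of earlier episodes. -/
lemma IsRun.measurable_action [Finite A] [MeasurableSingletonClass A]
    (run : IsRun M W β sel Pr ℱ s a) (hsel : Measurable sel) :
    ∀ k < K, ∀ h < H, Measurable[ℱ (k * H + h)] (a k h) := by
  intro k
  induction k using Nat.strong_induction_on with
  | _ k ih =>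
    intro hk h hh
    have hmono : ∀ l < k, ∀ h' < H, ℱ (l * H + h') ≤ ℱ (k * H + h) := fun l hl h' hh' =>
      ℱ.mono ((mul_add_lt_mul hl hh').le.trans (Nat.le_add_right _ _))
    have hs : ∀ l < k, ∀ h' < H, Measurable[ℱ (k * H + h)] (s l h') := fun l hl h' hh' =>
      (run.adapted l (hl.trans hk) h' hh').mono (hmono l hl h' hh') le_rfl
    have ha : ∀ l < k, ∀ h' < H, Measurable[ℱ (k * H + h)] (a l h') := fun l hl h' hh' =>
      (ih l hl (hl.trans hk) h' hh').mono (hmono l hl h' hh') le_rfl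
    have hg := @LinearMDP.measurable_greedyPolicy S A _ _ d H K _ _ M W β sel hsel Ω
      (ℱ (k * H + h)) (runLog M.toEpisodicMDP s a) k hs ha
      (fun l hl h' hh' => (M.measurable_reward (hl.trans hk) hh').comp
        ((hs l hl h' hh').prodMk (ha l hl h' hh'))) h
    have e : a k h = fun ω =>
        greedyPolicy M.φ H W β sel (runLog M.toEpisodicMDP s a ω) k h (s k h ω) :=
      funext fun ω => run.action k hk h hh ω
    rw [e]
    exact hg.comp (measurable_id.prodMk (run.adapted k hk h hh))

lemma IsRun.measurable_state_of_le (run : IsRun M W β sel Pr ℱ s a) {k h t : ℕ} (hk : k < K)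
    (hh : h < H) (ht : k * H + h ≤ t) : Measurable[ℱ t] (s k h) :=
  (run.adapted k hk h hh).mono (ℱ.mono ht) le_rfl

lemma IsRun.measurable_action_of_le [Finite A] [MeasurableSingletonClass A]
    (run : IsRun M W β sel Pr ℱ s a) (hsel : Measurable sel) {k h t : ℕ}
    (hk : k < K) (hh : h < H) (ht : k * H + h ≤ t) : Measurable[ℱ t] (a k h) :=
  (run.measurable_action hsel k hk h hh).mono (ℱ.mono ht) le_rfl

lemma abs_noise_le {k h : ℕ} (hk : k < K) (hh : h < H) (D : Log S A) {f : S → ℝ}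
    (hf : Measurable f) {b : ℝ} (hb : ∀ x, |f x| ≤ b) : |M.noise D f h k| ≤ 2 * b := by
  have h1 := integral_transition_mem_Icc M.toEpisodicMDP hk hh (D.state k h, D.action k h) hf
    (fun x => abs_le.1 (hb x))
  have h2 := abs_le.1 (hb (D.state k (h + 1)))
  rw [LinearMDP.noise, abs_le]
  constructor <;> linarith [h1.1, h1.2, h2.1, h2.2]

lemma IsRun.measurable_noise [Finite A] [MeasurableSingletonClass A]
    (run : IsRun M W β sel Pr ℱ s a) (hsel : Measurable sel) {k h : ℕ} (hk : k < K)
    (hh : h + 1 < H) {f : Ω → S → ℝ}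
    (hf : @Measurable _ _ (@Prod.instMeasurableSpace _ _ (ℱ (k * H + h)) _) _
      (fun z : Ω × S => f z.1 z.2)) :
    Measurable[ℱ (k * H + h + 1)]
      fun ω => M.noise (runLog M.toEpisodicMDP s a ω) (f ω) h k := by
  have hm : ℱ (k * H + h) ≤ ℱ (k * H + h + 1) := ℱ.mono (Nat.le_succ _)
  have h1 : Measurable[ℱ (k * H + h)] fun ω => ∫ x, f ω x ∂(M.P k h (s k h ω, a k h ω)) :=
    @measurable_integral_transition S A _ _ H K M.toEpisodicMDP k h hk (by omega) Ω
      (ℱ (k * H + h)) (s k h) (a k h) (run.adapted k hk h (by omega))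
      (run.measurable_action hsel k hk h (by omega)) f hf
  exact (measurable_comp_graph hm (run.adapted k hk (h + 1) hh) hf).sub (h1.mono hm le_rfl)

/-- The noise of a predictable bounded function has conditional mean zero. -/
lemma IsRun.integral_mul_noise_eq_zero [IsProbabilityMeasure Pr] [Finite A]
    [MeasurableSingletonClass A] (run : IsRun M W β sel Pr ℱ s a) (hsel : Measurable sel)
    {k h : ℕ} (hk : k < K) (hh : h + 1 < H) {f : Ω → S → ℝ}
    (hf : @Measurable _ _ (@Prod.instMeasurableSpace _ _ (ℱ (k * H + h)) _) _
      (fun z : Ω × S => f z.1 z.2)) {b : ℝ} (hb : ∀ ω x, |f ω x| ≤ b)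
    {Z : Ω → ℝ} (hZ : Measurable[ℱ (k * H + h)] Z) {c : ℝ} (hc : ∀ ω, |Z ω| ≤ c) :
    ∫ ω, Z ω * M.noise (runLog M.toEpisodicMDP s a ω) (f ω) h k ∂Pr = 0 := by
  have hmk := M.isMarkov k hk h (by omega)
  have hsm : Measurable[ℱ (k * H + h)] fun ω => (s k h ω, a k h ω) :=
    (run.adapted k hk h (by omega)).prodMk (run.measurable_action hsel k hk h (by omega))
  have hX : Measurable (s k (h + 1)) := (run.adapted k hk (h + 1) hh).mono (ℱ.le _) le_rfl
  have hg : @Measurable _ _ (@Prod.instMeasurableSpace _ _ (ℱ (k * H + h)) _) _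
      (fun z : Ω × S => Z z.1 * f z.1 z.2) :=
    (hZ.comp (@measurable_fst _ _ (ℱ (k * H + h)) _)).mul hf
  have hgb : ∀ ω x, |Z ω * f ω x| ≤ c * b := fun ω x => by
    rw [abs_mul]
    exact mul_le_mul (hc ω) (hb ω x) (abs_nonneg _) ((abs_nonneg _).trans (hc ω))
  have key := integral_eq_integral_condLaw (ℱ.le (k * H + h)) hX
    ((M.P k h).comap (fun ω => (s k h ω, a k h ω)) hsm) (Kernel.IsMarkovKernel.comap _ hsm)
    (fun B hB => run.transition k hk h hh B hB) (f := fun ω x => Z ω * f ω x) hg hgb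
  simp only [Kernel.comap_apply, integral_const_mul] at key
  have h1 : Measurable fun ω => Z ω * f ω (s k (h + 1) ω) :=
    measurable_comp_graph (f := fun ω x => Z ω * f ω x) (ℱ.le (k * H + h)) hX hg
  have h2 : Measurable fun ω => Z ω * ∫ x, f ω x ∂(M.P k h (s k h ω, a k h ω)) := by
    have := @measurable_integral_transition S A _ _ H K M.toEpisodicMDP k h hk (by omega) Ω
      (ℱ (k * H + h)) (s k h) (a k h) (run.adapted k hk h (by omega))
      (run.measurable_action hsel k hk h (by omega)) f hf
    exact (hZ.mono (ℱ.le _) le_rfl).mul (this.mono (ℱ.le _) le_rfl)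
  have hfω : ∀ ω, Measurable (f ω) := fun ω =>
    hf.comp (@measurable_prodMk_left _ _ (ℱ (k * H + h)) _ ω)
  have hi1 : Integrable (fun ω => Z ω * f ω (s k (h + 1) ω)) Pr :=
    Integrable.of_bound h1.aestronglyMeasurable (c * b)
      (Filter.Eventually.of_forall fun ω => hgb ω _)
  have hi2 : Integrable (fun ω => Z ω * ∫ x, f ω x ∂(M.P k h (s k h ω, a k h ω))) Pr := by
    refine Integrable.of_bound h2.aestronglyMeasurable (c * b)
      (Filter.Eventually.of_forall fun ω => ?_)
    have := integral_transition_mem_Icc M.toEpisodicMDP hk (by omega : h < H)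
      (s k h ω, a k h ω) (hfω ω) (fun x => abs_le.1 (hb ω x))
    rw [Real.norm_eq_abs, abs_mul]
    exact mul_le_mul (hc ω) (abs_le.2 this) (abs_nonneg _) ((abs_nonneg _).trans (hc ω))
  have e : ∀ ω, Z ω * M.noise (runLog M.toEpisodicMDP s a ω) (f ω) h k
      = Z ω * f ω (s k (h + 1) ω) - Z ω * ∫ x, f ω x ∂(M.P k h (s k h ω, a k h ω)) := fun ω => by
    rw [LinearMDP.noise, mul_sub]; rfl
  simp only [e]
  rw [integral_sub hi1 hi2, key, sub_self]

/-- Exponential inequality for the noise of a run, summed over all episodes and steps, with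
predictable functions `f k h` and predictable multipliers `η k h`. -/
lemma IsRun.integral_exp_noise_le_one [IsProbabilityMeasure Pr] [Finite A]
    [MeasurableSingletonClass A] (run : IsRun M W β sel Pr ℱ s a) (hsel : Measurable sel)
    {f : ℕ → ℕ → Ω → S → ℝ} {η : ℕ → ℕ → Ω → ℝ} {C : ℝ} (hC0 : 0 ≤ C)
    (hf : ∀ k < K, ∀ h, h + 1 < H → @Measurable _ _
      (@Prod.instMeasurableSpace _ _ (ℱ (k * H + h)) _) _ (fun z : Ω × S => f k h z.1 z.2))
    (hfb : ∀ k < K, ∀ h, h + 1 < H → ∀ ω x, |f k h ω x| ≤ 1 / 2)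
    (hη : ∀ k < K, ∀ h, h + 1 < H → Measurable[ℱ (k * H + h)] (η k h))
    (hηC : ∀ k < K, ∀ h, h + 1 < H → ∀ ω, |η k h ω| ≤ C) :
    Integrable (fun ω => Real.exp (∑ k ∈ Finset.range K, ∑ h ∈ Finset.range H,
      if h + 1 < H then η k h ω * M.noise (runLog M.toEpisodicMDP s a ω) (f k h ω) h k
        - η k h ω ^ 2 / 2 else 0)) Pr ∧
    ∫ ω, Real.exp (∑ k ∈ Finset.range K, ∑ h ∈ Finset.range H,
      if h + 1 < H then η k h ω * M.noise (runLog M.toEpisodicMDP s a ω) (f k h ω) h k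
        - η k h ω ^ 2 / 2 else 0) ∂Pr ≤ 1 := by
  set η' : ℕ → Ω → ℝ := fun t ω => if t % H + 1 < H then η (t / H) (t % H) ω else 0 with hη'
  set ξ' : ℕ → Ω → ℝ := fun t ω => if t % H + 1 < H then
    M.noise (runLog M.toEpisodicMDP s a ω) (f (t / H) (t % H) ω) (t % H) (t / H) else 0 with hξ'
  have hsum : ∀ ω, (∑ k ∈ Finset.range K, ∑ h ∈ Finset.range H,
      if h + 1 < H then η k h ω * M.noise (runLog M.toEpisodicMDP s a ω) (f k h ω) h k
        - η k h ω ^ 2 / 2 else 0)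
      = ∑ t ∈ Finset.range (K * H), (η' t ω * ξ' t ω - η' t ω ^ 2 / 2) := by
    intro ω
    rw [← sum_range_mul_eq K (fun k h => if h + 1 < H then
      η k h ω * M.noise (runLog M.toEpisodicMDP s a ω) (f k h ω) h k - η k h ω ^ 2 / 2 else 0)]
    refine Finset.sum_congr rfl fun t _ => ?_
    simp only [hη', hξ']
    split_ifs <;> simp
  simp only [hsum]
  have hdiv : ∀ t < K * H, t / H < K := fun t ht => Nat.div_lt_of_lt_mul (by rwa [mul_comm])
  have hmod : ∀ t, t / H * H + t % H = t := fun t => Nat.div_add_mod' t H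
  have main := integral_exp_sum_le_one (Pr := Pr) ℱ η' ξ' (C := C) (K * H) ?_ ?_ ?_ ?_ ?_
  · obtain ⟨hm, ⟨b, hb⟩, hI⟩ := main
    refine ⟨?_, hI⟩
    exact Integrable.of_bound (hm.mono (ℱ.le _) le_rfl).aestronglyMeasurable b
      (Filter.Eventually.of_forall fun ω => by rw [Real.norm_eq_abs, Real.abs_exp]; exact hb ω)
  · intro t ht
    by_cases h : t % H + 1 < H
    · simp only [hη', if_pos h]
      have := hη _ (hdiv t ht) _ h
      rwa [hmod] at this
    · simp only [hη', if_neg h]; exact measurable_const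
  · intro t ht ω
    by_cases h : t % H + 1 < H
    · simp only [hη', if_pos h]
      exact hηC _ (hdiv t ht) _ h ω
    · simpa only [hη', if_neg h, abs_zero] using hC0
  · intro t ht
    by_cases h : t % H + 1 < H
    · simp only [hξ', if_pos h]
      have := run.measurable_noise hsel (hdiv t ht) h (hf _ (hdiv t ht) _ h)
      rwa [hmod] at this
    · simp only [hξ', if_neg h]; exact measurable_const
  · intro t ht ω
    by_cases h : t % H + 1 < H
    · simp only [hξ', if_pos h]
      have hfm := hf _ (hdiv t ht) _ h
      have := abs_noise_le (M := M) (hdiv t ht) (by omega : t % H < H)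
        (runLog M.toEpisodicMDP s a ω) (f := f (t / H) (t % H) ω)
        (hfm.comp (@measurable_prodMk_left _ _ (ℱ (t / H * H + t % H)) _ ω))
        (hfb _ (hdiv t ht) _ h ω)
      linarith
    · simp only [hξ', if_neg h, abs_zero, zero_le_one]
  · rintro t ht Z hZ ⟨b, hb⟩
    by_cases h : t % H + 1 < H
    · simp only [hξ', if_pos h]
      refine run.integral_mul_noise_eq_zero hsel (hdiv t ht) h (hf _ (hdiv t ht) _ h)
        (hfb _ (hdiv t ht) _ h) ?_ hb
      rwa [hmod]
    · simp [hξ', if_neg h]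

end RunNoise

/-! ### Discretization of the value estimates -/

section Discretization

open Matrix

variable {S A : Type*} {d H K : ℕ}

/-- The value functions that the algorithm can produce, truncated to `[-H, H]`: they are determined
by a weight vector `w` and a matrix `G`, the inverse Gram matrix. -/
noncomputable def clippedValue (φ : S → A → EuclideanSpace ℝ (Fin d)) (H : ℕ) (β : ℝ)
    (w : Fin d → ℝ) (G : Matrix (Fin d) (Fin d) ℝ) (x : S) : ℝ :=
  ⨆ b, max (-(H : ℝ)) (min (w ⬝ᵥ (φ x b).ofLp + β * √((φ x b).ofLp ⬝ᵥ G *ᵥ (φ x b).ofLp)) H)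

lemma abs_clippedValue_le [Nonempty A] (φ : S → A → EuclideanSpace ℝ (Fin d)) (H : ℕ) (β : ℝ)
    (w : Fin d → ℝ) (G : Matrix (Fin d) (Fin d) ℝ) (x : S) : |clippedValue φ H β w G x| ≤ H := by
  have hH : (0 : ℝ) ≤ H := Nat.cast_nonneg _
  have hub : ∀ r : ℝ, max (-(H : ℝ)) (min r H) ≤ H := fun r =>
    max_le (by linarith) (min_le_right _ _)
  rw [abs_le]
  refine ⟨?_, ciSup_le fun b => hub _⟩
  obtain ⟨b⟩ := ‹Nonempty A›
  refine le_trans (le_max_left _ _) (le_ciSup (f := fun b => max (-(H : ℝ))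
    (min (w ⬝ᵥ (φ x b).ofLp + β * √((φ x b).ofLp ⬝ᵥ G *ᵥ (φ x b).ofLp)) H)) ?_ b)
  exact ⟨H, by rintro _ ⟨b, rfl⟩; exact hub _⟩

/-- The value estimates belong to the parametric family as soon as they are bounded below. -/
lemma estV_eq_clippedValue [Finite A] [Nonempty A] (φ : S → A → EuclideanSpace ℝ (Fin d)) {H : ℕ}
    (W : ℕ) (β : ℝ) (D : Log S A) (k : ℕ) {h : ℕ} (hh : h < H)
    (hV : ∀ s, -(H : ℝ) ≤ estV φ H W β D k h s) :
    estV φ H W β D k h = clippedValue φ H β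
      (weight φ H W D k h (estV φ H W β D k (h + 1))) (gram φ H W D k h)⁻¹ := by
  ext s
  have e : ∀ b, max (-(H : ℝ)) (estQ φ H W β D k h s b)
      = max (-(H : ℝ)) (min (weight φ H W D k h (estV φ H W β D k (h + 1)) ⬝ᵥ (φ s b).ofLp
        + β * √((φ s b).ofLp ⬝ᵥ (gram φ H W D k h)⁻¹ *ᵥ (φ s b).ofLp)) H) := fun b => by
    rw [estQ_of_lt φ W β D k hh]; rfl
  rw [clippedValue]
  simp only [← e]
  refine le_antisymm (ciSup_le fun b => ?_) (ciSup_le fun b => ?_)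
  · exact (le_max_right _ _).trans (le_ciSup (f := fun b => max (-(H : ℝ)) (estQ φ H W β D k h s b))
      (Set.finite_range _).bddAbove b)
  · exact max_le (hV s) (estQ_le_estV φ H W β D k h s b)

lemma abs_iSup_sub_iSup_le {ι : Type*} [Finite ι] [Nonempty ι] {f g : ι → ℝ} {δ : ℝ}
    (h : ∀ b, |f b - g b| ≤ δ) : |(⨆ b, f b) - ⨆ b, g b| ≤ δ := by
  rw [abs_sub_le_iff]
  constructor
  · rw [sub_le_iff_le_add]
    refine ciSup_le fun b => ?_
    have h1 := (abs_sub_le_iff.1 (h b)).1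
    have h2 := le_ciSup (Set.finite_range g).bddAbove b
    linarith
  · rw [sub_le_iff_le_add]
    refine ciSup_le fun b => ?_
    have h1 := (abs_sub_le_iff.1 (h b)).2
    have h2 := le_ciSup (Set.finite_range f).bddAbove b
    linarith

lemma abs_sqrt_sub_sqrt_le (x y : ℝ) : |√x - √y| ≤ √|x - y| := by
  have key : ∀ x y : ℝ, √x ≤ √y + √|x - y| := fun x y => by
    rw [Real.sqrt_le_left (by positivity)]
    rcases le_or_gt 0 y with hy | hy
    · have h1 := Real.sq_sqrt hy
      have h2 := Real.sq_sqrt (abs_nonneg (x - y))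
      nlinarith [le_abs_self (x - y), Real.sqrt_nonneg y, Real.sqrt_nonneg |x - y|,
        mul_nonneg (Real.sqrt_nonneg y) (Real.sqrt_nonneg |x - y|)]
    · have h2 := Real.sq_sqrt (abs_nonneg (x - y))
      rw [Real.sqrt_eq_zero_of_nonpos hy.le]
      nlinarith [le_abs_self (x - y)]
  rw [abs_sub_le_iff]
  have h1 := key x y
  have h2 := key y x
  rw [abs_sub_comm y x] at h2
  constructor <;> linarith

lemma abs_dotProduct_sub_le {w w' v : Fin d → ℝ} {ε : ℝ} (hw : ∀ i, |w i - w' i| ≤ ε)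
    (hv : ∀ i, |v i| ≤ 1) : |w ⬝ᵥ v - w' ⬝ᵥ v| ≤ d * ε := by
  rw [← sub_dotProduct, dotProduct]
  refine (Finset.abs_sum_le_sum_abs _ _).trans ?_
  calc _ ≤ ∑ _i : Fin d, ε := Finset.sum_le_sum fun i _ => by
        rw [abs_mul, Pi.sub_apply]
        calc _ ≤ ε * 1 := mul_le_mul (hw i) (hv i) (abs_nonneg _) ((abs_nonneg _).trans (hw i))
          _ = ε := mul_one _
    _ = _ := by simp

lemma abs_clip_sub_clip_le (c x y : ℝ) :
    |max (-c) (min x c) - max (-c) (min y c)| ≤ |x - y| := by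
  rw [max_comm (-c), max_comm (-c)]
  exact (abs_max_sub_max_le_abs _ _ _).trans (abs_inf_sub_inf_le_abs x y c)

/-- The truncated values depend on their parameters in a Hölder continuous way. -/
lemma abs_clippedValue_sub_le [Finite A] [Nonempty A] {φ : S → A → EuclideanSpace ℝ (Fin d)}
    (hφ : ∀ s a, ‖φ s a‖ ≤ 1) (H : ℕ) {β : ℝ} (hβ : 0 ≤ β) {w w' : Fin d → ℝ}
    {G G' : Matrix (Fin d) (Fin d) ℝ} {ε : ℝ} (hw : ∀ i, |w i - w' i| ≤ ε)
    (hG : ∀ i j, |G i j - G' i j| ≤ ε) (x : S) :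
    |clippedValue φ H β w G x - clippedValue φ H β w' G' x| ≤ d * ε + β * (d * √ε) := by
  refine abs_iSup_sub_iSup_le fun b => ?_
  set v := (φ x b).ofLp
  have hv : ∀ i, |v i| ≤ 1 := fun i => (abs_apply_le_norm _ i).trans (hφ x b)
  refine (abs_clip_sub_clip_le _ _ _).trans ?_
  have h1 := abs_dotProduct_sub_le hw hv
  have h2 : |v ⬝ᵥ G *ᵥ v - v ⬝ᵥ G' *ᵥ v| ≤ d * (d * ε) := by
    rw [dotProduct_comm v, dotProduct_comm v]
    exact abs_dotProduct_sub_le (fun i => abs_dotProduct_sub_le (hG i) hv) hv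
  have h3 : |√(v ⬝ᵥ G *ᵥ v) - √(v ⬝ᵥ G' *ᵥ v)| ≤ d * √ε := by
    refine (abs_sqrt_sub_sqrt_le _ _).trans ((Real.sqrt_le_sqrt h2).trans ?_)
    rw [← mul_assoc, Real.sqrt_mul (by positivity), Real.sqrt_mul_self (Nat.cast_nonneg _)]
  have e : w ⬝ᵥ v + β * √(v ⬝ᵥ G *ᵥ v) - (w' ⬝ᵥ v + β * √(v ⬝ᵥ G' *ᵥ v))
      = (w ⬝ᵥ v - w' ⬝ᵥ v) + β * (√(v ⬝ᵥ G *ᵥ v) - √(v ⬝ᵥ G' *ᵥ v)) := by ring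
  rw [e]
  refine (abs_add_le _ _).trans (add_le_add h1 ?_)
  rw [abs_mul, abs_of_nonneg hβ]
  gcongr

/-- The integer grid that discretizes a direction `u`, a weight vector `w` and a matrix `G`,
to be scaled by the mesh size. -/
noncomputable def grid (d N : ℕ) : Finset ((Fin d → ℤ) × (Fin d → ℤ) × (Fin d × Fin d → ℤ)) :=
  Fintype.piFinset (fun _ => Finset.Icc (-(N : ℤ)) N) ×ˢ
    Fintype.piFinset (fun _ => Finset.Icc (-(N : ℤ)) N) ×ˢ
      Fintype.piFinset (fun _ => Finset.Icc (-(N : ℤ)) N)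

lemma card_grid (d N : ℕ) : (grid d N).card = (2 * N + 1) ^ (d + (d + d * d)) := by
  have h : (Finset.Icc (-(N : ℤ)) N).card = 2 * N + 1 := by
    rw [Int.card_Icc]; omega
  simp only [grid, Finset.card_product, Fintype.card_piFinset, h, Finset.prod_const,
    Finset.card_univ, Fintype.card_fin, Fintype.card_prod]
  ring

lemma exists_int_near {ε R x : ℝ} {N : ℕ} (hε : 0 < ε) (hx : |x| ≤ R) (hN : R / ε ≤ N) :
    ∃ g : ℤ, g ∈ Finset.Icc (-(N : ℤ)) N ∧ |x - ε * g| ≤ ε := by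
  have h1 : |x / ε| ≤ N := by
    rw [abs_div, abs_of_pos hε]
    exact (div_le_div_of_nonneg_right hx hε.le).trans hN
  rw [abs_le] at h1
  refine ⟨⌊x / ε⌋, Finset.mem_Icc.2 ⟨?_, ?_⟩, ?_⟩
  · rw [Int.le_floor]; push_cast; exact h1.1
  · have := (Int.floor_le (x / ε)).trans h1.2
    exact_mod_cast this
  · have h2 := Int.floor_le (x / ε)
    have h3 := (Int.lt_floor_add_one (x / ε)).le
    have e : x = ε * (x / ε) := by field_simp
    rw [abs_le]
    constructor
    · nlinarith only [h2, hε, e]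
    · nlinarith only [h3, hε, e]

lemma exists_grid_near {ε R : ℝ} {N : ℕ} (hε : 0 < ε) (hN : R / ε ≤ N) {u w : Fin d → ℝ}
    {G : Matrix (Fin d) (Fin d) ℝ} (hu : ∀ i, |u i| ≤ R) (hw : ∀ i, |w i| ≤ R)
    (hG : ∀ i j, |G i j| ≤ R) :
    ∃ g ∈ grid d N, (∀ i, |u i - ε * g.1 i| ≤ ε) ∧ (∀ i, |w i - ε * g.2.1 i| ≤ ε) ∧
      ∀ i j, |G i j - ε * g.2.2 (i, j)| ≤ ε := by
  choose g1 hg1 hg1' using fun i => exists_int_near hε (hu i) hN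
  choose g2 hg2 hg2' using fun i => exists_int_near hε (hw i) hN
  choose g3 hg3 hg3' using fun p : Fin d × Fin d => exists_int_near hε (hG p.1 p.2) hN
  refine ⟨(g1, g2, g3), ?_, hg1', hg2', fun i j => hg3' (i, j)⟩
  simp only [grid, Finset.mem_product, Fintype.mem_piFinset]
  exact ⟨hg1, hg2, hg3⟩

end Discretization

/-! ### From a bound on the grid to a bound on the noise -/

section Scores

open Matrix

variable {S A : Type*} [MeasurableSpace S] [MeasurableSpace A] {d H K : ℕ}

lemma LinearMDP.measurable_clippedValue [Finite A] (M : LinearMDP S A d H K)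
    (β : ℝ) (w : Fin d → ℝ) (G : Matrix (Fin d) (Fin d) ℝ) :
    Measurable (clippedValue M.φ H β w G) := by
  refine Measurable.iSup fun b => ?_
  have hφ : ∀ i, Measurable fun x => (M.φ x b).ofLp i := fun i =>
    (M.measurable_feature_apply i).comp (measurable_id.prodMk measurable_const)
  simp only [mulVec, dotProduct]
  refine measurable_const.max (Measurable.min (Measurable.add
    (Finset.measurable_sum _ fun i _ => (hφ i).const_mul _)
    (Measurable.const_mul (Measurable.sqrt ?_) β)) measurable_const)
  exact Finset.measurable_sum _ fun i _ => (hφ i).mul (Finset.measurable_sum _ fun j _ =>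
    (hφ j).const_mul _)

lemma LinearMDP.noise_const_mul (M : LinearMDP S A d H K) (D : Log S A) (f : S → ℝ) (c : ℝ)
    (h l : ℕ) : M.noise D (fun x => c * f x) h l = c * M.noise D f h l := by
  rw [noise, noise, integral_const_mul]; ring

lemma LinearMDP.abs_noise_sub_le (M : LinearMDP S A d H K) {k h : ℕ} (hk : k < K) (hh : h < H)
    (D : Log S A) {f g : S → ℝ} (hf : Measurable f) (hg : Measurable g) {b δ : ℝ}
    (hfb : ∀ x, |f x| ≤ b) (hgb : ∀ x, |g x| ≤ b) (hδ : ∀ x, |f x - g x| ≤ δ) :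
    |M.noise D f h k - M.noise D g h k| ≤ 2 * δ := by
  have := M.isMarkov k hk h hh
  have e : M.noise D f h k - M.noise D g h k = M.noise D (fun x => f x - g x) h k := by
    rw [noise, noise, noise, integral_sub]
    · ring
    · exact Integrable.of_bound hf.aestronglyMeasurable b (Filter.Eventually.of_forall hfb)
    · exact Integrable.of_bound hg.aestronglyMeasurable b (Filter.Eventually.of_forall hgb)
  rw [e]
  exact abs_noise_le hk hh D (hf.sub hg) hδ

/-- The exponent of the self-normalized exponential inequality in direction `u`, for the value
function with parameters `w` and `G`. -/
noncomputable def LinearMDP.score (M : LinearMDP S A d H K) (W : ℕ) (β : ℝ) (D : Log S A)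
    (k h : ℕ) (u w : Fin d → ℝ) (G : Matrix (Fin d) (Fin d) ℝ) : ℝ :=
  ∑ l ∈ Finset.Ico (epochStart H W k) k,
    ((u ⬝ᵥ feat M.φ D h l) * M.noise D (fun x => (2 * H : ℝ)⁻¹ * clippedValue M.φ H β w G x) h l
      - (u ⬝ᵥ feat M.φ D h l) ^ 2 / 2)

lemma LinearMDP.abs_score_sub_le [Finite A] [Nonempty A] (M : LinearMDP S A d H K) {W : ℕ} {β : ℝ}
    (hβ : 0 ≤ β) (D : Log S A) {k h L : ℕ} (hk : k < K) (hh : h < H)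
    (hL : k - epochStart H W k ≤ L) {u u' w w' : Fin d → ℝ} {G G' : Matrix (Fin d) (Fin d) ℝ}
    {ε t : ℝ} (ht : ∀ l ∈ Finset.Ico (epochStart H W k) k, |u ⬝ᵥ feat M.φ D h l| ≤ t)
    (hu : ∀ i, |u i - u' i| ≤ ε) (hw : ∀ i, |w i - w' i| ≤ ε) (hG : ∀ i j, |G i j - G' i j| ≤ ε)
    (hε0 : 0 ≤ ε) (ht0 : 0 ≤ t) (hdε : d * ε ≤ 1) :
    |M.score W β D k h u w G - M.score W β D k h u' w' G'|
      ≤ L * (t * (d * ε + β * (d * √ε)) + (2 + t) * (d * ε)) := by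
  have hH1 : (1 : ℝ) ≤ H := by exact_mod_cast (by omega : 1 ≤ H)
  have hbound : ∀ w G x, |(2 * H : ℝ)⁻¹ * clippedValue M.φ H β w G x| ≤ 1 / 2 := by
    intro w G x
    rw [abs_mul, abs_of_nonneg (by positivity)]
    calc _ ≤ (2 * H : ℝ)⁻¹ * H := by gcongr; exact abs_clippedValue_le _ _ _ _ _ _
      _ = 1 / 2 := by field_simp
  rw [score, score, ← Finset.sum_sub_distrib]
  refine (Finset.abs_sum_le_sum_abs _ _).trans ?_
  have hterm : ∀ l ∈ Finset.Ico (epochStart H W k) k,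
      |(u ⬝ᵥ feat M.φ D h l) * M.noise D (fun x => (2 * H : ℝ)⁻¹ * clippedValue M.φ H β w G x) h l
        - (u ⬝ᵥ feat M.φ D h l) ^ 2 / 2
        - ((u' ⬝ᵥ feat M.φ D h l) *
            M.noise D (fun x => (2 * H : ℝ)⁻¹ * clippedValue M.φ H β w' G' x) h l
          - (u' ⬝ᵥ feat M.φ D h l) ^ 2 / 2)|
      ≤ t * (d * ε + β * (d * √ε)) + (2 + t) * (d * ε) := by
    intro l hl
    have hlK : l < K := (Finset.mem_Ico.1 hl).2.trans hk
    have hv : ∀ i, |feat M.φ D h l i| ≤ 1 := fun i =>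
      (abs_apply_le_norm _ i).trans (M.norm_feature_le _ _)
    have h1 := abs_dotProduct_sub_le hu hv
    have h0 := ht l hl
    have hm : ∀ w G, Measurable fun x => (2 * H : ℝ)⁻¹ * clippedValue M.φ H β w G x := fun w G =>
      (M.measurable_clippedValue β w G).const_mul _
    have h2 : |M.noise D (fun x => (2 * H : ℝ)⁻¹ * clippedValue M.φ H β w G x) h l
        - M.noise D (fun x => (2 * H : ℝ)⁻¹ * clippedValue M.φ H β w' G' x) h l|
        ≤ d * ε + β * (d * √ε) := by
      refine (M.abs_noise_sub_le hlK hh D (hm w G) (hm w' G') (hbound w G) (hbound w' G')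
        (δ := (d * ε + β * (d * √ε)) / 2) fun x => ?_).trans (by linarith)
      rw [← mul_sub, abs_mul, abs_of_nonneg (by positivity)]
      have h3 := abs_clippedValue_sub_le M.norm_feature_le H hβ hw hG x
      have h4 : (2 * H : ℝ)⁻¹ ≤ 2⁻¹ := inv_anti₀ two_pos (by linarith)
      calc _ ≤ 2⁻¹ * (d * ε + β * (d * √ε)) :=
            mul_le_mul h4 h3 (abs_nonneg _) (by norm_num)
        _ = _ := by ring
    have h3 := abs_noise_le (M := M) hlK hh D (hm w' G') (hbound w' G')
    set a := u ⬝ᵥ feat M.φ D h l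
    set a' := u' ⬝ᵥ feat M.φ D h l
    set e := M.noise D (fun x => (2 * H : ℝ)⁻¹ * clippedValue M.φ H β w G x) h l
    set e' := M.noise D (fun x => (2 * H : ℝ)⁻¹ * clippedValue M.φ H β w' G' x) h l
    have hsum : |a + a'| ≤ 2 * t + 2 := by
      have : a + a' = 2 * a - (a - a') := by ring
      rw [abs_le] at h0 h1 ⊢
      constructor <;> linarith [h0.1, h0.2, h1.1, h1.2]
    have e1 : a * e - a ^ 2 / 2 - (a' * e' - a' ^ 2 / 2)
        = a * (e - e') + (a - a') * e' - (a - a') * (a + a') / 2 := by ring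
    rw [e1]
    have b1 : |a * (e - e')| ≤ t * (d * ε + β * (d * √ε)) := by
      rw [abs_mul]; exact mul_le_mul h0 h2 (abs_nonneg _) ht0
    have b2 : |(a - a') * e'| ≤ d * ε * 1 := by
      rw [abs_mul]
      exact mul_le_mul h1 (by linarith) (abs_nonneg _) (by positivity)
    have b3 : |(a - a') * (a + a')| ≤ d * ε * (2 * t + 2) := by
      rw [abs_mul]
      exact mul_le_mul h1 hsum (abs_nonneg _) (by positivity)
    rw [abs_le] at b1 b2 b3 ⊢
    constructor <;> linarith [b1.1, b1.2, b2.1, b2.2, b3.1, b3.2]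
  refine (Finset.sum_le_sum hterm).trans ?_
  rw [Finset.sum_const, nsmul_eq_mul, Nat.card_Ico]
  gcongr

/-- The weights of a least-squares fit to responses bounded by `b` are at most `L * b`. -/
lemma LinearMDP.abs_weight_apply_le (M : LinearMDP S A d H K) (D : Log S A) {W k h L : ℕ}
    (hL : k - epochStart H W k ≤ L) {f : S → ℝ} {b : ℝ} (hb0 : 0 ≤ b)
    (hb : ∀ l < k, |D.reward l h + f (D.state l (h + 1))| ≤ b) (i : Fin d) :
    |weight M.φ H W D k h f i| ≤ L * b := by
  have h1 := leastSquares_dotProduct (Finset.Ico (epochStart H W k) k) (feat M.φ D h)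
    (fun l => D.reward l h + f (D.state l (h + 1))) (Pi.single i 1)
  rw [dotProduct_single_one] at h1
  change weight M.φ H W D k h f i = _ at h1
  rw [h1]
  refine (Finset.abs_sum_le_sum_abs _ _).trans ?_
  calc _ ≤ ∑ l ∈ Finset.Ico (epochStart H W k) k, b * 1 := by
        refine Finset.sum_le_sum fun l hl => ?_
        rw [abs_mul]
        exact mul_le_mul (hb l (Finset.mem_Ico.1 hl).2)
          (abs_dotProduct_regGram_inv_le_one _ _ (by simp) hl) (abs_nonneg _) hb0
    _ ≤ _ := by
        rw [mul_one, Finset.sum_const, nsmul_eq_mul, Nat.card_Ico]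
        gcongr

/-- If all scores of grid points are at most `ι`, then the noise of the value estimates is bounded
by a multiple of the bonus.  The number `t > 0` is the length of the direction at which the score is
evaluated, and may be chosen freely. -/
lemma LinearMDP.abs_sum_noise_le [Finite A] [Nonempty A] (M : LinearMDP S A d H K) {W : ℕ} {β : ℝ}
    (hβ : 0 ≤ β) (D : Log S A) {k h L N : ℕ} (hk : k < K) (hh : h + 1 < H)
    (hL : k - epochStart H W k ≤ L)
    (hD : ∀ l < k, ∀ h < H, D.reward l h = M.r l h (D.state l h) (D.action l h))
    (hV : ∀ j, h < j → ∀ s, |estV M.φ H W β D k j s| ≤ H)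
    {ε t R ι : ℝ} (hε0 : 0 < ε) (ht0 : 0 < t) (hdε : d * ε ≤ 1) (hN : R / ε ≤ N) (htR : t ≤ R)
    (hR1 : 1 ≤ R) (hLR : L * (1 + H) ≤ R)
    (herr : L * (t * (d * ε + β * (d * √ε)) + (2 + t) * (d * ε)) ≤ 1)
    (hscore : ∀ g ∈ grid d N, M.score W β D k h (fun i => ε * g.1 i) (fun i => ε * g.2.1 i)
      (Matrix.of fun i j => ε * g.2.2 (i, j)) ≤ ι) (s : S) (a : A) :
    |∑ l ∈ Finset.Ico (epochStart H W k) k, M.noise D (estV M.φ H W β D k (h + 1)) h l *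
      (feat M.φ D h l ⬝ᵥ (gram M.φ H W D k h)⁻¹ *ᵥ (M.φ s a).ofLp)|
      ≤ 2 * H * ((ι + 1) / t + t / 2) * bonus M.φ H W D k h s a := by
  have hH1 : (1 : ℝ) ≤ H := by exact_mod_cast (by omega : 1 ≤ H)
  have hcl := estV_eq_clippedValue M.φ W β D k hh (fun s => (abs_le.1 (hV _ h.lt_succ_self s)).1)
  set w := weight M.φ H W D k (h + 1) (estV M.φ H W β D k (h + 1 + 1)) with hw
  set G := (gram M.φ H W D k (h + 1))⁻¹ with hG
  have hwR : ∀ i, |w i| ≤ R := fun i => by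
    refine (M.abs_weight_apply_le D hL (b := 1 + H) (by positivity) (fun l hl => ?_) i).trans hLR
    have h1 := M.reward_mem l (hl.trans hk) (h + 1) hh (D.state l (h + 1)) (D.action l (h + 1))
    have h2 := abs_le.1 (hV (h + 1 + 1) (by omega) (D.state l (h + 1 + 1)))
    rw [hD l hl _ hh, abs_le]
    constructor <;> linarith [h1.1, h1.2, h2.1, h2.2]
  have hGR : ∀ i j, |G i j| ≤ R := fun i j => (abs_regGram_inv_apply_le_one _ _ i j).trans hR1
  rw [gram_eq_regGram]
  set I := Finset.Ico (epochStart H W k) k with hI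
  set x := feat M.φ D h with hx
  set v := (M.φ s a).ofLp with hv
  have hsq := sum_sq_le_dotProduct_regGram_inv I x v
  have hnorm := normSq_regGram_inv_mulVec_le I x v
  have hbon : bonus M.φ H W D k h s a ^ 2 = v ⬝ᵥ (regGram I x)⁻¹ *ᵥ v :=
    Real.sq_sqrt (dotProduct_regGram_inv_mulVec_self_nonneg I x v)
  have hb0 : 0 ≤ bonus M.φ H W D k h s a := Real.sqrt_nonneg _
  set B := bonus M.φ H W D k h s a
  set y := (regGram I x)⁻¹ *ᵥ v with hy
  -- the noise of the normalized value function
  set e : ℕ → ℝ := fun l => M.noise D (fun x => (2 * H : ℝ)⁻¹ * clippedValue M.φ H β w G x) h l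
    with he
  have hnoise : ∀ l, M.noise D (estV M.φ H W β D k (h + 1)) h l = 2 * H * e l := fun l => by
    rw [he, hcl]; simp only [M.noise_const_mul]; field_simp
  -- the bound for an arbitrary direction of length at most `t`
  have hdir : ∀ u : Fin d → ℝ, u ⬝ᵥ u ≤ t ^ 2 → ∑ l ∈ I, (u ⬝ᵥ x l) ^ 2 ≤ t ^ 2 →
      ∑ l ∈ I, (u ⬝ᵥ x l) * e l ≤ ι + 1 + t ^ 2 / 2 := by
    intro u hu1 hu2
    have huR : ∀ i, |u i| ≤ R := fun i => by
      refine le_trans (abs_le_of_sq_le_sq ?_ ht0.le) htR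
      refine le_trans ?_ hu1
      rw [sq]
      exact Finset.single_le_sum (f := fun i => u i * u i) (fun _ _ => mul_self_nonneg _)
        (Finset.mem_univ i)
    have hut : ∀ l ∈ I, |u ⬝ᵥ x l| ≤ t := fun l hl => by
      refine abs_le_of_sq_le_sq ?_ ht0.le
      exact le_trans (Finset.single_le_sum (f := fun l => (u ⬝ᵥ x l) ^ 2)
        (fun _ _ => sq_nonneg _) hl) hu2
    obtain ⟨g, hg, g1, g2, g3⟩ := exists_grid_near hε0 hN huR hwR hGR
    have h1 := (abs_le.1 (M.abs_score_sub_le hβ D hk (by omega) hL hut g1 g2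
      (G := G) (G' := Matrix.of fun i j => ε * g.2.2 (i, j)) g3 hε0.le ht0.le hdε)).2
    have h2 := hscore g hg
    have h3 : M.score W β D k h u w G = ∑ l ∈ I, (u ⬝ᵥ x l) * e l
        - (∑ l ∈ I, (u ⬝ᵥ x l) ^ 2) / 2 := by
      rw [score, Finset.sum_sub_distrib, Finset.sum_div]
    linarith
  have hsum : ∑ l ∈ I, M.noise D (estV M.φ H W β D k (h + 1)) h l * (x l ⬝ᵥ y)
      = 2 * H * ∑ l ∈ I, (y ⬝ᵥ x l) * e l := by
    rw [Finset.mul_sum]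
    refine Finset.sum_congr rfl fun l _ => ?_
    rw [hnoise, dotProduct_comm]; ring
  rw [hsum, abs_mul, abs_of_nonneg (by positivity), mul_assoc (2 * (H : ℝ))]
  refine mul_le_mul_of_nonneg_left ?_ (by positivity)
  rcases hb0.eq_or_lt with hB | hB
  · -- if the bonus vanishes then so do all coefficients
    rw [← hB] at hbon ⊢
    have hz : ∀ l ∈ I, y ⬝ᵥ x l = 0 := fun l hl => by
      have h1 := Finset.single_le_sum (f := fun l => (x l ⬝ᵥ y) ^ 2)
        (fun _ _ => sq_nonneg _) hl
      have h2 : (x l ⬝ᵥ y) ^ 2 ≤ 0 := by linarith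
      rw [dotProduct_comm]
      exact pow_eq_zero_iff two_ne_zero |>.1 (le_antisymm h2 (sq_nonneg _))
    rw [Finset.sum_eq_zero fun l hl => by rw [hz l hl, zero_mul]]
    simp
  · have hscale : ∀ σ : ℝ, σ ^ 2 = 1 →
        σ * ∑ l ∈ I, (y ⬝ᵥ x l) * e l ≤ ((ι + 1) / t + t / 2) * B := by
      intro σ hσ
      have hc2 : (σ * t / B) ^ 2 * B ^ 2 = t ^ 2 := by
        rw [div_pow, mul_pow, hσ]; field_simp
      have h1 := hdir ((σ * t / B) • y) ?_ ?_
      · have e1 : ∑ l ∈ I, ((σ * t / B) • y ⬝ᵥ x l) * e l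
            = t / B * (σ * ∑ l ∈ I, (y ⬝ᵥ x l) * e l) := by
          rw [Finset.mul_sum, Finset.mul_sum]
          refine Finset.sum_congr rfl fun l _ => ?_
          rw [smul_dotProduct, smul_eq_mul]; ring
        rw [e1] at h1
        have e2 : ((ι + 1) / t + t / 2) * B = (ι + 1 + t ^ 2 / 2) / (t / B) := by
          field_simp
        rw [e2, le_div_iff₀ (by positivity)]
        linarith
      · rw [smul_dotProduct, dotProduct_smul, smul_eq_mul, smul_eq_mul, ← mul_assoc, ← sq, ← hc2,
          hbon]
        gcongr
      · simp only [smul_dotProduct, smul_eq_mul, mul_pow, ← Finset.mul_sum]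
        rw [← hc2, hbon]
        simp only [dotProduct_comm y]
        gcongr
    rw [abs_le]
    constructor
    · linarith [hscale (-1) (by norm_num)]
    · linarith [hscale 1 (by norm_num)]

end Scores

/-! ### The high-probability event -/

section Event

open Matrix

variable {S A : Type*} [MeasurableSpace S] [MeasurableSpace A] {d H K : ℕ}
  {Ω : Type*} {mΩ : MeasurableSpace Ω}
  {M : LinearMDP S A d H K} {W : ℕ} {β : ℝ} {sel : (A → ℝ) → A} {Pr : Measure Ω}
  {ℱ : Filtration ℕ mΩ} {s : ℕ → ℕ → Ω → S} {a : ℕ → ℕ → Ω → A}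

lemma IsRun.measurable_feat [Finite A] [MeasurableSingletonClass A]
    (run : IsRun M W β sel Pr ℱ s a) (hsel : Measurable sel) {k h : ℕ} (hk : k < K) (hh : h < H)
    (i : Fin d) :
    Measurable[ℱ (k * H + h)] fun ω => feat M.φ (runLog M.toEpisodicMDP s a ω) h k i :=
  (M.measurable_feature_apply i).comp
    ((run.adapted k hk h hh).prodMk (run.measurable_action hsel k hk h hh))

/-- The exponential inequality for the scores. -/
lemma IsRun.integral_exp_score_le_one [IsProbabilityMeasure Pr] [Finite A] [Nonempty A]
    [MeasurableSingletonClass A] (run : IsRun M W β sel Pr ℱ s a) (hsel : Measurable sel)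
    {k h : ℕ} (hk : k < K) (hh : h + 1 < H) (u w : Fin d → ℝ) (G : Matrix (Fin d) (Fin d) ℝ) :
    Integrable (fun ω => Real.exp (M.score W β (runLog M.toEpisodicMDP s a ω) k h u w G)) Pr ∧
    ∫ ω, Real.exp (M.score W β (runLog M.toEpisodicMDP s a ω) k h u w G) ∂Pr ≤ 1 := by
  have hH1 : (1 : ℝ) ≤ H := by exact_mod_cast (by omega : 1 ≤ H)
  set f : ℕ → ℕ → Ω → S → ℝ := fun _ _ _ x => (2 * H : ℝ)⁻¹ * clippedValue M.φ H β w G x with hf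
  set I := Finset.Ico (epochStart H W k) k with hI
  set η : ℕ → ℕ → Ω → ℝ := fun l h' ω => if h' = h ∧ l ∈ I then
    u ⬝ᵥ feat M.φ (runLog M.toEpisodicMDP s a ω) h' l else 0 with hη
  have hfm : Measurable fun x => (2 * H : ℝ)⁻¹ * clippedValue M.φ H β w G x :=
    (M.measurable_clippedValue β w G).const_mul _
  have key := run.integral_exp_noise_le_one hsel (f := f) (η := η)
    (C := ‖(WithLp.toLp 2 u : EuclideanSpace ℝ (Fin d))‖) (norm_nonneg _) ?_ ?_ ?_ ?_
  · have e : ∀ ω, (∑ l ∈ Finset.range K, ∑ h' ∈ Finset.range H, if h' + 1 < H then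
        η l h' ω * M.noise (runLog M.toEpisodicMDP s a ω) (f l h' ω) h' l - η l h' ω ^ 2 / 2 else 0)
        = M.score W β (runLog M.toEpisodicMDP s a ω) k h u w G := by
      intro ω
      have hsub : I ⊆ Finset.range K := fun l hl =>
        Finset.mem_range.2 ((Finset.mem_Ico.1 hl).2.trans hk)
      rw [LinearMDP.score, ← Finset.sum_subset hsub]
      · refine Finset.sum_congr rfl fun l hl => ?_
        rw [Finset.sum_eq_single h]
        · have hl' : l ∈ I := hl
          simp [hη, hf, hl', hh]
        · intro h' _ hne
          simp [hη, hne]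
        · intro hn; exact absurd (Finset.mem_range.2 (by omega)) hn
      · intro l _ hl
        exact Finset.sum_eq_zero fun h' _ => by simp [hη, hl]
    simpa only [e] using key
  · exact fun l _ h' _ => hfm.comp (@measurable_snd _ _ (ℱ (l * H + h')) _)
  · intro l _ h' _ ω x
    simp only [hf]
    rw [abs_mul, abs_of_nonneg (by positivity)]
    calc _ ≤ (2 * H : ℝ)⁻¹ * H := by gcongr; exact abs_clippedValue_le _ _ _ _ _ _
      _ = 1 / 2 := by field_simp
  · intro l hl h' hh'
    by_cases hc : h' = h ∧ l ∈ I
    · simp only [hη, if_pos hc, dotProduct]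
      exact Finset.measurable_sum _ fun i _ =>
        (run.measurable_feat hsel hl (by omega) i).const_mul _
    · simp only [hη, if_neg hc]; exact measurable_const
  · intro l hl h' hh' ω
    by_cases hc : h' = h ∧ l ∈ I
    · simp only [hη, if_pos hc]
      refine (abs_dotProduct_ofLp_le (WithLp.toLp 2 u) _).trans ?_
      exact mul_le_of_le_one_right (norm_nonneg _) (M.norm_feature_le _ _)
    · simp only [hη, if_neg hc, abs_zero]; exact norm_nonneg _

/-- The value gap is predictable: it is determined by the data of earlier episodes. -/
lemma IsRun.measurable_valueGap [Finite A] [MeasurableSingletonClass A]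
    (run : IsRun M W β sel Pr ℱ s a) (hsel : Measurable sel) {k : ℕ} (hk : k < K) (h j : ℕ) :
    @Measurable _ _ (@Prod.instMeasurableSpace _ _ (ℱ (k * H + h)) _) _
      (fun z : Ω × S => M.valueGap W β (runLog M.toEpisodicMDP s a z.1) k
        (greedyPolicy M.φ H W β sel (runLog M.toEpisodicMDP s a z.1) k) j z.2) := by
  have hle : ∀ l < k, ∀ h' < H, l * H + h' ≤ k * H + h := fun l hl h' hh' =>
    (mul_add_lt_mul hl hh').le.trans (Nat.le_add_right _ _)
  have hs : ∀ l < k, ∀ h' < H, Measurable[ℱ (k * H + h)] (s l h') := fun l hl h' hh' =>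
    run.measurable_state_of_le (hl.trans hk) hh' (hle l hl h' hh')
  have ha : ∀ l < k, ∀ h' < H, Measurable[ℱ (k * H + h)] (a l h') := fun l hl h' hh' =>
    run.measurable_action_of_le hsel (hl.trans hk) hh' (hle l hl h' hh')
  have hr : ∀ l < k, ∀ h' < H, Measurable[ℱ (k * H + h)]
      fun ω => (runLog M.toEpisodicMDP s a ω).reward l h' := fun l hl h' hh' =>
    (M.measurable_reward (hl.trans hk) hh').comp ((hs l hl h' hh').prodMk (ha l hl h' hh'))
  have h1 := (@LinearMDP.measurable_estimates S A _ _ d H K _ _ M W β Ω (ℱ (k * H + h))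
    (runLog M.toEpisodicMDP s a) k hs ha hr j).2
  have h2 := @LinearMDP.measurable_policyValue S A _ _ d H K M k hk Ω (ℱ (k * H + h))
    (fun ω => greedyPolicy M.φ H W β sel (runLog M.toEpisodicMDP s a ω) k)
    (fun j _ => @LinearMDP.measurable_greedyPolicy S A _ _ d H K _ _ M W β sel hsel Ω
      (ℱ (k * H + h)) (runLog M.toEpisodicMDP s a) k hs ha hr j) j
  exact (measurable_const.max (h1.min measurable_const)).sub h2

lemma LinearMDP.abs_valueGap_le (M : LinearMDP S A d H K) {k : ℕ} (hk : k < K)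
    {π : ℕ → S → A} (hπ : ∀ j, Measurable (π j)) (D : Log S A) (h : ℕ) (x : S) :
    |M.valueGap W β D k π h x| ≤ 2 * H := by
  have hH : (0 : ℝ) ≤ H := Nat.cast_nonneg _
  have h1 := M.policyValue_mem_Icc_zero_H hk (fun j _ => hπ j) h x
  have h2 : max (-(H : ℝ)) (min (estV M.φ H W β D k h x) H) ≤ H :=
    max_le (by linarith) (min_le_right _ _)
  have h3 := le_max_left (-(H : ℝ)) (min (estV M.φ H W β D k h x) H)
  rw [valueGap, abs_le]
  constructor <;> linarith [h1.1, h1.2]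

/-- The martingale part of the regret in the episodes that satisfy `P`, a condition that does not
depend on the data. -/
noncomputable def LinearMDP.martingalePart (M : LinearMDP S A d H K) (W : ℕ) (β : ℝ)
    (sel : (A → ℝ) → A) (D : Log S A) (P : ℕ → Prop) [DecidablePred P] : ℝ :=
  ∑ k ∈ Finset.range K, if P k then ∑ h ∈ Finset.range H, if h + 1 < H then
    M.noise D (M.valueGap W β D k (greedyPolicy M.φ H W β sel D k) (h + 1)) h k else 0 else 0

/-- The exponential inequality for the martingale part of the regret. -/
lemma IsRun.integral_exp_martingalePart_le_one [IsProbabilityMeasure Pr] [Finite A]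
    [MeasurableSingletonClass A] (run : IsRun M W β sel Pr ℱ s a) (hsel : Measurable sel)
    (P : ℕ → Prop) [DecidablePred P] (hH : 0 < H) {c : ℝ} (hc : 0 ≤ c) :
    Integrable (fun ω => Real.exp (-c / (4 * H) *
        M.martingalePart W β sel (runLog M.toEpisodicMDP s a ω) P
        - (∑ _k ∈ Finset.range K, ∑ h ∈ Finset.range H, if h + 1 < H then c ^ 2 / 2 else 0))) Pr ∧
    ∫ ω, Real.exp (-c / (4 * H) *
        M.martingalePart W β sel (runLog M.toEpisodicMDP s a ω) P
        - (∑ _k ∈ Finset.range K, ∑ h ∈ Finset.range H, if h + 1 < H then c ^ 2 / 2 else 0))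
        ∂Pr ≤ 1 := by
  have hH0 : (0 : ℝ) < H := by exact_mod_cast hH
  set f : ℕ → ℕ → Ω → S → ℝ := fun k h ω x => if P k then
    (4 * H : ℝ)⁻¹ * M.valueGap W β (runLog M.toEpisodicMDP s a ω) k
      (greedyPolicy M.φ H W β sel (runLog M.toEpisodicMDP s a ω) k) (h + 1) x else 0 with hf
  have key := run.integral_exp_noise_le_one hsel (f := f) (η := fun _ _ _ => -c) (C := c) hc
    ?_ ?_ ?_ ?_
  · have e : ∀ ω, (∑ k ∈ Finset.range K, ∑ h ∈ Finset.range H, if h + 1 < H then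
        -c * M.noise (runLog M.toEpisodicMDP s a ω) (f k h ω) h k - (-c) ^ 2 / 2 else 0)
        = -c / (4 * H) * M.martingalePart W β sel (runLog M.toEpisodicMDP s a ω) P
        - (∑ _k ∈ Finset.range K, ∑ h ∈ Finset.range H, if h + 1 < H then c ^ 2 / 2 else 0) := by
      intro ω
      rw [LinearMDP.martingalePart, Finset.mul_sum, ← Finset.sum_sub_distrib]
      refine Finset.sum_congr rfl fun k _ => ?_
      by_cases hP : P k
      · rw [if_pos hP, Finset.mul_sum, ← Finset.sum_sub_distrib]
        refine Finset.sum_congr rfl fun h _ => ?_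
        split_ifs
        · simp only [hf, if_pos hP, M.noise_const_mul]
          field_simp
        · simp
      · rw [if_neg hP, mul_zero, zero_sub, ← Finset.sum_neg_distrib]
        refine Finset.sum_congr rfl fun h _ => ?_
        split_ifs
        · simp [hf, if_neg hP, LinearMDP.noise]
        · simp
    simpa only [e] using key
  · intro k hk h _
    by_cases hP : P k
    · simp only [hf, if_pos hP]
      exact (run.measurable_valueGap hsel hk h (h + 1)).const_mul _
    · simp only [hf, if_neg hP]; exact measurable_const
  · intro k hk h _ ω x
    by_cases hP : P k
    · simp only [hf, if_pos hP]
      have := M.abs_valueGap_le (W := W) (β := β) hk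
        (M.measurable_greedyPolicy_const W β hsel (runLog M.toEpisodicMDP s a ω) k)
        (runLog M.toEpisodicMDP s a ω) (h + 1) x
      rw [abs_mul, abs_of_nonneg (by positivity)]
      calc _ ≤ (4 * H : ℝ)⁻¹ * (2 * H) := by gcongr
        _ = 1 / 2 := by field_simp; norm_num
    · simp [hf, if_neg hP]
  · exact fun k _ h _ => measurable_const
  · exact fun k _ h _ ω => by rw [abs_neg, abs_of_nonneg hc]

/-- With probability at least `1 - p`, all scores of grid points are at most logarithmic and the
martingale part of the regret obeys an Azuma–Hoeffding bound. -/
lemma IsRun.exists_event [IsProbabilityMeasure Pr] [Finite A]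
    [MeasurableSingletonClass A] (run : IsRun M W β sel Pr ℱ s a) (hsel : Measurable sel)
    (P : ℕ → Prop) [DecidablePred P] (hH : 0 < H) (hK : 0 < K) {c : ℝ} (hc : 0 < c)
    {p : ℝ} (hp : 0 < p) (ε : ℝ) (N : ℕ) :
    ∃ E : Set Ω, ENNReal.ofReal (1 - p) ≤ Pr E ∧ ∀ ω ∈ E,
      (∀ k < K, ∀ h, h + 1 < H → ∀ g ∈ grid d N,
        M.score W β (runLog M.toEpisodicMDP s a ω) k h (fun i => ε * g.1 i)
          (fun i => ε * g.2.1 i) (Matrix.of fun i j => ε * g.2.2 (i, j))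
          ≤ Real.log (2 * (((K * H : ℕ) : ℝ) * (grid d N).card) / p)) ∧
      -M.martingalePart W β sel (runLog M.toEpisodicMDP s a ω) P
        ≤ 4 * H * (Real.log (2 / p) / c + c * ((K * H : ℕ) : ℝ) / 2) := by
  have : Nonempty A := ⟨sel 0⟩
  have hH0 : (0 : ℝ) < H := by exact_mod_cast hH
  set J := Finset.range K ×ˢ Finset.range (H - 1) ×ˢ grid d N with hJ
  set sc : (ℕ × ℕ × ((Fin d → ℤ) × (Fin d → ℤ) × (Fin d × Fin d → ℤ))) → Ω → ℝ := fun j ω =>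
    Real.exp (M.score W β (runLog M.toEpisodicMDP s a ω) j.1 j.2.1 (fun i => ε * j.2.2.1 i)
      (fun i => ε * j.2.2.2.1 i) (Matrix.of fun i i' => ε * j.2.2.2.2 (i, i'))) with hsc
  set az : Ω → ℝ := fun ω => Real.exp (-c / (4 * H) *
        M.martingalePart W β sel (runLog M.toEpisodicMDP s a ω) P
        - (∑ _k ∈ Finset.range K, ∑ h ∈ Finset.range H, if h + 1 < H then c ^ 2 / 2 else 0))
    with haz
  set q : ℝ := ((K * H : ℕ) : ℝ) * (grid d N).card with hq
  have hgrid : 0 < (grid d N).card := by rw [card_grid]; positivity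
  have hq0 : 0 < q := by
    rw [hq]; exact_mod_cast Nat.mul_pos (Nat.mul_pos hK hH) hgrid
  have hscore : ∀ j ∈ J, Integrable (sc j) Pr ∧ ∫ ω, sc j ω ∂Pr ≤ 1 := by
    intro j hj
    simp only [hJ, Finset.mem_product, Finset.mem_range] at hj
    exact run.integral_exp_score_le_one hsel hj.1 (by omega) _ _ _
  have hazuma := run.integral_exp_martingalePart_le_one hsel P hH hc.le
  -- one application of Markov's inequality to `Y` covers all scores and the martingale part
  set Y : Ω → ℝ := fun ω => (∑ j ∈ J, sc j ω) / q + az ω with hY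
  have hs1 : Integrable (fun ω => (∑ j ∈ J, sc j ω) / q) Pr :=
    (integrable_finsetSum J fun j hj => (hscore j hj).1).div_const q
  have hYi : Integrable Y Pr := hs1.add hazuma.1
  have hY0 : ∀ ω, 0 ≤ Y ω := fun ω => add_nonneg
    (div_nonneg (Finset.sum_nonneg fun j _ => (Real.exp_pos _).le) hq0.le) (Real.exp_pos _).le
  have hJq : (J.card : ℝ) ≤ q := by
    rw [hq, hJ]
    simp only [Finset.card_product, Finset.card_range]
    rw [← mul_assoc]
    exact_mod_cast Nat.mul_le_mul_right _ (Nat.mul_le_mul_left _ (Nat.sub_le _ _))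
  have hYI : ∫ ω, Y ω ∂Pr ≤ 2 := by
    have h1 : ∫ ω, (∑ j ∈ J, sc j ω) / q ∂Pr ≤ 1 := by
      rw [integral_div, integral_finsetSum J fun j hj => (hscore j hj).1, div_le_one hq0]
      refine (Finset.sum_le_sum fun j hj => (hscore j hj).2).trans ?_
      simpa using hJq
    rw [hY, integral_add hs1 hazuma.1]
    linarith [hazuma.2]
  have hmarkov := mul_meas_ge_le_integral_of_nonneg (Filter.Eventually.of_forall hY0) hYi (2 / p)
  have hbad : Pr.real {ω | 2 / p ≤ Y ω} ≤ p := by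
    have h1 : 2 / p * Pr.real {ω | 2 / p ≤ Y ω} ≤ 2 := hmarkov.trans hYI
    rw [div_mul_eq_mul_div, div_le_iff₀ hp] at h1
    linarith
  refine ⟨{ω | 2 / p ≤ Y ω}ᶜ, ?_, fun ω hω => ?_⟩
  · have h1 : (1 : ENNReal) ≤ Pr {ω | 2 / p ≤ Y ω} + Pr {ω | 2 / p ≤ Y ω}ᶜ := by
      rw [← measure_univ (μ := Pr), ← Set.union_compl_self {ω | 2 / p ≤ Y ω}]
      exact measure_union_le _ _
    have h2 : Pr {ω | 2 / p ≤ Y ω} ≤ ENNReal.ofReal p := by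
      rw [← ofReal_measureReal (measure_ne_top _ _)]
      exact ENNReal.ofReal_le_ofReal hbad
    rw [ENNReal.ofReal_sub _ hp.le, ENNReal.ofReal_one, tsub_le_iff_left]
    exact h1.trans (by gcongr)
  · have hYω : Y ω < 2 / p := not_le.1 hω
    constructor
    · intro k hk h hh g hg
      have hj : (k, h, g) ∈ J := by
        simp only [hJ, Finset.mem_product, Finset.mem_range]
        exact ⟨hk, by omega, hg⟩
      have h1 : sc (k, h, g) ω ≤ ∑ j ∈ J, sc j ω :=
        Finset.single_le_sum (f := fun j => sc j ω) (fun j _ => (Real.exp_pos _).le) hj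
      have h2 : (∑ j ∈ J, sc j ω) / q ≤ 2 / p := by
        have := Real.exp_pos (-c / (4 * H) *
          M.martingalePart W β sel (runLog M.toEpisodicMDP s a ω) P
          - (∑ _k ∈ Finset.range K, ∑ h ∈ Finset.range H, if h + 1 < H then c ^ 2 / 2 else 0))
        exact (le_add_of_nonneg_right this.le).trans hYω.le
      rw [Real.le_log_iff_exp_le (by positivity)]
      rw [div_le_iff₀ hq0] at h2
      calc _ ≤ _ := h1.trans h2
        _ = _ := by ring
    · have h1 : az ω ≤ 2 / p := by
        refine (le_add_of_nonneg_left ?_).trans hYω.le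
        exact div_nonneg (Finset.sum_nonneg fun j _ => (Real.exp_pos _).le) hq0.le
      rw [haz, ← Real.le_log_iff_exp_le (by positivity)] at h1
      have h2 : (∑ _k ∈ Finset.range K, ∑ h ∈ Finset.range H, if h + 1 < H then c ^ 2 / 2 else 0)
          ≤ ((K * H : ℕ) : ℝ) * (c ^ 2 / 2) := by
        calc _ ≤ ∑ _k ∈ Finset.range K, ∑ _h ∈ Finset.range H, c ^ 2 / 2 := by
              refine Finset.sum_le_sum fun k _ => Finset.sum_le_sum fun h _ => ?_
              split_ifs
              · exact le_rfl
              · positivity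
          _ = _ := by simp [mul_assoc]
      set m := M.martingalePart W β sel (runLog M.toEpisodicMDP s a ω) P
      have h3 : c * (-m / (4 * H)) ≤ Real.log (2 / p) + ((K * H : ℕ) : ℝ) * (c ^ 2 / 2) := by
        have e : c * (-m / (4 * H)) = -c / (4 * H) * m := by ring
        rw [e]; linarith
      have h4 : -m / (4 * H) ≤ Real.log (2 / p) / c + c * ((K * H : ℕ) : ℝ) / 2 := by
        have e : Real.log (2 / p) / c + c * ((K * H : ℕ) : ℝ) / 2
            = (Real.log (2 / p) + ((K * H : ℕ) : ℝ) * (c ^ 2 / 2)) / c := by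
          field_simp
        rw [e, le_div_iff₀ hc]; linarith
      rw [div_le_iff₀ (by positivity)] at h4
      linarith

end Event

/-! ### Choice of the discretization and of the bonus factor -/

section Constants

set_option maxHeartbeats 1000000 in
/-- A bonus factor `β = c d H √ℓ` with `c ≥ 1000` covers the noise, after discretization of a box of
polynomial size with polynomially small mesh, and the regularization bias. -/
lemma exists_discretization {d K H L : ℕ} (hd : 0 < d) (hK : 0 < K) (hH : 0 < H) (hLK : L ≤ K)
    {p c : ℝ} (hp0 : 0 < p) (hp1 : p < 1) (hc : 1000 ≤ c) {ℓ β : ℝ}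
    (hℓ : ℓ = Real.log (2 * d * ((K * H : ℕ) : ℝ) / p)) (hβ : β = c * d * H * √ℓ) :
    ∃ (ε t R : ℝ) (N : ℕ), 0 < ε ∧ 0 < t ∧ d * ε ≤ 1 ∧ R / ε ≤ N ∧ t ≤ R ∧ 1 ≤ R ∧
      L * (1 + (H : ℝ)) ≤ R ∧ L * (t * (d * ε + β * (d * √ε)) + (2 + t) * (d * ε)) ≤ 1 ∧
      0 ≤ Real.log (2 * (((K * H : ℕ) : ℝ) * (grid d N).card) / p) ∧
      2 * H * ((Real.log (2 * (((K * H : ℕ) : ℝ) * (grid d N).card) / p) + 1) / t + t / 2)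
        + √d * (1 + H) ≤ β := by
  set Z : ℝ := 2 * d * ((K * H : ℕ) : ℝ) / p with hZ
  have hd1 : (1 : ℝ) ≤ d := by exact_mod_cast hd
  have hK1 : (1 : ℝ) ≤ K := by exact_mod_cast hK
  have hH1 : (1 : ℝ) ≤ H := by exact_mod_cast hH
  have hL : (L : ℝ) ≤ K := by exact_mod_cast hLK
  have hL0 : (0 : ℝ) ≤ L := Nat.cast_nonneg _
  have hc0 : 0 < c := by linarith
  -- `Z` dominates all quantities of the problem
  have hZ1 : 2 * d * (K * H) ≤ Z := by
    rw [hZ, le_div_iff₀ hp0]; push_cast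
    exact mul_le_of_le_one_right (by positivity) hp1.le
  have hKH : (1 : ℝ) ≤ K * H := one_le_mul_of_one_le_of_one_le hK1 hH1
  have hdH : (d : ℝ) * H ≤ Z := by
    refine le_trans ?_ hZ1
    have h1 : (d : ℝ) * H ≤ d * (K * H) := by
      gcongr; exact le_mul_of_one_le_left (by linarith) hK1
    linarith [show (0 : ℝ) ≤ d * (K * H) by positivity]
  have hZ2 : 2 ≤ Z := by
    refine le_trans ?_ hZ1
    linarith [one_le_mul_of_one_le_of_one_le hd1 hKH]
  have hdZ : (d : ℝ) ≤ Z := (le_mul_of_one_le_right (by linarith) hH1).trans hdH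
  have hLHZ : L * (1 + (H : ℝ)) ≤ Z := by
    refine le_trans ?_ hZ1
    have h1 : L * (1 + (H : ℝ)) ≤ K * (2 * H) := by gcongr; linarith
    have h2 : (K : ℝ) * H ≤ d * (K * H) := le_mul_of_one_le_left (by positivity) hd1
    linarith
  have hLZ : (L : ℝ) ≤ Z := (le_mul_of_one_le_right hL0 (by linarith)).trans hLHZ
  have hZ0 : 0 < Z := by linarith
  have hℓlog2 : Real.log 2 ≤ ℓ := by rw [hℓ]; exact Real.log_le_log two_pos hZ2
  have hlog2 := Real.log_two_gt_d9
  have hlog2' := Real.log_two_lt_d9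
  have hℓ2 : 1 / 2 ≤ ℓ := by linarith
  have hℓZ : ℓ ≤ Z := by rw [hℓ]; linarith [Real.log_le_sub_one_of_pos hZ0]
  have hsℓ : √ℓ ≤ Z := by
    rw [Real.sqrt_le_left hZ0.le]
    exact hℓZ.trans (le_self_pow₀ (by linarith) two_ne_zero)
  have hsℓ2 : 1 / 2 ≤ √ℓ := by
    rw [Real.le_sqrt (by norm_num) (by linarith)]; linarith
  have hsq : √ℓ * √ℓ = ℓ := Real.mul_self_sqrt (by linarith)
  have hsℓ0 : 0 < √ℓ := by linarith
  -- the logarithm `ι` of the number of grid points is of order `d² ℓ`, so that this choice of `t`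
  -- balances `ι / t` and `t`
  set t : ℝ := d * √ℓ with ht
  have ht0 : 0 < t := by positivity
  have htZ : t ≤ Z ^ 2 := by
    rw [sq]; exact mul_le_mul hdZ hsℓ hsℓ0.le hZ0.le
  have hβ0 : 0 ≤ β := by rw [hβ]; positivity
  have hβZ : β ≤ c * Z ^ 2 := by
    rw [hβ, sq, mul_assoc c, mul_assoc c]
    gcongr
  -- the mesh is `e ^ 2`, because the values are only Hölder continuous, of exponent `1 / 2`, in the
  -- matrix parameter
  set e : ℝ := 1 / (16 * c * Z ^ 6) with he
  have he0 : 0 < e := by positivity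
  have hse : √(e ^ 2) = e := Real.sqrt_sq he0.le
  have hZ6 : (1 : ℝ) ≤ Z ^ 6 := one_le_pow₀ (by linarith)
  have he1 : e ≤ 1 := by
    rw [he, div_le_one (by positivity)]
    exact one_le_mul_of_one_le_of_one_le (by linarith) hZ6
  have heZ : c * Z ^ 6 * e = 1 / 16 := by rw [he]; field_simp
  -- both error terms are at most `Z⁻³ / 16`
  have hdε : d * e ^ 2 ≤ 1 / (16 * Z ^ 3) := by
    rw [le_div_iff₀ (by positivity)]
    calc d * e ^ 2 * (16 * Z ^ 3) ≤ Z * e ^ 2 * (16 * Z ^ 3) := by gcongr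
      _ = 16 * (Z ^ 4 * e) * e := by ring
      _ ≤ 16 * (c * Z ^ 6 * e) * 1 := by
          have : Z ^ 4 ≤ c * Z ^ 6 := by
            have h1 : Z ^ 4 ≤ Z ^ 6 := pow_le_pow_right₀ (by linarith) (by norm_num)
            have h2 : Z ^ 6 ≤ c * Z ^ 6 := le_mul_of_one_le_left (by positivity) (by linarith)
            linarith
          gcongr
      _ = 1 := by rw [heZ]; norm_num
  have hβε : β * (d * √(e ^ 2)) ≤ 1 / (16 * Z ^ 3) := by
    rw [hse, le_div_iff₀ (by positivity)]
    calc β * (d * e) * (16 * Z ^ 3) ≤ c * Z ^ 2 * (Z * e) * (16 * Z ^ 3) := by gcongr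
      _ = 16 * (c * Z ^ 6 * e) := by ring
      _ = 1 := by rw [heZ]; norm_num
  have hZ3 : (1 : ℝ) ≤ Z ^ 3 := one_le_pow₀ (by linarith)
  have hZsq : 4 ≤ Z ^ 2 := by nlinarith only [hZ2]
  set N : ℕ := ⌈Z ^ 2 / e ^ 2⌉₊ with hN
  have hcard : 1 ≤ ((grid d N).card : ℝ) := by
    rw [card_grid]
    exact_mod_cast Nat.one_le_pow _ _ (by positivity)
  have hT1 : (1 : ℝ) ≤ ((K * H : ℕ) : ℝ) := by push_cast; exact hKH
  have hι0 : 0 ≤ Real.log (2 * (((K * H : ℕ) : ℝ) * (grid d N).card) / p) := by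
    refine Real.log_nonneg ?_
    rw [le_div_iff₀ hp0]
    linarith [one_le_mul_of_one_le_of_one_le hT1 hcard]
  refine ⟨e ^ 2, t, Z ^ 2, N, by positivity, ht0, ?_, Nat.le_ceil _, htZ, by linarith,
    hLHZ.trans (le_self_pow₀ (by linarith) two_ne_zero), ?_, hι0, ?_⟩
  · refine hdε.trans ?_
    rw [div_le_one (by positivity)]; linarith
  · calc L * (t * (d * e ^ 2 + β * (d * √(e ^ 2))) + (2 + t) * (d * e ^ 2))
        ≤ Z * (Z ^ 2 * (1 / (16 * Z ^ 3) + 1 / (16 * Z ^ 3))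
            + (2 + Z ^ 2) * (1 / (16 * Z ^ 3))) := by
          gcongr
      _ = 3 / 16 + 1 / (8 * Z ^ 2) := by field_simp; ring
      _ ≤ 1 := by
          have : 1 / (8 * Z ^ 2) ≤ 1 / 32 := by
            apply one_div_le_one_div_of_le <;> linarith
          linarith
  · -- the tangent of the logarithm at `128`: the slope is small, so that
    -- `c` absorbs `24 * log c`
    have hlogc : Real.log c ≤ c / 128 + 4 := by
      have h1 := Real.log_le_sub_one_of_pos (show 0 < c / 128 by positivity)
      rw [Real.log_div (by positivity) (by norm_num),
        show (128 : ℝ) = 2 ^ 7 by norm_num, Real.log_pow] at h1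
      push_cast at h1
      norm_num at h1 ⊢
      linarith
    have hlogc0 : 0 ≤ Real.log c := Real.log_nonneg (by linarith)
    have h2N : ((2 * N + 1 : ℕ) : ℝ) ≤ 2 ^ 10 * c ^ 2 * Z ^ 14 := by
      have h1 := (Nat.ceil_lt_add_one (show 0 ≤ Z ^ 2 / e ^ 2 by positivity)).le
      have h2 : Z ^ 2 / e ^ 2 = 256 * (c ^ 2 * Z ^ 14) := by
        rw [he]; field_simp; ring
      have h3 : 1 ≤ c ^ 2 * Z ^ 14 := one_le_mul_of_one_le_of_one_le
        (one_le_pow₀ (by linarith)) (one_le_pow₀ (by linarith))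
      push_cast
      rw [← hN, h2] at h1
      linarith
    have hlogN : Real.log ((2 * N + 1 : ℕ) : ℝ) ≤ 24 * ℓ + 2 * Real.log c := by
      have h1 := Real.log_le_log (by positivity) h2N
      rw [Real.log_mul (by positivity) (by positivity), Real.log_mul (by positivity)
        (by positivity), Real.log_pow, Real.log_pow, Real.log_pow, ← hℓ] at h1
      push_cast at h1 ⊢
      linarith
    have hlogN0 : 0 ≤ Real.log ((2 * N + 1 : ℕ) : ℝ) :=
      Real.log_nonneg (by exact_mod_cast Nat.le_add_left 1 (2 * N))
    have hι : Real.log (2 * (((K * H : ℕ) : ℝ) * (grid d N).card) / p) + 1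
        ≤ d ^ 2 * ℓ * (75 + 12 * Real.log c) := by
      have e1 : 2 * (((K * H : ℕ) : ℝ) * (grid d N).card) / p
          = 2 * ((K * H : ℕ) : ℝ) / p * ((2 * N + 1 : ℕ) : ℝ) ^ (d + (d + d * d)) := by
        rw [card_grid]; push_cast; ring
      rw [e1, Real.log_mul (by positivity) (by positivity), Real.log_pow]
      have h1 : Real.log (2 * ((K * H : ℕ) : ℝ) / p) ≤ ℓ := by
        rw [hℓ]
        refine Real.log_le_log (by positivity) ?_
        rw [hZ]
        gcongr
        linarith
      have h2 : ((d + (d + d * d) : ℕ) : ℝ) ≤ 3 * d ^ 2 := by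
        have := le_mul_of_one_le_left (show (0 : ℝ) ≤ d by linarith) hd1
        push_cast; rw [sq]; linarith
      have h3 : ((d + (d + d * d) : ℕ) : ℝ) * Real.log ((2 * N + 1 : ℕ) : ℝ)
          ≤ 3 * d ^ 2 * (24 * ℓ + 2 * Real.log c) := by gcongr
      have h4 : Real.log c ≤ 2 * ℓ * Real.log c := le_mul_of_one_le_left hlogc0 (by linarith)
      have h5 : (1 : ℝ) ≤ d ^ 2 := one_le_pow₀ hd1
      have h6 : 3 * d ^ 2 * (24 * ℓ + 2 * Real.log c)
          ≤ 3 * d ^ 2 * (24 * ℓ + 4 * (ℓ * Real.log c)) := by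
        exact mul_le_mul_of_nonneg_left (by linarith) (by positivity)
      have h7 : 3 * ℓ ≤ d ^ 2 * (3 * ℓ) := le_mul_of_one_le_left (by linarith) h5
      calc _ ≤ 3 * ℓ + 3 * d ^ 2 * (24 * ℓ + 4 * (ℓ * Real.log c)) := by linarith
        _ ≤ d ^ 2 * (3 * ℓ) + 3 * d ^ 2 * (24 * ℓ + 4 * (ℓ * Real.log c)) := by linarith
        _ = _ := by ring
    have h1 : (Real.log (2 * (((K * H : ℕ) : ℝ) * (grid d N).card) / p) + 1) / t
        ≤ d * √ℓ * (75 + 12 * Real.log c) := by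
      rw [div_le_iff₀ ht0, ht]
      refine hι.trans (le_of_eq ?_)
      linear_combination (-(d ^ 2 * (75 + 12 * Real.log c))) * hsq
    have h2 : √(d : ℝ) ≤ d := by
      rw [Real.sqrt_le_left (by linarith)]; exact le_self_pow₀ hd1 two_ne_zero
    have h3 : √(d : ℝ) * (1 + H) ≤ d * H * √ℓ * 4 := by
      calc √(d : ℝ) * (1 + H) ≤ d * (2 * H) := by gcongr; linarith
        _ = d * H * (1 / 2) * 4 := by ring
        _ ≤ _ := by gcongr
    calc _ ≤ 2 * H * (d * √ℓ * (75 + 12 * Real.log c) + t / 2) + d * H * √ℓ * 4 := by gcongr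
      _ = d * H * √ℓ * (155 + 24 * Real.log c) := by rw [ht]; ring
      _ ≤ d * H * √ℓ * c := by gcongr; linarith
      _ = β := by rw [hβ]; ring

end Constants

/-! ### Sums over the episodes -/

section Sums

open Matrix

variable {S A : Type*} [MeasurableSpace S] [MeasurableSpace A] {d H K : ℕ}

lemma sub_epochStart_lt {H W : ℕ} (hL : 0 < W / H) (k : ℕ) : k - epochStart H W k < W / H := by
  have h1 := Nat.mod_lt k hL
  have h2 := Nat.div_add_mod' k (W / H)
  rw [epochStart]; omega

lemma epochStart_eq_of_le {H W j k : ℕ} (hL : 0 < W / H) (h1 : epochStart H W k ≤ j)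
    (h2 : j ≤ k) : epochStart H W j = epochStart H W k := by
  have h3 : k / (W / H) ≤ j / (W / H) := (Nat.le_div_iff_mul_le hL).2 h1
  rw [epochStart, epochStart, le_antisymm (Nat.div_le_div_right h2) h3]

/-- The total variation of the parameters of step `h` in the epoch of episode `k`. -/
noncomputable def LinearMDP.epochVariation (M : LinearMDP S A d H K) (W k h : ℕ) : ℝ :=
  ∑ j ∈ Finset.Ico 1 K with epochStart H W j = epochStart H W k, M.variation j h

lemma LinearMDP.epochVariation_nonneg (M : LinearMDP S A d H K) (W k h : ℕ) :
    0 ≤ M.epochVariation W k h :=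
  Finset.sum_nonneg fun j _ => M.variation_nonneg j h

lemma LinearMDP.sum_variation_le_epochVariation (M : LinearMDP S A d H K) {W k l : ℕ}
    (hL : 0 < W / H) (hk : k < K) (hl : l ∈ Finset.Ico (epochStart H W k) k) (h : ℕ) :
    ∑ j ∈ Finset.Ioc l k, M.variation j h ≤ M.epochVariation W k h := by
  refine Finset.sum_le_sum_of_subset_of_nonneg (fun j hj => ?_) fun j _ _ => M.variation_nonneg j h
  have hl' := Finset.mem_Ico.1 hl
  have hj' := Finset.mem_Ioc.1 hj
  exact Finset.mem_filter.2 ⟨Finset.mem_Ico.2 ⟨by omega, by omega⟩,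
    epochStart_eq_of_le hL (by omega) hj'.2⟩

/-- Every change of the parameters is counted once for each of the at most `W / H` episodes of its
epoch. -/
lemma LinearMDP.sum_epochVariation_le (M : LinearMDP S A d H K) {W : ℕ} (hL : 0 < W / H) :
    ∑ k ∈ Finset.range K, ∑ h ∈ Finset.range H, M.epochVariation W k h
      ≤ (W / H : ℕ) * (M.Btheta + H * M.Bmu) := by
  have hcard : ∀ j, (((Finset.range K).filter
      fun k => epochStart H W j = epochStart H W k).card : ℝ) ≤ (W / H : ℕ) := by
    intro j
    have hsub : (Finset.range K).filter (fun k => epochStart H W j = epochStart H W k)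
        ⊆ Finset.Ico (epochStart H W j) (epochStart H W j + W / H) := by
      intro k hk
      rw [(Finset.mem_filter.1 hk).2, Finset.mem_Ico]
      have h1 := sub_epochStart_lt hL k
      have h2 : epochStart H W k ≤ k := Nat.div_mul_le_self _ _
      omega
    have := Finset.card_le_card hsub
    rw [Nat.card_Ico, Nat.add_sub_cancel_left] at this
    exact_mod_cast this
  have htot : ∑ j ∈ Finset.Ico 1 K, ∑ h ∈ Finset.range H, M.variation j h
      = M.Btheta + H * M.Bmu := by
    simp only [variation, Btheta, Bmu, Finset.sum_add_distrib, Finset.mul_sum]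
  calc _ = ∑ h ∈ Finset.range H, ∑ j ∈ Finset.Ico 1 K, ∑ k ∈ Finset.range K,
        if epochStart H W j = epochStart H W k then M.variation j h else 0 := by
        rw [Finset.sum_comm]
        refine Finset.sum_congr rfl fun h _ => ?_
        rw [Finset.sum_comm]
        exact Finset.sum_congr rfl fun k _ => by rw [epochVariation, Finset.sum_filter]
    _ ≤ ∑ h ∈ Finset.range H, ∑ j ∈ Finset.Ico 1 K, (W / H : ℕ) * M.variation j h := by
        refine Finset.sum_le_sum fun h _ => Finset.sum_le_sum fun j _ => ?_
        rw [← Finset.sum_filter, Finset.sum_const, nsmul_eq_mul]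
        exact mul_le_mul_of_nonneg_right (hcard j) (M.variation_nonneg j h)
    _ = _ := by
        rw [← htot, Finset.sum_comm, Finset.mul_sum]
        simp only [Finset.mul_sum]

/-- The elliptical potential bound, summed over the epochs. -/
lemma LinearMDP.sum_sq_bonus_le (M : LinearMDP S A d H K) (W : ℕ) (D : Log S A) (h : ℕ)
    (hL : 0 < W / H) :
    ∑ k ∈ Finset.range K, bonus M.φ H W D k h (D.state k h) (D.action k h) ^ 2
      ≤ (K / (W / H) + 1 : ℕ) * (2 * (d * Real.log ((d + W / H : ℕ) : ℝ))) := by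
  set L := W / H with hLdef
  have hbon : ∀ k, bonus M.φ H W D k h (D.state k h) (D.action k h) ^ 2 = feat M.φ D h k ⬝ᵥ
      (regGram (Finset.Ico (k / L * L) k) (feat M.φ D h))⁻¹ *ᵥ feat M.φ D h k := fun k =>
    Real.sq_sqrt (dotProduct_regGram_inv_mulVec_self_nonneg _ _ _)
  have hK : K ≤ (K / L + 1) * L := by
    have h1 := Nat.div_add_mod' K L
    have h2 := Nat.mod_lt K hL
    rw [add_mul]; omega
  calc _ ≤ ∑ k ∈ Finset.range ((K / L + 1) * L),
        bonus M.φ H W D k h (D.state k h) (D.action k h) ^ 2 :=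
        Finset.sum_le_sum_of_subset_of_nonneg (Finset.range_mono hK) fun _ _ _ => sq_nonneg _
    _ = ∑ e ∈ Finset.range (K / L + 1), ∑ i ∈ Finset.range L, feat M.φ D h (e * L + i) ⬝ᵥ
        (regGram (Finset.Ico (e * L) (e * L + i)) (feat M.φ D h))⁻¹ *ᵥ
          feat M.φ D h (e * L + i) := by
        rw [← sum_range_mul_eq]
        refine Finset.sum_congr rfl fun k _ => ?_
        rw [hbon, Nat.div_add_mod']
    _ ≤ ∑ e ∈ Finset.range (K / L + 1), 2 * (d * Real.log ((d + L : ℕ) : ℝ)) := by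
        refine Finset.sum_le_sum fun e _ => ?_
        have := sum_dotProduct_regGram_inv_le (feat M.φ D h)
          (fun l => M.dotProduct_feature_le_one _ _) (e * L) L
        rwa [Fintype.card_fin] at this
    _ = _ := by simp

lemma LinearMDP.sum_bonus_le (M : LinearMDP S A d H K) {W : ℕ} (D : Log S A) (h : ℕ)
    (hL : 0 < W / H) (hLK : W / H ≤ K) {ℓ : ℝ} (hℓ : Real.log ((d + W / H : ℕ) : ℝ) ≤ ℓ) :
    ∑ k ∈ Finset.range K, bonus M.φ H W D k h (D.state k h) (D.action k h)
      ≤ 2 * K * √(d * ℓ / (W / H : ℕ)) := by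
  have h1 := M.sum_sq_bonus_le W D h hL
  set L := W / H with hLdef
  have hL0 : (0 : ℝ) < L := by exact_mod_cast hL
  have hℓ0 : 0 ≤ ℓ := (Real.log_natCast_nonneg _).trans hℓ
  have hq : ((K / L + 1 : ℕ) : ℝ) ≤ 2 * K / L := by
    have h2 : (1 : ℝ) ≤ K / L := (one_le_div hL0).2 (by exact_mod_cast hLK)
    have h3 : ((K / L : ℕ) : ℝ) ≤ K / L := Nat.cast_div_le
    push_cast
    rw [mul_div_assoc]; linarith
  have h2 := Real.sum_mul_le_sqrt_mul_sqrt (Finset.range K) (fun _ => (1 : ℝ))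
    fun k => bonus M.φ H W D k h (D.state k h) (D.action k h)
  simp only [one_mul, one_pow, Finset.sum_const, Finset.card_range, nsmul_eq_mul, mul_one] at h2
  refine h2.trans ?_
  rw [← Real.sqrt_mul (Nat.cast_nonneg K)]
  refine Real.sqrt_le_iff.2 ⟨by positivity, ?_⟩
  rw [mul_pow, mul_pow, Real.sq_sqrt (by positivity)]
  calc _ ≤ K * (2 * K / L * (2 * (d * ℓ))) := by
        gcongr
        exact h1.trans (by gcongr)
    _ = _ := by ring

end Sums

/-! ### The dynamic regret -/

section Regret

variable {S A : Type*} [MeasurableSpace S] [MeasurableSpace A] {d H K : ℕ}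

/-- A linear MDP has positive dimension, because its transition probabilities do not vanish. -/
lemma LinearMDP.dimension_pos (M : LinearMDP S A d H K) (hK : 0 < K) (hH : 0 < H) (s : S) (a : A) :
    0 < d := by
  rcases Nat.eq_zero_or_pos d with rfl | hd
  · have := M.isMarkov 0 hK 0 hH
    have h := M.transition_eq 0 hK 0 hH s a Set.univ MeasurableSet.univ
    simp at h
  · exact hd

lemma LinearMDP.Btheta_nonneg (M : LinearMDP S A d H K) : 0 ≤ M.Btheta :=
  Finset.sum_nonneg fun _ _ => Finset.sum_nonneg fun _ _ => norm_nonneg _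

lemma LinearMDP.Bmu_nonneg (M : LinearMDP S A d H K) : 0 ≤ M.Bmu :=
  Finset.sum_nonneg fun _ _ => Finset.sum_nonneg fun _ _ => norm_nonneg _

/-- An episode with little variation in its epoch is analysed through optimism; in any other
episode the drift term alone exceeds the trivial bound `H` on the regret. -/
lemma dynRegret_le [Finite A] [MeasurableSingletonClass A] (M : LinearMDP S A d H K) {W L : ℕ}
    {β N ℓ : ℝ} {sel : (A → ℝ) → A} (hselm : Measurable sel)
    (hsel : ∀ (f : A → ℝ) (b : A), f b ≤ f (sel f)) {Ω : Type*} {s : ℕ → ℕ → Ω → S}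
    {a : ℕ → ℕ → Ω → A} {ω : Ω} (hH : 0 < H) (hL : 0 < L) (hWL : W / H = L) (hLK : L ≤ K)
    (hβ : 0 ≤ β) (hℓ : Real.log ((d + L : ℕ) : ℝ) ≤ ℓ) (P : ℕ → Prop) [DecidablePred P]
    (hP : ∀ k, P k ↔ √L * ∑ h ∈ Finset.range H, M.epochVariation W k h ≤ 1)
    (hact : ∀ k < K, ∀ h < H, a k h ω =
      greedyPolicy M.φ H W β sel (runLog M.toEpisodicMDP s a ω) k h (s k h ω))
    (hgood : ∀ k < K, P k → M.GoodEpisode W β (runLog M.toEpisodicMDP s a ω) k L N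
      (M.epochVariation W k)) :
    dynRegret M W β sel s a ω ≤ 2 * β * (H * (2 * K * √(d * ℓ / L)))
      + 2 * H * (√L * (L * (M.Btheta + H * M.Bmu)))
      - M.martingalePart W β sel (runLog M.toEpisodicMDP s a ω) P := by
  set D := runLog M.toEpisodicMDP s a ω with hD
  set b : ℕ → ℕ → ℝ := fun k h => bonus M.φ H W D k h (D.state k h) (D.action k h) with hb
  have hb0 : ∀ k h, 0 ≤ b k h := fun k h => Real.sqrt_nonneg _
  have hH1 : (1 : ℝ) ≤ H := by exact_mod_cast hH
  have hv0 : ∀ k, 0 ≤ √L * ∑ h ∈ Finset.range H, M.epochVariation W k h := fun k =>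
    mul_nonneg (Real.sqrt_nonneg _)
      (Finset.sum_nonneg fun h _ => M.epochVariation_nonneg W k h)
  have hepisode : ∀ k ∈ Finset.range K, M.optimalValue k 0 (s k 0 ω)
      - M.policyValue k (greedyPolicy M.φ H W β sel D k) 0 (s k 0 ω)
      ≤ 2 * β * ∑ h ∈ Finset.range H, b k h
        + 2 * H * (√L * ∑ h ∈ Finset.range H, M.epochVariation W k h)
        - if P k then ∑ h ∈ Finset.range H, if h + 1 < H then
            M.noise D (M.valueGap W β D k (greedyPolicy M.φ H W β sel D k) (h + 1)) h k
          else 0 else 0 := by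
    intro k hk
    have hk' := Finset.mem_range.1 hk
    by_cases hPk : P k
    · have h1 := (hgood k hk' hPk).regret_le hselm hsel (hact k hk')
      rw [Finset.sum_sub_distrib, Finset.sum_add_distrib, ← Finset.mul_sum, ← Finset.mul_sum,
        ← Finset.mul_sum] at h1
      rw [if_pos hPk]
      have h2 := mul_le_mul_of_nonneg_right (show (2 : ℝ) ≤ 2 * H by linarith) (hv0 k)
      refine h1.trans ?_
      linarith
    · have h1 := M.optimalValue_sub_policyValue_le hk'
        (M.measurable_greedyPolicy_const W β hselm D k) (s k 0 ω)
      have h2 : 1 ≤ √L * ∑ h ∈ Finset.range H, M.epochVariation W k h :=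
        (not_le.1 fun h => hPk ((hP k).2 h)).le
      have h3 : 0 ≤ 2 * β * ∑ h ∈ Finset.range H, b k h :=
        mul_nonneg (by positivity) (Finset.sum_nonneg fun h _ => hb0 k h)
      have h4 := mul_le_mul_of_nonneg_left h2 (show (0 : ℝ) ≤ 2 * H by positivity)
      rw [if_neg hPk]
      linarith
  have hbonus : ∑ k ∈ Finset.range K, ∑ h ∈ Finset.range H, b k h
      ≤ H * (2 * K * √(d * ℓ / L)) := by
    rw [Finset.sum_comm]
    calc _ ≤ ∑ _h ∈ Finset.range H, 2 * K * √(d * ℓ / L) := by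
          refine Finset.sum_le_sum fun h _ => ?_
          have := M.sum_bonus_le (W := W) D h (hWL ▸ hL) (hWL ▸ hLK) (hWL ▸ hℓ)
          rwa [hWL] at this
      _ = _ := by simp
  have hdrift := M.sum_epochVariation_le (W := W) (hWL ▸ hL)
  rw [hWL] at hdrift
  calc dynRegret M W β sel s a ω ≤ _ := Finset.sum_le_sum hepisode
    _ = 2 * β * (∑ k ∈ Finset.range K, ∑ h ∈ Finset.range H, b k h)
        + 2 * H * (√L * ∑ k ∈ Finset.range K, ∑ h ∈ Finset.range H, M.epochVariation W k h)
        - M.martingalePart W β sel D P := by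
        rw [Finset.sum_sub_distrib, Finset.sum_add_distrib, ← Finset.mul_sum, ← Finset.mul_sum,
          ← Finset.mul_sum]
        rfl
    _ ≤ _ := by gcongr

lemma rpow_three_halves {x : ℝ} (hx : 0 < x) : x ^ (3 / 2 : ℝ) = x * √x := by
  rw [Real.sqrt_eq_rpow, show (3 / 2 : ℝ) = 1 + 1 / 2 by norm_num, Real.rpow_add hx, Real.rpow_one]

lemma rpow_neg_half {x : ℝ} (hx : 0 < x) : x ^ (-(1 / 2) : ℝ) = (√x)⁻¹ := by
  rw [Real.sqrt_eq_rpow, Real.rpow_neg hx.le]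

/-- The contributions of the bonuses, of the drift and of the martingale to the regret, for an epoch
of `L` episodes, in terms of the epoch length `L * H`. -/
lemma regret_terms_le {d H K L : ℕ} (hd : 0 < d) (hH : 0 < H) (hL : 0 < L) (hLK : L ≤ K)
    {c ℓ x y : ℝ} (hc : 0 ≤ c) (hℓ : 1 / 2 ≤ ℓ) (hx : 0 ≤ x) (hy : 0 ≤ y) :
    2 * (c * d * H * √ℓ) * (H * (2 * K * √(d * ℓ / L))) + 2 * H * (√L * (L * (x + H * y)))
        + 6 * H * √(ℓ * ((K * H : ℕ) : ℝ))
      ≤ (4 * c + 12) * ℓ * (((L * H : ℕ) : ℝ) ^ (-(1 / 2) : ℝ) * ((K * H : ℕ) : ℝ)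
            * (d : ℝ) ^ (3 / 2 : ℝ) * (H : ℝ) ^ (3 / 2 : ℝ)
          + x * (d : ℝ) ^ (1 / 2 : ℝ) * (H : ℝ) ^ (-(1 / 2) : ℝ)
            * ((L * H : ℕ) : ℝ) ^ (3 / 2 : ℝ)
          + y * (d : ℝ) ^ (1 / 2 : ℝ) * (H : ℝ) ^ (1 / 2 : ℝ)
            * ((L * H : ℕ) : ℝ) ^ (3 / 2 : ℝ)) := by
  have hd1 : (1 : ℝ) ≤ d := by exact_mod_cast hd
  have hH1 : (1 : ℝ) ≤ H := by exact_mod_cast hH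
  have hL1 : (1 : ℝ) ≤ L := by exact_mod_cast hL
  have hLK' : (L : ℝ) ≤ K := by exact_mod_cast hLK
  have hK1 : (1 : ℝ) ≤ K := hL1.trans hLK'
  push_cast
  rw [rpow_neg_half (by positivity), rpow_neg_half (by positivity), rpow_three_halves
    (by positivity), rpow_three_halves (by positivity), rpow_three_halves (by positivity),
    ← Real.sqrt_eq_rpow, ← Real.sqrt_eq_rpow, Real.sqrt_div (by positivity),
    Real.sqrt_mul (by positivity), Real.sqrt_mul (by positivity), Real.sqrt_mul (by positivity),
    Real.sqrt_mul (by positivity)]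
  have hsd : (1 : ℝ) ≤ √d := Real.one_le_sqrt.2 hd1
  have hsH : (1 : ℝ) ≤ √H := Real.one_le_sqrt.2 hH1
  have hsL : (1 : ℝ) ≤ √L := Real.one_le_sqrt.2 hL1
  have hsK : √L ≤ √K := Real.sqrt_le_sqrt hLK'
  have hsℓ : 1 / 2 ≤ √ℓ := by
    rw [Real.le_sqrt (by norm_num) (by linarith)]; linarith
  have qℓ : √ℓ * √ℓ = ℓ := Real.mul_self_sqrt (by linarith)
  have qH : √(H : ℝ) * √H = H := Real.mul_self_sqrt (by linarith)
  have qK : √(K : ℝ) * √K = K := Real.mul_self_sqrt (by linarith)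
  have e1 : (√(L : ℝ) * √H)⁻¹ * (K * H) * (d * √d) * (H * √H)
      = K * H ^ 2 * (d * √d) / √L := by field_simp
  have e2 : x * √d * (√(H : ℝ))⁻¹ * (L * H * (√L * √H)) = H * (√L * (L * x)) * √d := by
    field_simp
  have e3 : y * √d * √(H : ℝ) * (L * H * (√L * √H)) = H * (√L * (L * (H * y))) * √d := by
    linear_combination (y * √d * L * H * √L) * qH
  rw [e1, e2, e3]
  set X := K * H ^ 2 * (d * √d) / √(L : ℝ) with hX
  set u := H * (√(L : ℝ) * (L * x)) with hu
  set v := H * (√(L : ℝ) * (L * (H * y))) with hv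
  have hX0 : 0 ≤ X := by positivity
  have hu0 : 0 ≤ u := by positivity
  have hv0 : 0 ≤ v := by positivity
  have t1 : 2 * (c * d * H * √ℓ) * (H * (2 * K * (√d * √ℓ / √L))) = 4 * c * ℓ * X := by
    rw [hX]; field_simp; linear_combination (4 * c) * qℓ
  have t3 : 6 * H * (√ℓ * (√K * √H)) ≤ 12 * ℓ * X := by
    have h1 : √ℓ ≤ 2 * ℓ := by
      calc √ℓ ≤ 2 * (√ℓ * √ℓ) := by nlinarith only [hsℓ]
        _ = _ := by rw [qℓ]
    have h2 : √(K : ℝ) * √H ≤ K * H / √L := by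
      rw [le_div_iff₀ (by positivity)]
      calc √(K : ℝ) * √H * √L ≤ √K * √H * √K := by gcongr
        _ = (√K * √K) * √H := by ring
        _ = K * √H := by rw [qK]
        _ ≤ K * (√H * √H) := by gcongr; exact le_mul_of_one_le_left (by positivity) hsH
        _ = K * H := by rw [qH]
    have h3 : H * (K * H / √(L : ℝ)) ≤ X := by
      have h4 : (1 : ℝ) ≤ d * √d := one_le_mul_of_one_le_of_one_le hd1 hsd
      calc H * (K * H / √(L : ℝ)) = K * H ^ 2 * 1 / √(L : ℝ) := by ring
        _ ≤ _ := by rw [hX]; gcongr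
    calc 6 * H * (√ℓ * (√K * √H)) ≤ 6 * H * (2 * ℓ * (K * H / √L)) := by gcongr
      _ = 12 * ℓ * (H * (K * H / √L)) := by ring
      _ ≤ _ := by gcongr
  have t2 : 2 * (u + v) ≤ (4 * c + 12) * ℓ * (u * √d + v * √d) := by
    have h1 : 2 ≤ (4 * c + 12) * ℓ := by nlinarith only [hc, hℓ]
    have h2 : u + v ≤ u * √d + v * √d :=
      add_le_add (le_mul_of_one_le_right hu0 hsd) (le_mul_of_one_le_right hv0 hsd)
    exact mul_le_mul h1 h2 (add_nonneg hu0 hv0) (by linarith)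
  have e4 : 2 * H * (√(L : ℝ) * (L * (x + H * y))) = 2 * (u + v) := by rw [hu, hv]; ring
  rw [t1, e4]
  linarith

end Regret

end NonstationaryRL

theorem mainTheorem1 :
    ∃ c₀ : ℝ, 0 < c₀ ∧ ∀ c : ℝ, c₀ ≤ c → ∃ C : ℝ, 0 < C ∧ ∃ q : ℕ,
      ∀ (S : Type*) (A : Type*) (Ω : Type*) [MeasurableSpace S] [MeasurableSpace A]
        [MeasurableSingletonClass A] [Finite A] [mΩ : MeasurableSpace Ω]
        (d H K W : ℕ) (p : ℝ) (M : NonstationaryRL.LinearMDP S A d H K)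
        (sel : (A → ℝ) → A) (Pr : Measure Ω) [IsProbabilityMeasure Pr] (ℱ : Filtration ℕ mΩ)
        (s : ℕ → ℕ → Ω → S) (a : ℕ → ℕ → Ω → A),
        0 < W → H ∣ W → W ≤ K * H → 0 < p → p < 1 →
        Measurable sel → (∀ (f : A → ℝ) (b : A), f b ≤ f (sel f)) →
        NonstationaryRL.IsRun M W
          (c * d * H * √(Real.log (2 * d * ((K * H : ℕ) : ℝ) / p))) sel Pr ℱ s a →
        ENNReal.ofReal (1 - p) ≤
          Pr {ω | NonstationaryRL.dynRegret M W
                (c * d * H * √(Real.log (2 * d * ((K * H : ℕ) : ℝ) / p))) sel s a ω ≤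
              C * Real.log (2 * d * ((K * H : ℕ) : ℝ) / p) ^ q *
                ((W : ℝ) ^ (-(1 / 2) : ℝ) * ((K * H : ℕ) : ℝ) * (d : ℝ) ^ (3 / 2 : ℝ)
                    * (H : ℝ) ^ (3 / 2 : ℝ)
                  + M.Btheta * (d : ℝ) ^ (1 / 2 : ℝ) * (H : ℝ) ^ (-(1 / 2) : ℝ)
                    * (W : ℝ) ^ (3 / 2 : ℝ)
                  + M.Bmu * (d : ℝ) ^ (1 / 2 : ℝ) * (H : ℝ) ^ (1 / 2 : ℝ)
                    * (W : ℝ) ^ (3 / 2 : ℝ))} := by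
  refine ⟨1000, by norm_num, fun c hc => ⟨4 * c + 12, by linarith, 1, ?_⟩⟩
  intro S A Ω _ _ _ _ mΩ d H K W p M sel Pr _ ℱ s a hW hdvd hWK hp0 hp1 hselm hsel run
  classical
  -- an epoch consists of `L` episodes
  obtain ⟨L, rfl⟩ := hdvd
  rw [mul_comm H L] at hW hWK run ⊢
  have hL : 0 < L := Nat.pos_of_mul_pos_right hW
  have hH : 0 < H := Nat.pos_of_mul_pos_left hW
  have hLK : L ≤ K := Nat.le_of_mul_le_mul_right hWK hH
  have hK : 0 < K := hL.trans_le hLK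
  have hWL : L * H / H = L := Nat.mul_div_cancel L hH
  obtain ⟨ω₀⟩ : Nonempty Ω := nonempty_of_isProbabilityMeasure Pr
  have hd : 0 < d := M.dimension_pos hK hH (s 0 0 ω₀) (a 0 0 ω₀)
  have : Nonempty A := ⟨sel 0⟩
  set ℓ : ℝ := Real.log (2 * d * ((K * H : ℕ) : ℝ) / p) with hℓ
  set β : ℝ := c * d * H * √ℓ with hβ
  have hc0 : 0 ≤ c := by linarith
  have hβ0 : 0 ≤ β := by positivity
  have hd1 : (1 : ℝ) ≤ d := by exact_mod_cast hd
  have hT1 : (1 : ℝ) ≤ ((K * H : ℕ) : ℝ) := by exact_mod_cast Nat.mul_pos hK hH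
  have hT0 : (0 : ℝ) < ((K * H : ℕ) : ℝ) := by linarith
  have hdT : (1 : ℝ) ≤ d * ((K * H : ℕ) : ℝ) := one_le_mul_of_one_le_of_one_le hd1 hT1
  have hp2 : Real.log (2 / p) ≤ ℓ := by
    rw [hℓ]
    refine Real.log_le_log (by positivity) ?_
    gcongr
    linarith
  have hℓ2 : 1 / 2 ≤ ℓ := by
    have h1 : Real.log 2 ≤ Real.log (2 / p) :=
      Real.log_le_log two_pos ((le_div_iff₀ hp0).2 (by linarith))
    linarith [Real.log_two_gt_d9]
  have hdL : Real.log ((d + L : ℕ) : ℝ) ≤ ℓ := by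
    rw [hℓ]
    refine Real.log_le_log (by positivity) ?_
    have h1 : (L : ℝ) ≤ ((K * H : ℕ) : ℝ) := by
      exact_mod_cast hLK.trans (Nat.le_mul_of_pos_right K hH)
    have h2 : (d : ℝ) ≤ d * ((K * H : ℕ) : ℝ) := le_mul_of_one_le_right (by linarith) hT1
    have h3 : ((K * H : ℕ) : ℝ) ≤ d * ((K * H : ℕ) : ℝ) := le_mul_of_one_le_left hT0.le hd1
    rw [le_div_iff₀ hp0]
    refine (mul_le_of_le_one_right (by positivity) hp1.le).trans ?_
    push_cast at h1 h2 h3 ⊢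
    linarith
  obtain ⟨ε, t, R, N, hε0, ht0, hdε, hN, htR, hR1, hLR, herr, hι0, hfac⟩ :=
    NonstationaryRL.exists_discretization hd hK hH hLK hp0 hp1 hc hℓ hβ
  -- whether the analysis through optimism applies depends on the parameters only
  set P : ℕ → Prop := fun k =>
    √L * ∑ h ∈ Finset.range H, M.epochVariation (L * H) k h ≤ 1 with hP
  set γ : ℝ := √(ℓ / ((K * H : ℕ) : ℝ)) with hγ
  have hγ0 : 0 < γ := Real.sqrt_pos.2 (by positivity)
  obtain ⟨E, hE, hevent⟩ := run.exists_event hselm P hH hK hγ0 hp0 ε N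
  refine hE.trans (measure_mono fun ω hω => ?_)
  obtain ⟨hscore, hmart⟩ := hevent ω hω
  have hlen : ∀ k, k - NonstationaryRL.epochStart H (L * H) k ≤ L := fun k => by
    have := NonstationaryRL.sub_epochStart_lt (H := H) (W := L * H) (by rwa [hWL]) k
    rw [hWL] at this
    exact this.le
  have hmain := NonstationaryRL.dynRegret_le M (L := L) (β := β) (ℓ := ℓ) hselm hsel (s := s)
    (a := a) (ω := ω) hH hL hWL hLK hβ0 hdL P (fun k => Iff.rfl)
    (fun k hk h hh => run.action k hk h hh ω)
    fun k hk hPk =>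
      { lt := hk
        reward := fun _ _ _ _ => rfl
        length := hlen k
        drift := fun h _ l hl =>
          M.sum_variation_le_epochVariation (by rwa [hWL]) hk hl h
        drift_nonneg := fun h => M.epochVariation_nonneg _ k h
        drift_le_one := hPk
        noise := fun h hh hV x b => M.abs_sum_noise_le hβ0 _ hk hh (hlen k)
          (fun _ _ _ _ => rfl) hV hε0 ht0 hdε hN htR hR1 hLR herr (hscore k hk h hh) x b
        le_factor := hfac
        const_nonneg := by positivity }
  -- the choice of `γ` balances the two terms of the Azuma–Hoeffding bound
  have hazuma : 4 * H * (Real.log (2 / p) / γ + γ * ((K * H : ℕ) : ℝ) / 2)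
      ≤ 6 * H * √(ℓ * ((K * H : ℕ) : ℝ)) := by
    have h1 : γ * ((K * H : ℕ) : ℝ) = √(ℓ * ((K * H : ℕ) : ℝ)) := by
      rw [hγ, Real.sqrt_div (by linarith), Real.sqrt_mul (by linarith), div_mul_eq_mul_div,
        mul_div_assoc, Real.div_sqrt]
    have h2 : γ * √(ℓ * ((K * H : ℕ) : ℝ)) = ℓ := by
      rw [← h1, ← mul_assoc, hγ, Real.mul_self_sqrt (by positivity), div_mul_cancel₀ _ hT0.ne']
    have h3 : Real.log (2 / p) / γ ≤ √(ℓ * ((K * H : ℕ) : ℝ)) := by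
      rw [div_le_iff₀ hγ0, mul_comm, h2]; exact hp2
    rw [h1]
    have h4 := mul_le_mul_of_nonneg_left h3 (show (0 : ℝ) ≤ 4 * H by positivity)
    linarith
  have hterms := NonstationaryRL.regret_terms_le hd hH hL hLK hc0 hℓ2 M.Btheta_nonneg M.Bmu_nonneg
  rw [Set.mem_ofPred_eq, pow_one]
  linarith
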